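/- **Conventions.** All complexes are finite, based, over $\mathbb F_2$: a complex $K$ is a finite graded set of basis elements, $K^i$ is the set of those of degree $i$, and $\partial$ lowers the degree by one, $\partial^2=0$, $\delta=\partial^\top$. $Z_i,B_i$ (resp. $Z^i,B^i$) are the $i$-cycles and $i$-boundaries (resp. $i$-cocycles and $i$-coboundaries), and $|\cdot|$ is the Hamming weight. Let $\preceq$ be the reflexive and transitive closure of "$x\in\operatorname{supp}(\partial y)$", and for a basis element $x$ and a cochain $c$ write $x\preceq c$ if $x\preceq y$ for all $y\in\operatorname{supp}(c)$. $K$ has locality $w$ if every basis element is comparable to at most $w$ basis elements (itself included). $d_i(K)=\min\{|z|:z\in Z_i\setminus B_i\}$ ($\infty$ if there is no such $z$). $K$ has an $(m,0)$-small-set flip decoder at level $i$ if (1) for every $i$-cochain $e\ne0$ with $|e|\le m$ there is $c^0\in K^0$ such that $|e+\delta c|<|e|$ for some $(i-1)$-cochain $c\succeq c^0$, or $|\delta(e+c)|<|\delta e|$ for some $i$-cochain $c\succeq c^0$; and (2) for every $i$-cochain $e$ with $\delta e\neq0$, $|e|\le m$ there are $c^0\in K^0$ and an $i$-cochain $c\succeq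 c^0$ with $|\delta(e+c)|<|\delta e|$. For $r$-dimensional $K$ (all degrees at most $r$), the connectivity graph $G^K_I$ has vertex set $\bigsqcup_{i\in I}K^i$; two distinct vertices are adjacent iff they lie above a common element of $K^0$ or below a common element of $K^r$. For a graph $G$, $\mathcal E(G,\eta,\gamma)$ is the family of sets $S$ of vertices contained in a connected subgraph $G'$ with $|V(G')|\ge\eta$ and $|S|\ge\gamma|V(G')|$. A set avoids a family if it contains no member of it. **Setting.** Let $2\le i\le r-1$. Let $A$ be an $(r-1)$-dimensional complex, $M^{A}$ a finite graded set, and $\mathrm{Enc}^A:\mathbb F_2^{M^A}\to\mathbb F_2^{A}$ a cochain map (zero coboundary on the source) inducing an isomorphism on cohomology. Let $B$ be a 1-dimensional complex with $\delta^B:\mathbb F_2^{B^0}\to\mathbb F_2^{B^1}$, and let $M^{0}\subseteq B^0$, $M^{1}\subseteq B^1$ be information sets of $\ker\delta^B$ and $\ker\partial^B$, that is, maximal sets on which every assignment extends to a codeword. $\mathrm{Enc}^B$ sends $x\in\mathbb F_2^{M^0}$ to the unique codeword of $\ker\delta^B$ restricting to $x$, and extends $x\in\mathbb F_2^{M^1}$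 by zero. Let $L\subseteq M^{1}$, $\bar L=B^1\setminus L$, and let $B_{\bar L}$ be $B$ with the basis elements in $L$ removed. Put $C=A\otimes B$, of locality $w$, $C_{\bar L}=A\otimes B_{\bar L}$, $\mathrm{Enc}^C=\mathrm{Enc}^A\otimes \mathrm{Enc}^B$. Assume that $C_{\bar L}$ has an $(m,0)$-small-set flip decoder at level $i$ and that every element of $C_{\bar L}^{i-1}\sqcup C_{\bar L}^{i}$ lies above an element of $C_{\bar L}^0$. Let $G$ be a finite graph containing $G^C_{\{i-1,i,i+1\}}$ as a subgraph, and let $$0<\eta\le\min\{m,\ d_i(C_{\bar L}),\ d_{i-1}(A)\},\qquad 0<\gamma\le\frac1{150w^7}.$$ Put $\mathcal E_{\mathrm{run}}=\mathcal E(G,\eta,\gamma)$ and $\mathcal E_{\mathrm{out}}=\mathcal E(G,\eta,300w^7\gamma)$. The input code is the CSS code at level $i$ of $C$, on the physical qubits $C^i$, with logical qubits $(M^{A,i}\times M^{0})\sqcup(M^{A,i-1}\times M^{1})$. The output code consists of $|L|$ copies of the CSS code at level $i-1$ of $A$, on the physical qubits $A^{i-1}\times L\subseteq C^i$, with logical qubits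 $M^{A,i-1}\times L$. The encoding isometries send $|x\rangle$ to the uniform superposition of the elements of the cohomology class $\mathrm{Enc}^C(x)+B^i(C)$ (resp. the tensor product over $L$ of those of $\mathrm{Enc}^A(x)+B^{i-1}(A)$). Let $\bar{\mathcal O}$ trace out the logical qubits outside $M^{A,i-1}\times L$. A *Pauli superoperator* is a map $\rho\mapsto P\rho P'$ with Pauli operators $P,P'$; its support is $\operatorname{supp}P\cup\operatorname{supp}P'$. A *Pauli $\mathcal E$-deviation* of an encoded state $(\mathrm{Enc}\otimes\mathcal I)(\rho)$ is an operator which, after the non-code qubits and the classical register are traced out, is a scalar multiple (possibly zero) of $(\mathcal F\circ \mathrm{Enc}\otimes\mathcal I)(\rho)$ for a Pauli superoperator $\mathcal F$ on the code qubits with $\mathcal E$-avoiding support. An *adaptive Clifford circuit* has in every time step a noiseless classical computation on its classical register (which is always in a mixture of computational basis states) followed by Clifford gates (Pauli gates, $H$, $S$, $CNOT$, Pauli measurements, resets to $|0\rangle$, $|+\rangle$) on disjoint qubits; each gate other than a measurement is applied iff its classical control bit is $1$, and each measurement writes its outcome into its bit. A *Pauli fault* applies a Pauli superoperator to the qubits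 after every time step. **Proposition 5.1.** There is an adaptive Clifford circuit $\mathcal Q$ with $T=2$ time steps on the $n=|C^i|$ qubits $C^i$, whose first step measures Pauli $Z$ on exactly the qubits $C^i\setminus(A^{i-1}\times L)$ and whose second step consists of classically controlled $X$ gates on qubits of $A^{i-1}\times L$, that is a Pauli fault-tolerant gadget for $\bar{\mathcal O}$ in the following sense. For every $\ell\in\mathbb N$, every density operator $\rho$ on the input logical qubits and $\ell$ reference qubits, every Pauli $\mathcal E_{\mathrm{run}}$-deviation $\sigma$ of $(\mathrm{Enc}^C\otimes\mathcal I_\ell)(\rho)$ whose classical register is in a mixture of computational basis states, and every Pauli fault $\mathcal F=(\mathcal F_1,\mathcal F_2)$ such that the supports of $\mathcal F_1$ and of $\mathcal F_2$ are both $\mathcal E_{\mathrm{run}}$-avoiding, the output of the corrupted circuit $(\mathcal Q[\mathcal F]\otimes\mathcal I_\ell)(\sigma)$ is a Pauli $\mathcal E_{\mathrm{out}}$-deviation of $\big(((\mathrm{Enc}^A)^{\sqcup L}\circ\bar{\mathcal O})\otimes\mathcal I_\ell\big)(\rho)$. -/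

import Mathlib

open scoped Matrix Kronecker ComplexOrder

/-! ## Based chain complexes over the field with two elements -/

/-- A finite based chain complex over `𝔽₂`: a finite graded set `X` of basis elements and a boundary
map `∂` on `𝔽₂^X` with `∂² = 0` that lowers the degree by one.  The entry `bd x y` is the coefficient
of `x` in `∂ 1_y`.  A (co)chain is a function `X → 𝔽₂`; the `i`-(co)chains are those supported on the
basis elements of degree `i`.  The complex has dimension `r` if all degrees are at most `r`. -/
structure BasedComplex (X : Type*) [Fintype X] where
  deg : X → ℕ
  bd : Matrix X X (ZMod 2)
  bd_deg : ∀ x y, bd x y ≠ 0 → deg y = deg x + 1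
  bd_sq : bd * bd = 0

namespace BasedComplex

variable {X : Type*} [Fintype X] (K : BasedComplex X)

/-- The basis elements of degree `i`. -/
abbrev Cell (i : ℕ) : Type _ := {x : X // K.deg x = i}

/-- The boundary map `∂`. -/
def boundary (c : X → ZMod 2) : X → ZMod 2 := K.bd *ᵥ c

/-- The coboundary map `δ = ∂ᵀ`. -/
def coboundary (c : X → ZMod 2) : X → ZMod 2 := K.bdᵀ *ᵥ c

/-- `c` is an `i`-(co)chain. -/
def IsChain (i : ℕ) (c : X → ZMod 2) : Prop := ∀ x, c x ≠ 0 → K.deg x = i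

/-- The partial order `x ⪯ y` on basis elements: the reflexive and transitive closure of
`x ◁ y :↔ x ∈ supp (∂ 1_y)`. -/
def Below (x y : X) : Prop := Relation.ReflTransGen (fun a b => K.bd a b ≠ 0) x y

/-- `x ⪯ c` for a basis element `x` and a (co)chain `c`. -/
def BelowChain (x : X) (c : X → ZMod 2) : Prop := ∀ y, c y ≠ 0 → K.Below x y

/-- Locality `w`: every basis element is comparable with at most `w` basis elements. -/
def HasLocality (w : ℕ) : Prop :=
  ∀ c : X, {c' : X | K.Below c' c ∨ K.Below c c'}.ncard ≤ w

/-- The `i`-systolic distance: the least weight of an `i`-cycle that is not an `i`-boundary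
(`⊤` if there is none). -/
noncomputable def systolicDistance [DecidableEq X] (i : ℕ) : ENNReal :=
  ⨅ z ∈ {z : X → ZMod 2 | K.IsChain i z ∧ K.boundary z = 0 ∧
    ¬ ∃ c, K.IsChain (i + 1) c ∧ K.boundary c = z}, (hammingNorm z : ENNReal)

/-- `m`-small-set error-flip decoder at level `i`. -/
def HasErrorFlipDecoder [DecidableEq X] (i m : ℕ) : Prop :=
  ∀ e, K.IsChain i e → e ≠ 0 → hammingNorm e ≤ m →
    ∃ c₀, K.deg c₀ = 0 ∧
      ((∃ j c, j + 1 = i ∧ K.IsChain j c ∧ K.BelowChain c₀ c ∧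
          hammingNorm (e + K.coboundary c) < hammingNorm e) ∨
        (∃ c, K.IsChain i c ∧ K.BelowChain c₀ c ∧
          hammingNorm (K.coboundary (e + c)) < hammingNorm (K.coboundary e)))

/-- `(m, γ)`-small-set syndrome-flip decoder at level `i`.  Only errors with nonzero syndrome are
considered: a zero syndrome cannot be reduced. -/
def HasSyndromeFlipDecoder [DecidableEq X] (i m : ℕ) (γ : ℝ) : Prop :=
  ∀ e, K.IsChain i e → K.coboundary e ≠ 0 → hammingNorm e ≤ m →
    ∀ f, K.IsChain (i + 1) f → (hammingNorm f : ℝ) ≤ γ * hammingNorm (K.coboundary e) →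
      ∃ c₀ c, K.deg c₀ = 0 ∧ K.IsChain i c ∧ K.BelowChain c₀ c ∧
        hammingNorm (K.coboundary (e + c) + f) < hammingNorm (K.coboundary e + f)

/-- `(m, γ)`-small-set flip decoder at level `i`. -/
def HasSmallSetFlipDecoder [DecidableEq X] (i m : ℕ) (γ : ℝ) : Prop :=
  K.HasErrorFlipDecoder i m ∧ K.HasSyndromeFlipDecoder i m γ

/-- The level-`I` connectivity graph of an `r`-dimensional complex: the vertices are the basis elements
whose degree lies in `I`; two of them are joined if they lie above a common element of degree `0` or
below a common element of degree `r`. -/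
def connectivityGraph (r : ℕ) (I : Set ℕ) : SimpleGraph {c : X // K.deg c ∈ I} where
  Adj c c' := c ≠ c' ∧
    ((∃ c₀, K.deg c₀ = 0 ∧ K.Below c₀ c ∧ K.Below c₀ c') ∨
      (∃ c₁, K.deg c₁ = r ∧ K.Below c c₁ ∧ K.Below c' c₁))
  symm := ⟨by
    rintro c c' ⟨h, h' | h'⟩
    · exact ⟨h.symm, Or.inl (by obtain ⟨a, b, c, d⟩ := h'; exact ⟨a, b, d, c⟩)⟩
    · exact ⟨h.symm, Or.inr (by obtain ⟨a, b, c, d⟩ := h'; exact ⟨a, b, d, c⟩)⟩⟩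
  loopless := ⟨fun _ h => h.1 rfl⟩

/-- The tensor product of complexes, with `∂ = ∂ ⊗ 1 + 1 ⊗ ∂` and additive degrees. -/
def tensor {Y : Type*} [Fintype Y] [DecidableEq X] [DecidableEq Y]
    (K : BasedComplex X) (K' : BasedComplex Y) : BasedComplex (X × Y) where
  deg c := K.deg c.1 + K'.deg c.2
  bd := K.bd ⊗ₖ (1 : Matrix Y Y (ZMod 2)) + (1 : Matrix X X (ZMod 2)) ⊗ₖ K'.bd
  bd_deg := by
    rintro ⟨x, y⟩ ⟨x', y'⟩ h
    simp only [Matrix.add_apply, Matrix.kroneckerMap_apply, Matrix.one_apply] at h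
    by_cases hx : K.bd x x' = 0
    · by_cases hy : K'.bd y y' = 0
      · simp [hx, hy] at h
      · have hxx : x = x' := by
          by_contra hne
          simp [hx, hne] at h
        have := K'.bd_deg y y' hy
        subst hxx
        simp only
        omega
    · by_cases hyy : y = y'
      · have := K.bd_deg x x' hx
        subst hyy
        simp only
        omega
      · by_cases hxx : x = x'
        · subst hxx
          have := K.bd_deg x x hx
          omega
        · simp [hxx, hyy] at h
  bd_sq := by
    simp only [Matrix.add_mul, Matrix.mul_add, ← Matrix.mul_kronecker_mul, K.bd_sq, K'.bd_sq,
      Matrix.one_mul, Matrix.mul_one, Matrix.zero_kronecker, Matrix.kronecker_zero, zero_add,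
      add_zero]
    ext a b
    exact CharTwo.add_self_eq_zero _

/-- The one-dimensional complex with basis `B₀` in degree `0`, basis `B₁` in degree `1` and boundary
map `H`, so that `δ = Hᵀ : 𝔽₂^B₀ → 𝔽₂^B₁`. -/
def oneDim {B₀ B₁ : Type*} [Fintype B₀] [Fintype B₁] (H : Matrix B₀ B₁ (ZMod 2)) :
    BasedComplex (B₀ ⊕ B₁) where
  deg := Sum.elim (fun _ => 0) (fun _ => 1)
  bd := Matrix.fromBlocks 0 H 0 0
  bd_deg := by rintro (x | x) (y | y) h <;> simp at h ⊢
  bd_sq := by simp [Matrix.fromBlocks_multiply]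

/-- An encoding map for all levels of the cohomology: `E : 𝔽₂^MA → 𝔽₂^X` is a degree-preserving
cochain map, from the complex with graded basis `MA` and zero coboundary map, that induces an
isomorphism on cohomology. -/
structure IsEncodingMap {MA : Type*} [Fintype MA] (degM : MA → ℕ) (E : Matrix X MA (ZMod 2)) :
    Prop where
  graded : ∀ x k, E x k ≠ 0 → K.deg x = degM k
  cochain : ∀ v, K.coboundary (E *ᵥ v) = 0
  inj : ∀ v, (∃ c, E *ᵥ v = K.coboundary c) → v = 0
  surj : ∀ z, K.coboundary z = 0 → ∃ v c, z = E *ᵥ v + K.coboundary c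

/-- The coboundaries `Bⁱ`, as vectors indexed by the basis elements of degree `i`. -/
noncomputable def levelCoboundaries (i : ℕ) : Submodule (ZMod 2) (K.Cell i → ZMod 2) :=
  LinearMap.range (K.bdᵀ.submatrix (Subtype.val : K.Cell i → X) id).mulVecLin

/-- `Q_X = ker ∂ᵢ`. -/
noncomputable def codeX (i : ℕ) : Submodule (ZMod 2) (K.Cell i → ZMod 2) :=
  LinearMap.ker (K.bd.submatrix id (Subtype.val : K.Cell i → X)).mulVecLin

/-- `Q_Z = ker δᵢ`. -/
noncomputable def codeZ (i : ℕ) : Submodule (ZMod 2) (K.Cell i → ZMod 2) :=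
  LinearMap.ker (K.bdᵀ.submatrix id (Subtype.val : K.Cell i → X)).mulVecLin

open Classical in
/-- The encoding isometry at level `i` of an encoding map `E`: it sends `|x⟩` to the uniform
superposition `|Bⁱ|^(-1/2) ∑ |y⟩` over the coset `y ∈ E x + Bⁱ`. -/
noncomputable def encodingIsometry {MA : Type*} [Fintype MA] (degM : MA → ℕ)
    (E : Matrix X MA (ZMod 2)) (i : ℕ) :
    Matrix (K.Cell i → ZMod 2) ({k : MA // degM k = i} → ZMod 2) ℂ :=
  Matrix.of fun y x =>
    if y - E.submatrix Subtype.val Subtype.val *ᵥ x ∈ K.levelCoboundaries i then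
      1 / (Real.sqrt (Nat.card (K.levelCoboundaries i)) : ℂ)
    else 0

end BasedComplex

/-! ## Information sets and the encoding map of a one-dimensional complex -/

/-- `S` is extendable for the classical code `C`: every assignment on `S` extends to a codeword. -/
def IsExtendable {B : Type*} (C : Submodule (ZMod 2) (B → ZMod 2)) (S : Finset B) : Prop :=
  ∀ x : B → ZMod 2, ∃ c ∈ C, ∀ b ∈ S, c b = x b

/-- An information set: a maximal extendable set. -/
def IsInformationSet {B : Type*} [DecidableEq B] (C : Submodule (ZMod 2) (B → ZMod 2))
    (S : Finset B) : Prop :=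
  IsExtendable C S ∧ ∀ b ∉ S, ¬ IsExtendable C (insert b S)

open Classical in
/-- The codeword of `C` whose restriction to the information set `S` is the indicator of `s`. -/
noncomputable def systematicCodeword {B : Type*} (C : Submodule (ZMod 2) (B → ZMod 2))
    (S : Finset B) (s : S) : B → ZMod 2 :=
  if h : ∃ c ∈ C, ∀ b : S, c b = if b = s then 1 else 0 then h.choose else 0

/-- The encoding map of the one-dimensional complex `oneDim H`, for information sets `M₀` of `ker δ`
and `M₁` of `ker ∂`: in degree `0` a message `x ∈ 𝔽₂^M₀` goes to the codeword of `ker δ` that restricts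
to `x` on `M₀`; in degree `1` a message is extended by zero. -/
noncomputable def oneDimEncoding {B₀ B₁ : Type*} [Fintype B₀] [Fintype B₁]
    [DecidableEq B₁] (H : Matrix B₀ B₁ (ZMod 2)) (M₀ : Finset B₀) (M₁ : Finset B₁) :
    Matrix (B₀ ⊕ B₁) (M₀ ⊕ M₁) (ZMod 2) :=
  Matrix.fromBlocks
    (Matrix.of fun b s => systematicCodeword (LinearMap.ker Hᵀ.mulVecLin) M₀ s b) 0 0
    (Matrix.of fun b s => if b = (s : B₁) then 1 else 0)

/-- The matrix of the boundary map after the basis elements in `L` have been removed from degree `1`. -/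
def removeCells {B₀ B₁ : Type*} (H : Matrix B₀ B₁ (ZMod 2)) (L : Finset B₁) :
    Matrix B₀ {b : B₁ // b ∉ L} (ZMod 2) :=
  H.submatrix id Subtype.val

/-! ## Families of bad sets -/

/-- `S` contains no element of the family `E`. -/
def Avoiding {V : Type*} (E : Set (Set V)) (S : Set V) : Prop := ∀ T ∈ E, ¬ T ⊆ S

/-- The family `𝓔(G, η, γ)`: sets `S` that lie in a connected subgraph `G'` of `G` with
`|V(G')| ≥ η` and `|S| / |V(G')| ≥ γ`. -/
def badSets {V : Type*} (G : SimpleGraph V) (η γ : ℝ) : Set (Set V) :=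
  {S | ∃ G' : G.Subgraph, G'.Connected ∧ S ⊆ G'.verts ∧
    η ≤ G'.verts.ncard ∧ γ ≤ (S.ncard : ℝ) / G'.verts.ncard}

/-- The disjoint union of `T` copies of a family of sets, one copy for every time step. -/
def copies {V : Type*} (T : ℕ) (E : Set (Set V)) : Set (Set (V × Fin T)) :=
  {S | ∃ t : Fin T, ∃ S' ∈ E, S = S' ×ˢ {t}}

/-! ## Qubits, Pauli operators and superoperators

The state space of a register of qubits labelled by a finite type `Q` has basis `Q → ZMod 2`. -/

/-- Superoperators. -/
abbrev Superop (α β : Type*) := Matrix α α ℂ →ₗ[ℂ] Matrix β β ℂ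

/-- The superoperator `ρ ↦ A ρ B`. -/
def sandwich {α β : Type*} [Fintype α] (A : Matrix β α ℂ) (B : Matrix α β ℂ) : Superop α β where
  toFun ρ := A * ρ * B
  map_add' := by intros; simp [Matrix.mul_add, Matrix.add_mul]
  map_smul' := by intros; simp

/-- `Φ ⊗ id` for an untouched reference system with basis `R`. -/
def withRef {α β : Type*} (R : Type*) (Φ : Superop α β) : Superop (α × R) (β × R) where
  toFun ρ := Matrix.of fun a b =>
    Φ (Matrix.of fun x y => ρ (x, a.2) (y, b.2)) a.1 b.1
  map_add' := by
    intro ρ σ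
    ext a b
    have h : (Matrix.of fun x y => (ρ + σ) (x, a.2) (y, b.2)) =
        (Matrix.of fun x y => ρ (x, a.2) (y, b.2)) +
          (Matrix.of fun x y => σ (x, a.2) (y, b.2)) := by
      ext x y; simp
    rw [Matrix.add_apply, Matrix.of_apply, h, map_add]
    rfl
  map_smul' := by
    intro c ρ
    ext a b
    have h : (Matrix.of fun x y => (c • ρ) (x, a.2) (y, b.2)) =
        c • (Matrix.of fun x y => ρ (x, a.2) (y, b.2)) := by
      ext x y; simp
    rw [Matrix.of_apply, h, map_smul]
    rfl

/-- The partial trace that keeps the qubits in the range of `ι` and discards the others. -/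
def keepQubits {P Q : Type*} [Fintype P] [Fintype Q] [DecidableEq P] [DecidableEq Q]
    (ι : P ↪ Q) : Superop (Q → ZMod 2) (P → ZMod 2) where
  toFun ρ := Matrix.of fun y y' => ∑ u : Q → ZMod 2, ∑ u' : Q → ZMod 2,
    if (∀ p, u (ι p) = y p) ∧ (∀ p, u' (ι p) = y' p) ∧ (∀ q, (∀ p, ι p ≠ q) → u q = u' q)
    then ρ u u' else 0
  map_add' := by
    intro ρ σ
    ext y y'
    simp only [Matrix.of_apply, Matrix.add_apply, ← Finset.sum_add_distrib]
    refine Finset.sum_congr rfl fun u _ => Finset.sum_congr rfl fun u' _ => ?_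
    split_ifs <;> simp
  map_smul' := by
    intro c ρ
    ext y y'
    simp only [Matrix.of_apply, Matrix.smul_apply, Finset.smul_sum, RingHom.id_apply]
    refine Finset.sum_congr rfl fun u _ => Finset.sum_congr rfl fun u' _ => ?_
    split_ifs <;> simp

/-- Labels of the single-qubit Pauli matrices. -/
inductive Pauli where
  | I | X | Y | Z

namespace Pauli

/-- The single-qubit Pauli matrices, in the basis `|0⟩, |1⟩`. -/
noncomputable def mat : Pauli → Matrix (ZMod 2) (ZMod 2) ℂ
  | I => 1
  | X => Matrix.of fun a b => if a = b then 0 else 1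
  | Y => Matrix.of fun a b => if a = b then 0 else if a = 0 then -Complex.I else Complex.I
  | Z => Matrix.of fun a b => if a = b then (if a = 0 then 1 else -1) else 0

/-- The tensor product of single-qubit Pauli matrices. -/
noncomputable def tensorMat {Q : Type*} [Fintype Q] (s : Q → Pauli) :
    Matrix (Q → ZMod 2) (Q → ZMod 2) ℂ :=
  Matrix.of fun y x => ∏ q, (s q).mat (y q) (x q)

/-- The Pauli superoperator `ρ ↦ A ρ B`. -/
noncomputable def superop {Q : Type*} [Fintype Q] [DecidableEq Q] (A B : Q → Pauli) :
    Superop (Q → ZMod 2) (Q → ZMod 2) :=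
  sandwich (tensorMat A) (tensorMat B)

/-- The qubits on which the Pauli superoperator `ρ ↦ A ρ B` acts nontrivially. -/
def support {Q : Type*} (A B : Q → Pauli) : Set Q := {q | A q ≠ I ∨ B q ≠ I}

end Pauli

/-! ## Adaptive Clifford circuits -/

/-- The Clifford gate set on qubits labelled by `Q`. -/
inductive CliffordGate (Q : Type*) where
  | pauli (P : Pauli) (q : Q)
  | hadamard (q : Q)
  | phase (q : Q)
  | cnot (control target : Q) (h : control ≠ target)
  | measure (P : Pauli) (h : P ≠ Pauli.I) (q : Q)
  | resetZero (q : Q)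
  | resetPlus (q : Q)

section Gates

variable {Q : Type*} [Fintype Q] [DecidableEq Q]

/-- A single-qubit operator acting on qubit `q`. -/
def onQubit (q : Q) (U : Matrix (ZMod 2) (ZMod 2) ℂ) : Matrix (Q → ZMod 2) (Q → ZMod 2) ℂ :=
  Matrix.of fun y x => if ∀ p, p ≠ q → y p = x p then U (y q) (x q) else 0

/-- The projector onto the `(-1)^b` eigenspace of the Pauli `P` on qubit `q`. -/
noncomputable def pauliProjector (P : Pauli) (q : Q) (b : ZMod 2) :
    Matrix (Q → ZMod 2) (Q → ZMod 2) ℂ :=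
  onQubit q ((1 / 2 : ℂ) • (1 + (if b = 0 then (1 : ℂ) else -1) • P.mat))

/-- `ρ ↦ U ρ U†`. -/
noncomputable def conjugation (U : Matrix (Q → ZMod 2) (Q → ZMod 2) ℂ) :
    Superop (Q → ZMod 2) (Q → ZMod 2) :=
  sandwich U Uᴴ

/-- The set of qubits touched by a gate. -/
def CliffordGate.qubits : CliffordGate Q → Finset Q
  | .pauli _ q => {q}
  | .hadamard q => {q}
  | .phase q => {q}
  | .cnot c t _ => {c, t}
  | .measure _ _ q => {q}
  | .resetZero q => {q}
  | .resetPlus q => {q}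

/-- The quantum channel of a gate (for measurements: with the outcome forgotten). -/
noncomputable def CliffordGate.channel : CliffordGate Q → Superop (Q → ZMod 2) (Q → ZMod 2)
  | .pauli P q => conjugation (onQubit q P.mat)
  | .hadamard q => conjugation (onQubit q (Matrix.of fun a b =>
      (if a = 1 ∧ b = 1 then -1 else 1) / (Real.sqrt 2 : ℂ)))
  | .phase q => conjugation (onQubit q (Matrix.of fun a b =>
      if a = b then (if a = 0 then 1 else Complex.I) else 0))
  | .cnot c t _ => conjugation (Matrix.of fun y x =>
      if y = Function.update x t (x t + x c) then 1 else 0)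
  | .measure P _ q => ∑ b, conjugation (pauliProjector P q b)
  | .resetZero q => ∑ b, conjugation (onQubit q (Matrix.of fun a a' =>
      if a = 0 ∧ a' = b then 1 else 0))
  | .resetPlus q => ∑ b, conjugation (onQubit q (Matrix.of fun _ a' =>
      if a' = b then 1 / (Real.sqrt 2 : ℂ) else 0))

/-- Operators on a quantum system with basis `α` and an `M`-bit classical register that is in a mixture
of computational basis states: `σ x` is the block of `σ = ∑ₓ σ x ⊗ |x⟩⟨x|`. -/
abbrev HybridState (M : ℕ) (α : Type*) := (Fin M → ZMod 2) → Matrix α α ℂ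

/-- Apply a gate that is controlled by (and, for a measurement, writes its outcome into) bit `i`:
a measurement is always applied, any other gate is applied if bit `i` equals `1`. -/
noncomputable def CliffordGate.apply {M : ℕ} {R : Type*} (g : CliffordGate Q) (i : Fin M)
    (σ : HybridState M ((Q → ZMod 2) × R)) : HybridState M ((Q → ZMod 2) × R) := fun x =>
  match g with
  | .measure P _ q =>
      ∑ b, withRef R (conjugation (pauliProjector P q (x i))) (σ (Function.update x i b))
  | g => if x i = 1 then withRef R g.channel (σ x) else σ x

/-- Apply a classical map to the classical register. -/
def applyClassical {M : ℕ} {α : Type*} (C : (Fin M → ZMod 2) → (Fin M → ZMod 2))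
    (σ : HybridState M α) : HybridState M α :=
  fun y => ∑ x, if C x = y then σ x else 0

end Gates

/-- An adaptive Clifford circuit on the qubits `Q`, with `M` classical bits and `T` time steps.
At each time step a classical circuit, given by the map that it computes, acts on the classical register;
then gates on disjoint sets of qubits are applied, where the `i`-th gate belongs to the `i`-th bit. -/
structure AdaptiveCliffordCircuit (Q : Type*) [Fintype Q] [DecidableEq Q] (M T : ℕ) where
  card_le : Fintype.card Q ≤ M
  classical : Fin T → (Fin M → ZMod 2) → (Fin M → ZMod 2)
  numGates : Fin T → ℕ
  numGates_le : ∀ t, numGates t ≤ M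
  gate : ∀ t, Fin (numGates t) → CliffordGate Q
  gate_disjoint : ∀ t i i', i ≠ i' → Disjoint (gate t i).qubits (gate t i').qubits

/-- A Pauli fault for a circuit with `T` time steps: after step `t` the Pauli superoperator
`ρ ↦ (left t) ρ (right t)` is applied. -/
structure PauliFault (Q : Type*) (T : ℕ) where
  left : Fin T → Q → Pauli
  right : Fin T → Q → Pauli

/-- The space-time support of a Pauli fault. -/
def PauliFault.support {Q : Type*} {T : ℕ} (F : PauliFault Q T) : Set (Q × Fin T) :=
  {p | p.1 ∈ Pauli.support (F.left p.2) (F.right p.2)}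

section Circuits

variable {Q : Type*} [Fintype Q] [DecidableEq Q] {M T : ℕ}

/-- One (noiseless) time step of a circuit. -/
noncomputable def AdaptiveCliffordCircuit.step (C : AdaptiveCliffordCircuit Q M T) (R : Type*)
    (t : Fin T) (σ : HybridState M ((Q → ZMod 2) × R)) : HybridState M ((Q → ZMod 2) × R) :=
  (List.finRange (C.numGates t)).foldl
    (fun τ i => (C.gate t i).apply (Fin.castLE (C.numGates_le t) i) τ)
    (applyClassical (C.classical t) σ)

/-- The action of the corrupted circuit `C[F]`, tensored with the identity on the reference system. -/
noncomputable def AdaptiveCliffordCircuit.run (C : AdaptiveCliffordCircuit Q M T)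
    (F : PauliFault Q T) (R : Type*) (σ : HybridState M ((Q → ZMod 2) × R)) :
    HybridState M ((Q → ZMod 2) × R) :=
  (List.finRange T).foldl
    (fun τ t x => withRef R (Pauli.superop (F.left t) (F.right t)) (C.step R t τ x)) σ

end Circuits

/-! ## Decorated codes and Pauli fault-tolerant gadgets -/

/-- A decorated CSS code with physical qubits `P` and logical qubits `K`: the two classical codes, the
encoding isometry and a family of bad sets; the bad sets are subsets of a set `V` that contains `P`
through `pos`. -/
structure DecoratedCode (V P K : Type*) where
  codeX : Submodule (ZMod 2) (P → ZMod 2)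
  codeZ : Submodule (ZMod 2) (P → ZMod 2)
  enc : Matrix (P → ZMod 2) (K → ZMod 2) ℂ
  pos : P ↪ V
  bad : Set (Set V)

namespace DecoratedCode

variable {V P K : Type*} [Fintype P] [DecidableEq P] [Fintype K] [DecidableEq K]

/-- The encoding channel `ρ ↦ Enc ρ Enc†`. -/
noncomputable def encChannel (D : DecoratedCode V P K) : Superop (K → ZMod 2) (P → ZMod 2) :=
  sandwich D.enc D.encᴴ

/-- `σ` is a Pauli deviation of the encoding of `ρ`, where the code lives on the qubits `ι : P ↪ Q`:
after the other qubits and the classical register have been traced out, `σ` is a scalar multiple of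
`(𝓕 ∘ Enc ⊗ id)(ρ)` for a Pauli superoperator `𝓕` on the code qubits whose support avoids all bad sets. -/
def IsPauliDeviation (D : DecoratedCode V P K) {Q R : Type*} [Fintype Q] [DecidableEq Q]
    (ι : P ↪ Q) {M : ℕ} (σ : HybridState M ((Q → ZMod 2) × R))
    (ρ : Matrix ((K → ZMod 2) × R) ((K → ZMod 2) × R) ℂ) : Prop :=
  ∃ A B : P → Pauli, Avoiding D.bad (D.pos '' Pauli.support A B) ∧
    ∃ c : ℂ, withRef R (keepQubits ι) (∑ x, σ x) =
      c • withRef R (Pauli.superop A B) (withRef R D.encChannel ρ)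

end DecoratedCode

/-- The circuit `C` on the qubits `Q ⊆ V`, with bad sets `badRun` for its faults, is a Pauli
fault-tolerant gadget (without classical input or output) for the superoperator `O`, from the decorated
code `Din` on the qubits `ιin` to the decorated code `Dout` on the qubits `ιout`.  The classical
register may be in any mixture of computational basis states initially. -/
def IsPauliFaultTolerantGadget {V Q Pin Kin Pout Kout : Type*}
    [Fintype Q] [DecidableEq Q] [Fintype Pin] [DecidableEq Pin] [Fintype Kin] [DecidableEq Kin]
    [Fintype Pout] [DecidableEq Pout] [Fintype Kout] [DecidableEq Kout] {M T : ℕ}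
    (C : AdaptiveCliffordCircuit Q M T) (pos : Q ↪ V) (badRun : Set (Set (V × Fin T)))
    (Din : DecoratedCode V Pin Kin) (ιin : Pin ↪ Q)
    (Dout : DecoratedCode V Pout Kout) (ιout : Pout ↪ Q)
    (O : Superop (Kin → ZMod 2) (Kout → ZMod 2)) : Prop :=
  ∀ (l : ℕ) (ρ : Matrix ((Kin → ZMod 2) × (Fin l → ZMod 2)) ((Kin → ZMod 2) × (Fin l → ZMod 2)) ℂ),
    ρ.PosSemidef → ρ.trace = 1 →
    ∀ σ : HybridState M ((Q → ZMod 2) × (Fin l → ZMod 2)), Din.IsPauliDeviation ιin σ ρ →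
    ∀ F : PauliFault Q T, Avoiding badRun ((fun p => (pos p.1, p.2)) '' F.support) →
      Dout.IsPauliDeviation ιout (C.run F (Fin l → ZMod 2) σ) (withRef (Fin l → ZMod 2) O ρ)

/-! ## The codes between which the gadget switches

Here `C = A ⊗ B` with `B = oneDim H`, the input code is the code at level `j + 1` of `C` and the output
code consists of `|L|` copies of the code at level `j` of `A`. -/

section Switch

variable {X MA B₀ B₁ : Type*} [Fintype X] [DecidableEq X] [Fintype MA]
  [Fintype B₀] [DecidableEq B₀] [Fintype B₁] [DecidableEq B₁]

/-- The degrees of the logical basis elements `M^A × (M₀ ⊔ M₁)` of `C = A ⊗ B`. -/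
def productDeg (degM : MA → ℕ) (M₀ : Finset B₀) (M₁ : Finset B₁) : MA × (M₀ ⊕ M₁) → ℕ :=
  fun k => degM k.1 + Sum.elim (fun _ => 0) (fun _ => 1) k.2

/-- The inclusion `A^j × L ⊆ C^(j+1)` of physical qubits. -/
def physicalInclusion (A : BasedComplex X) (H : Matrix B₀ B₁ (ZMod 2)) (L : Finset B₁) (j : ℕ) :
    A.Cell j × L ↪ (A.tensor (BasedComplex.oneDim H)).Cell (j + 1) where
  toFun p := ⟨(p.1.1, Sum.inr p.2.1), congrArg (· + 1) p.1.2⟩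
  inj' := by
    rintro ⟨⟨a, ha⟩, ⟨l, hl⟩⟩ ⟨⟨a', ha'⟩, ⟨l', hl'⟩⟩ h
    have h' := congrArg Subtype.val h
    simpa using h'

/-- The inclusion `M^(A,j) × L ⊆ M^(C,j+1)` of logical qubits. -/
def logicalInclusion (degM : MA → ℕ) (M₀ : Finset B₀) (M₁ L : Finset B₁) (hL : L ⊆ M₁) (j : ℕ) :
    {k : MA // degM k = j} × L ↪ {k : MA × (M₀ ⊕ M₁) // productDeg degM M₀ M₁ k = j + 1} where
  toFun p := ⟨(p.1.1, Sum.inr ⟨p.2.1, hL p.2.2⟩), congrArg (· + 1) p.1.2⟩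
  inj' := by
    rintro ⟨⟨a, ha⟩, ⟨l, hl⟩⟩ ⟨⟨a', ha'⟩, ⟨l', hl'⟩⟩ h
    have h' := congrArg Subtype.val h
    simpa using h'

/-- The decorated code at level `i` of `C = A ⊗ B`, with encoding map `Enc^A ⊗ Enc^B`. -/
noncomputable def inputCode {V : Type*} (A : BasedComplex X) (degM : MA → ℕ)
    (encA : Matrix X MA (ZMod 2)) (H : Matrix B₀ B₁ (ZMod 2)) (M₀ : Finset B₀) (M₁ : Finset B₁)
    (i : ℕ) (pos : (A.tensor (BasedComplex.oneDim H)).Cell i ↪ V) (bad : Set (Set V)) :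
    DecoratedCode V ((A.tensor (BasedComplex.oneDim H)).Cell i)
      {k : MA × (M₀ ⊕ M₁) // productDeg degM M₀ M₁ k = i} where
  codeX := (A.tensor (BasedComplex.oneDim H)).codeX i
  codeZ := (A.tensor (BasedComplex.oneDim H)).codeZ i
  enc := (A.tensor (BasedComplex.oneDim H)).encodingIsometry (productDeg degM M₀ M₁)
    (encA ⊗ₖ oneDimEncoding H M₀ M₁) i
  pos := pos
  bad := bad

/-- The decorated code consisting of copies, labelled by `L`, of the code at level `j` of `A` with
encoding map `Enc^A`. -/
noncomputable def copiesCode {V : Type*} (A : BasedComplex X) (degM : MA → ℕ)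
    (encA : Matrix X MA (ZMod 2)) (L : Finset B₁) (j : ℕ) (pos : A.Cell j × L ↪ V)
    (bad : Set (Set V)) :
    DecoratedCode V (A.Cell j × L) ({k : MA // degM k = j} × L) where
  codeX := ⨅ l : L, (A.codeX j).comap (LinearMap.funLeft (ZMod 2) (ZMod 2) fun a => (a, l))
  codeZ := ⨅ l : L, (A.codeZ j).comap (LinearMap.funLeft (ZMod 2) (ZMod 2) fun a => (a, l))
  enc := Matrix.of fun y x =>
    ∏ l : L, A.encodingIsometry degM encA j (fun a => y (a, l)) (fun k => x (k, l))
  pos := pos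
  bad := bad

/-- The inclusion of the basis elements of degree `i` into those whose degree lies in `I`. -/
def cellInclusion (K : BasedComplex X) {i : ℕ} {I : Set ℕ} (h : i ∈ I) :
    K.Cell i ↪ {c : X // K.deg c ∈ I} where
  toFun c := ⟨c.1, by rw [c.2]; exact h⟩
  inj' := by
    rintro ⟨a, ha⟩ ⟨b, hb⟩ hab
    simpa using hab

end Switch

/-!
The circuit measures `Z` on the qubits of `C^i` outside `A^(i-1) × L`, a classical decoder guesses an
error of the outcome, and `X` gates on `A^(i-1) × L` undo the effect of the outcome there.

Algebra.  Let `κ l` be a codeword of `ker ∂^B` that restricts to the indicator of `l` on the information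
set `M¹`.  Contraction with `κ l` is a cochain map from `C` to `A`, so that a cochain of `C` is a
coboundary if and only if its restriction `t` to `A ⊗ B_L̄` is one and its values on each copy
`A^(i-1) × {l}`, added to the contraction of `t` with `κ l`, are a coboundary of `A`
(`glue_mem_levelCoboundaries_iff`).  After the linear map `(y, t) ↦ (y + s t, t)`, where `s` is this
contraction (`correction`), the input code is the product of a code on the measured qubits and the
output code (`inputCode_enc_glue`).  The first factor determines precisely the logical qubits
outside `M^(A,i-1) × L` (`eq_zero_of_encodedRest_mem`): measuring traces them out, and the correction
`s` of the outcome leaves the output code.  `exists_output_deviation` carries this out in the presence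
of faults: flips before the measurement change the correction by `s` of the error that is left after
decoding, and phase errors make the sum over the outcomes a character sum over cosets, which vanishes
unless the character is trivial on the coboundaries of `A ⊗ B_L̄`.

Geometry.  Two facts about errors that avoid the bad sets remain.  Avoidance is a density condition on
linked sets (`avoiding_badSets_iff`), so that the clusters of such an error are small.

* Flips (`exists_correction_equivalent`).  The error left after decoding is a cocycle of `A ⊗ B_L̄`.  Its
  clusters are small cocycles, and the flips of the small-set flip decoder reduce them to zero inside
  linked sets of size proportional to theirs (`exists_coboundary_eq_of_small`).  It is hence the
  coboundary of a cochain, and up to coboundaries of `A` the correction that it induces is the part of the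
  coboundary of this cochain in `C` that spills over to `A^(i-1) × L`; this is supported in the linked
  sets, which have low density by `Avoiding.of_clusters`.
* Phases (`dotProduct_encodedCochain_eq_zero_of_avoiding`).  If the character is trivial on the
  coboundaries, then the boundary of the phase error vanishes on `A × B^0` and on `A × (M¹ \ L)`.  The
  same holds for its clusters.  Contracted with codewords of `ker δ^B`, or restricted to an element of
  `M¹ \ L`, a cluster is a cycle of weight below the distances of `A ⊗ B_L̄` and of `A`, hence orthogonal to
  cocycles; so the character is trivial on all encoded cochains and the outcome reveals nothing about
  the logical qubits that are traced out.
-/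

/-! ### Signs and Pauli operators -/

section Signs

lemma zmod_two_eq_zero_or_one (a : ZMod 2) : a = 0 ∨ a = 1 := by
  revert a; decide

lemma zmod_two_eq_one {a : ZMod 2} (h : a ≠ 0) : a = 1 :=
  (zmod_two_eq_zero_or_one a).resolve_left h

lemma vec_add_self {ι : Type*} (v : ι → ZMod 2) : v + v = 0 :=
  funext fun _ => CharTwo.add_self_eq_zero _

lemma vec_add_cancel {ι : Type*} (v a : ι → ZMod 2) : v + a + a = v := by
  rw [add_assoc, vec_add_self, add_zero]

/-- The nontrivial character of `ZMod 2`. -/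
def sgn (a : ZMod 2) : ℂ := if a = 0 then 1 else -1

@[simp] lemma sgn_zero : sgn 0 = 1 := by simp [sgn]

lemma sgn_add (a b : ZMod 2) : sgn (a + b) = sgn a * sgn b := by
  have h : (1 + 1 : ZMod 2) = 0 := rfl
  rcases zmod_two_eq_zero_or_one a with rfl | rfl <;>
    rcases zmod_two_eq_zero_or_one b with rfl | rfl <;> simp [sgn, h]

lemma sgn_ne_zero (a : ZMod 2) : sgn a ≠ 0 := by
  unfold sgn; split_ifs <;> simp

lemma sgn_sum {ι : Type*} (s : Finset ι) (a : ι → ZMod 2) :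
    sgn (∑ i ∈ s, a i) = ∏ i ∈ s, sgn (a i) := by
  classical
  induction s using Finset.induction_on with
  | empty => simp
  | insert i s hi ih => rw [Finset.sum_insert hi, Finset.prod_insert hi, sgn_add, ih]

end Signs

lemma sandwich_apply {α β : Type*} [Fintype α] (A : Matrix β α ℂ) (B : Matrix α β ℂ)
    (ρ : Matrix α α ℂ) : sandwich A B ρ = A * ρ * B := rfl

namespace Pauli

/-- The bit flip part of a Pauli label. -/
def flip : Pauli → ZMod 2
  | I => 0
  | X => 1
  | Y => 1
  | Z => 0

/-- The phase flip part of a Pauli label. -/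
def sign : Pauli → ZMod 2
  | I => 0
  | X => 0
  | Y => 1
  | Z => 1

/-- The scalar by which a Pauli matrix differs from the product of its flip and sign parts. -/
noncomputable def scalar : Pauli → ℂ
  | Y => Complex.I
  | _ => 1

/-- The Pauli label with given flip and sign parts. -/
def ofBits (x z : ZMod 2) : Pauli :=
  if x = 0 then (if z = 0 then I else Z) else (if z = 0 then X else Y)

@[simp] lemma flip_ofBits (x z : ZMod 2) : (ofBits x z).flip = x := by
  unfold ofBits
  split_ifs with h h' h' <;> simp_all [flip, zmod_two_eq_one]

@[simp] lemma sign_ofBits (x z : ZMod 2) : (ofBits x z).sign = z := by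
  unfold ofBits
  split_ifs with h h' h' <;> simp_all [sign, zmod_two_eq_one]

lemma flip_eq_zero_of_eq_I {p : Pauli} (h : p = I) : p.flip = 0 := by subst h; rfl
lemma sign_eq_zero_of_eq_I {p : Pauli} (h : p = I) : p.sign = 0 := by subst h; rfl

lemma ofBits_zero : ofBits 0 0 = I := by simp [ofBits]

lemma scalar_ne_zero (p : Pauli) : p.scalar ≠ 0 := by cases p <;> simp [scalar]

lemma mat_apply (p : Pauli) (y x : ZMod 2) :
    p.mat y x = if y = x + p.flip then p.scalar * sgn (p.sign * x) else 0 := by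
  have h : (1 + 1 : ZMod 2) = 0 := rfl
  rcases zmod_two_eq_zero_or_one y with rfl | rfl <;>
    rcases zmod_two_eq_zero_or_one x with rfl | rfl <;> cases p <;>
    simp [mat, flip, sign, scalar, sgn, h]

variable {Q : Type*} [Fintype Q]

/-- A Pauli string shifts a basis state by its flips, and multiplies it by a sign and a scalar. -/
lemma tensorMat_apply (s : Q → Pauli) (y x : Q → ZMod 2) :
    tensorMat s y x = if y = x + (fun q => (s q).flip) then
      (∏ q, (s q).scalar) * sgn ((fun q => (s q).sign) ⬝ᵥ x) else 0 := by
  simp only [tensorMat, Matrix.of_apply, mat_apply]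
  split_ifs with h
  · rw [dotProduct, sgn_sum, ← Finset.prod_mul_distrib]
    refine Finset.prod_congr rfl fun q _ => ?_
    rw [if_pos (by rw [h]; rfl)]
  · have : ∃ q, y q ≠ x q + (s q).flip := by
      by_contra hc
      push Not at hc
      exact h (funext hc)
    obtain ⟨q, hq⟩ := this
    exact Finset.prod_eq_zero (Finset.mem_univ q) (if_neg hq)

/-- A Pauli superoperator shifts the two indices of a matrix and multiplies its entries by signs. -/
lemma exists_superop_apply [DecidableEq Q] (A B : Q → Pauli) :
    ∃ c : ℂ, c ≠ 0 ∧ ∀ (ρ : Matrix (Q → ZMod 2) (Q → ZMod 2) ℂ) (y y' : Q → ZMod 2),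
      superop A B ρ y y' = c * (sgn ((fun q => (A q).sign) ⬝ᵥ y) * sgn ((fun q => (B q).sign) ⬝ᵥ y') *
        ρ (y + fun q => (A q).flip) (y' + fun q => (B q).flip)) := by
  have hadd : ∀ v a : Q → ZMod 2, v + a + a = v := vec_add_cancel
  refine ⟨(∏ q, (A q).scalar) * (∏ q, (B q).scalar) *
    sgn ((fun q => (A q).sign) ⬝ᵥ (fun q => (A q).flip)), ?_, fun ρ y y' => ?_⟩
  · exact mul_ne_zero (mul_ne_zero (Finset.prod_ne_zero_iff.2 fun q _ => scalar_ne_zero _)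
      (Finset.prod_ne_zero_iff.2 fun q _ => scalar_ne_zero _)) (sgn_ne_zero _)
  · rw [superop, sandwich_apply, Matrix.mul_apply, Finset.sum_eq_single (y' + fun q => (B q).flip)]
    · rw [Matrix.mul_apply, Finset.sum_eq_single (y + fun q => (A q).flip)]
      · rw [tensorMat_apply, tensorMat_apply, if_pos (hadd _ _).symm, if_pos rfl,
          dotProduct_add, sgn_add]
        ring
      · intro x _ hx
        rw [tensorMat_apply, if_neg, zero_mul]
        rintro rfl
        exact hx (hadd _ _).symm
      · simp
    · intro x _ hx
      rw [tensorMat_apply, if_neg hx, mul_zero]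
    · simp

end Pauli

lemma withRef_apply {α β R : Type*} (Φ : Superop α β) (ρ : Matrix (α × R) (α × R) ℂ) (a b : β × R) :
    withRef R Φ ρ a b = Φ (Matrix.of fun x y => ρ (x, a.2) (y, b.2)) a.1 b.1 := rfl

/-! ### Gates and sequences of gates -/

section Gates

variable {Q R : Type*} [Fintype Q] [DecidableEq Q]

/-- A bit flip on the qubit `q` adds `1` to the coordinate `q` of the basis states. -/
lemma onQubit_X_apply (q : Q) (y x : Q → ZMod 2) :
    onQubit q Pauli.X.mat y x = if y = x + Pi.single q 1 then 1 else 0 := by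
  have h1 : ∀ a b : ZMod 2, (a = b) ↔ ¬ a = b + 1 := by decide
  have : y = x + Pi.single q 1 ↔ (∀ p, p ≠ q → y p = x p) ∧ y q = x q + 1 := by
    constructor
    · rintro rfl
      refine ⟨fun p hp => by simp [hp], by simp⟩
    · rintro ⟨h, h'⟩
      funext p
      by_cases hp : p = q
      · subst hp; simpa using h'
      · simpa [hp] using h p hp
  simp only [onQubit, Matrix.of_apply, Pauli.mat, this, ite_and, h1 (y q) (x q), ite_not]

lemma withRef_conjugation_X_apply (q : Q) (ρ : Matrix ((Q → ZMod 2) × R) ((Q → ZMod 2) × R) ℂ)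
    (a b : (Q → ZMod 2) × R) :
    withRef R (conjugation (onQubit q Pauli.X.mat)) ρ a b =
      ρ (a.1 + Pi.single q 1, a.2) (b.1 + Pi.single q 1, b.2) := by
  have hadd : ∀ v : Q → ZMod 2, v + Pi.single q 1 + Pi.single q 1 = v :=
    fun v => vec_add_cancel v _
  rw [withRef_apply, conjugation, sandwich_apply]
  rw [Matrix.mul_apply, Finset.sum_eq_single (b.1 + Pi.single q 1)]
  · rw [Matrix.mul_apply, Finset.sum_eq_single (a.1 + Pi.single q 1)]
    · rw [Matrix.conjTranspose_apply, onQubit_X_apply, onQubit_X_apply, if_pos (hadd _).symm,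
        if_pos (hadd _).symm]
      simp
    · intro x _ hx
      rw [onQubit_X_apply, if_neg, zero_mul]
      rintro h
      exact hx (by rw [h, hadd])
    · simp
  · intro x _ hx
    rw [Matrix.conjTranspose_apply, onQubit_X_apply, if_neg, star_zero, mul_zero]
    rintro h
    exact hx (by rw [h, hadd])
  · simp

lemma pauliProjector_Z_apply (q : Q) (b : ZMod 2) (y x : Q → ZMod 2) :
    pauliProjector Pauli.Z q b y x = if y = x ∧ x q = b then 1 else 0 := by
  have : y = x ↔ (∀ p, p ≠ q → y p = x p) ∧ y q = x q := by
    constructor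
    · rintro rfl; simp
    · rintro ⟨h, h'⟩
      funext p
      by_cases hp : p = q
      · subst hp; exact h'
      · exact h p hp
  have key : ∀ c d : ZMod 2, ((1 / 2 : ℂ) • (1 + (if b = 0 then (1 : ℂ) else -1) • Pauli.Z.mat)) c d =
      if c = d ∧ d = b then 1 else 0 := by
    intro c d
    rw [Matrix.smul_apply, Matrix.add_apply, Matrix.smul_apply]
    rcases zmod_two_eq_zero_or_one c with rfl | rfl <;>
      rcases zmod_two_eq_zero_or_one d with rfl | rfl <;>
      rcases zmod_two_eq_zero_or_one b with rfl | rfl <;>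
      simp [Pauli.mat] <;> norm_num
  rw [pauliProjector, onQubit, Matrix.of_apply, key]
  simp only [this, ite_and]

lemma withRef_conjugation_Z_apply (q : Q) (c : ZMod 2)
    (ρ : Matrix ((Q → ZMod 2) × R) ((Q → ZMod 2) × R) ℂ) (a b : (Q → ZMod 2) × R) :
    withRef R (conjugation (pauliProjector Pauli.Z q c)) ρ a b =
      if a.1 q = c ∧ b.1 q = c then ρ a b else 0 := by
  rw [withRef_apply, conjugation, sandwich_apply]
  rw [Matrix.mul_apply, Finset.sum_eq_single b.1]
  · rw [Matrix.mul_apply, Finset.sum_eq_single a.1]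
    · rw [Matrix.conjTranspose_apply, pauliProjector_Z_apply, pauliProjector_Z_apply]
      by_cases h : a.1 q = c <;> by_cases h' : b.1 q = c <;> simp [h, h']
    · intro x _ hx
      rw [pauliProjector_Z_apply, if_neg (fun h => hx h.1.symm), zero_mul]
    · simp
  · intro x _ hx
    rw [Matrix.conjTranspose_apply, pauliProjector_Z_apply, if_neg (fun h => hx h.1.symm),
      star_zero, mul_zero]
  · simp

end Gates

section Folds

variable {Q R ι : Type*} [Fintype Q] [DecidableEq Q] {M : ℕ}

/-- Measuring `Z` on several qubits, with the outcomes written into distinct bits of a register that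
starts in the state `0`, keeps the entries both of whose indices agree with the register. -/
lemma foldl_measure_apply (q : ι → Q) (bit : ι → Fin M) (hbit : Function.Injective bit)
    (hZ : Pauli.Z ≠ Pauli.I) (ρ : Matrix ((Q → ZMod 2) × R) ((Q → ZMod 2) × R) ℂ)
    (τ₀ : HybridState M ((Q → ZMod 2) × R)) (hτ₀ : ∀ x, τ₀ x = if x = 0 then ρ else 0)
    (l : List ι) (hl : l.Nodup) (x : Fin M → ZMod 2) (a b : (Q → ZMod 2) × R) :
    (l.foldl (fun τ i => (CliffordGate.measure Pauli.Z hZ (q i)).apply (bit i) τ) τ₀) x a b =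
      open Classical in
      if (∀ i ∈ l, a.1 (q i) = x (bit i) ∧ b.1 (q i) = x (bit i)) ∧
        (∀ k, (∀ i ∈ l, k ≠ bit i) → x k = 0) then ρ a b else 0 := by
  classical
  induction l using List.reverseRecOn generalizing x with
  | nil =>
    have : x = 0 ↔ ∀ k, x k = 0 := funext_iff
    by_cases h : x = 0
    · simp [hτ₀, h]
    · simp only [List.foldl_nil, hτ₀, if_neg h]
      rw [if_neg]
      · simp
      · simpa [← this] using h
  | append_singleton l i ih =>
    have hl' : l.Nodup ∧ i ∉ l := by
      rw [List.nodup_append] at hl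
      exact ⟨hl.1, fun h => hl.2.2 i h i (by simp) rfl⟩
    rw [List.foldl_append, List.foldl_cons, List.foldl_nil]
    simp only [CliffordGate.apply, Matrix.sum_apply, withRef_conjugation_Z_apply, ih hl'.1]
    have hne : ∀ i' ∈ l, bit i' ≠ bit i := fun i' h' hb => hl'.2 (hbit hb ▸ h')
    rw [Finset.sum_eq_single 0]
    · by_cases h1 : a.1 (q i) = x (bit i) ∧ b.1 (q i) = x (bit i)
      · rw [if_pos h1]
        congr 1
        apply propext
        refine and_congr ?_ ?_
        · simp only [List.mem_append, List.mem_singleton]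
          constructor
          · rintro h i' (h' | rfl)
            · simpa [hne i' h'] using h i' h'
            · exact h1
          · intro h i' h'
            simpa [hne i' h'] using h i' (Or.inl h')
        · simp only [List.mem_append, List.mem_singleton]
          constructor
          · intro h k hk
            have := h k fun i' h' => hk i' (Or.inl h')
            rwa [Function.update_of_ne (hk i (Or.inr rfl))] at this
          · intro h k hk
            by_cases hki : k = bit i
            · subst hki; simp
            · rw [Function.update_of_ne hki]
              refine h k ?_
              rintro i' (h' | rfl)
              · exact hk i' h'
              · exact hki
      · rw [if_neg h1, if_neg]
        rintro ⟨h, -⟩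
        exact h1 (h i (by simp))
    · intro c _ hc
      split_ifs with h1 h2
      · exact absurd (by simpa using h2.2 (bit i) fun i' h' => (hne i' h').symm) hc
      · rfl
      · rfl
    · simp

/-- Applying `X` gates controlled by the bits of the register shifts the two indices of a matrix. -/
lemma foldl_flip_apply (q : ι → Q) (bit : ι → Fin M) (τ₀ : HybridState M ((Q → ZMod 2) × R))
    (l : List ι) (x : Fin M → ZMod 2) (a b : (Q → ZMod 2) × R) :
    (l.foldl (fun τ i => (CliffordGate.pauli Pauli.X (q i)).apply (bit i) τ) τ₀) x a b =
      τ₀ x (a.1 + (l.map fun i => Pi.single (q i) (x (bit i))).sum, a.2)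
        (b.1 + (l.map fun i => Pi.single (q i) (x (bit i))).sum, b.2) := by
  induction l using List.reverseRecOn generalizing a b with
  | nil => simp
  | append_singleton l i ih =>
    rw [List.foldl_append, List.foldl_cons, List.foldl_nil]
    simp only [CliffordGate.apply, CliffordGate.channel, List.map_append, List.sum_append,
      List.map_cons, List.map_nil, List.sum_cons, List.sum_nil, add_zero]
    rcases zmod_two_eq_zero_or_one (x (bit i)) with h | h
    · rw [if_neg (by rw [h]; decide), h, Pi.single_zero, add_zero, ih]
    · rw [if_pos h, h, withRef_conjugation_X_apply, ih]
      rw [add_assoc, add_assoc, add_comm (Pi.single (q i) 1)]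

end Folds

/-! ### Vectors and partial traces on a register split into two parts -/

section Glue

variable {P U Q : Type*}

/-- The vector on `Q` with given values on the two parts of a decomposition of `Q`. -/
def glue (e : P ⊕ U ≃ Q) (y : P → ZMod 2) (t : U → ZMod 2) : Q → ZMod 2 :=
  fun q => Sum.elim y t (e.symm q)

/-- The restriction of a vector to the first part of a decomposition. -/
def leftPart (e : P ⊕ U ≃ Q) (v : Q → ZMod 2) : P → ZMod 2 := fun p => v (e (Sum.inl p))

/-- The restriction of a vector to the second part of a decomposition. -/
def rightPart (e : P ⊕ U ≃ Q) (v : Q → ZMod 2) : U → ZMod 2 := fun u => v (e (Sum.inr u))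

variable (e : P ⊕ U ≃ Q)

@[simp] lemma glue_inl (y : P → ZMod 2) (t : U → ZMod 2) (p : P) :
    glue e y t (e (Sum.inl p)) = y p := by simp [glue]

@[simp] lemma glue_inr (y : P → ZMod 2) (t : U → ZMod 2) (u : U) :
    glue e y t (e (Sum.inr u)) = t u := by simp [glue]

@[simp] lemma leftPart_glue (y : P → ZMod 2) (t : U → ZMod 2) : leftPart e (glue e y t) = y := by
  funext p; simp [leftPart]

@[simp] lemma rightPart_glue (y : P → ZMod 2) (t : U → ZMod 2) : rightPart e (glue e y t) = t := by
  funext p; simp [rightPart]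

lemma leftPart_add (v v' : Q → ZMod 2) : leftPart e (v + v') = leftPart e v + leftPart e v' := rfl

lemma rightPart_add (v v' : Q → ZMod 2) : rightPart e (v + v') = rightPart e v + rightPart e v' :=
  rfl

lemma ext_parts {v v' : Q → ZMod 2} (hl : leftPart e v = leftPart e v')
    (hr : rightPart e v = rightPart e v') : v = v' := by
  funext q
  obtain ⟨s, rfl⟩ := e.surjective q
  rcases s with p | u
  · exact congrFun hl p
  · exact congrFun hr u

lemma glue_parts (v : Q → ZMod 2) : glue e (leftPart e v) (rightPart e v) = v :=
  ext_parts e (by simp) (by simp)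

lemma dotProduct_parts [Fintype P] [Fintype U] [Fintype Q] (z v : Q → ZMod 2) :
    z ⬝ᵥ v = leftPart e z ⬝ᵥ leftPart e v + rightPart e z ⬝ᵥ rightPart e v := by
  rw [dotProduct, ← e.sum_comp, Fintype.sum_sum_type]
  rfl

/-- Tracing out the second part of the qubits. -/
lemma keepQubits_apply [Fintype P] [Fintype U] [Fintype Q] [DecidableEq P] [DecidableEq U]
    [DecidableEq Q] (ι : P ↪ Q) (hι : ∀ p, ι p = e (Sum.inl p))
    (ρ : Matrix (Q → ZMod 2) (Q → ZMod 2) ℂ) (y y' : P → ZMod 2) :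
    keepQubits ι ρ y y' = ∑ t, ρ (glue e y t) (glue e y' t) := by
  have hfst : ∀ (v : Q → ZMod 2) (y : P → ZMod 2), (∀ p, v (ι p) = y p) ↔ leftPart e v = y := by
    intro v y
    simp only [hι, funext_iff, leftPart]
  have hsnd : ∀ v v' : Q → ZMod 2, (∀ q, (∀ p, ι p ≠ q) → v q = v' q) ↔
      rightPart e v = rightPart e v' := by
    intro v v'
    constructor
    · intro h
      funext u
      exact h _ fun p => by simp [hι]
    · intro h q hq
      obtain ⟨s, rfl⟩ := e.surjective q
      rcases s with p | u
      · exact absurd (hι p) (hq p)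
      · exact congrFun h u
  simp only [keepQubits, LinearMap.coe_mk, AddHom.coe_mk, Matrix.of_apply, hfst, hsnd]
  let E : (P → ZMod 2) × (U → ZMod 2) ≃ (Q → ZMod 2) :=
    { toFun := fun s => glue e s.1 s.2
      invFun := fun v => (leftPart e v, rightPart e v)
      left_inv := fun s => by simp
      right_inv := fun v => glue_parts e v }
  rw [← E.sum_comp, Fintype.sum_prod_type, Finset.sum_eq_single y]
  · refine Finset.sum_congr rfl fun t _ => ?_
    rw [← E.sum_comp, Fintype.sum_prod_type, Finset.sum_eq_single y', Finset.sum_eq_single t]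
    · simp [E]
    · intro t' _ ht'
      simp [E, ht'.symm]
    · simp
    · intro x _ hx
      simp [E, hx]
    · simp
  · intro x _ hx
    simp [E, hx]
  · simp

lemma keepQubits_refl [Fintype Q] [DecidableEq Q] (ρ : Matrix (Q → ZMod 2) (Q → ZMod 2) ℂ) :
    keepQubits (Function.Embedding.refl Q) ρ = ρ := by
  ext y y'
  rw [keepQubits_apply (Equiv.sumEmpty Q Empty) _ (fun _ => rfl)]
  rw [Fintype.sum_eq_single (fun u : Empty => nomatch u)]
  · rfl
  · intro t ht
    exact absurd (Subsingleton.elim _ _) ht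

end Glue

/-! ### The circuit that measures and corrects -/

section Register

variable {P U Q : Type*} [Fintype U] [Fintype Q]

/-- The position of the measurement outcome of the qubit `u` in the classical register. -/
noncomputable def outcomeBit (e : P ⊕ U ≃ Q) (u : U) : Fin (Fintype.card Q) :=
  Fin.castLE (Fintype.card_le_of_injective _ (e.injective.comp Sum.inr_injective))
    (Fintype.equivFin U u)

variable (e : P ⊕ U ≃ Q)

lemma outcomeBit_injective : Function.Injective (outcomeBit e) := fun _ _ h =>
  (Fintype.equivFin U).injective (Fin.castLE_injective _ h)

/-- The register that holds the measurement outcomes `t` and is `0` elsewhere. -/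
noncomputable def record (t : U → ZMod 2) : Fin (Fintype.card Q) → ZMod 2 := fun k =>
  open Classical in if h : ∃ u, outcomeBit e u = k then t h.choose else 0

@[simp] lemma record_outcomeBit (t : U → ZMod 2) (u : U) : record e t (outcomeBit e u) = t u := by
  have h : ∃ u', outcomeBit e u' = outcomeBit e u := ⟨u, rfl⟩
  rw [record, dif_pos h, outcomeBit_injective e h.choose_spec]

lemma eq_record_iff (x : Fin (Fintype.card Q) → ZMod 2) (t : U → ZMod 2) :
    x = record e t ↔ (∀ u, t u = x (outcomeBit e u)) ∧ ∀ k, (∀ u, k ≠ outcomeBit e u) → x k = 0 := by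
  constructor
  · rintro rfl
    refine ⟨fun u => by simp, fun k hk => ?_⟩
    rw [record, dif_neg]
    rintro ⟨u, rfl⟩
    exact hk u rfl
  · rintro ⟨h, h'⟩
    funext k
    by_cases hk : ∃ u, outcomeBit e u = k
    · obtain ⟨u, rfl⟩ := hk
      rw [record_outcomeBit, h]
    · rw [h' k fun u hu => hk ⟨u, hu.symm⟩, record, dif_neg hk]

end Register

section Circuit

variable {P U Q R : Type*} [Fintype P] [Fintype U] [Fintype Q] [DecidableEq Q]

/-- The position of the bit that controls the correction of the qubit `p` in the classical register. -/
noncomputable def correctionBit (e : P ⊕ U ≃ Q) (p : P) : Fin (Fintype.card Q) :=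
  Fin.castLE (Fintype.card_le_of_injective _ (e.injective.comp Sum.inl_injective))
    (Fintype.equivFin P p)

/-- The circuit that measures `Z` on the qubits `U` and then flips the qubits `P` as told by the
function `f` of the measurement outcomes.  The classical register is cleared before the first step. -/
noncomputable def measureAndCorrect (e : P ⊕ U ≃ Q) (f : (U → ZMod 2) → (P → ZMod 2)) :
    AdaptiveCliffordCircuit Q (Fintype.card Q) 2 where
  card_le := le_rfl
  classical t := match t with
    | 0 => fun _ => 0
    | 1 => fun x g => if h : g.1 < Fintype.card P then
        f (fun u => x (outcomeBit e u)) ((Fintype.equivFin P).symm ⟨g.1, h⟩) else 0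
  numGates t := match t with
    | 0 => Fintype.card U
    | 1 => Fintype.card P
  numGates_le t := match t with
    | 0 => Fintype.card_le_of_injective _ (e.injective.comp Sum.inr_injective)
    | 1 => Fintype.card_le_of_injective _ (e.injective.comp Sum.inl_injective)
  gate t := match t with
    | 0 => fun i => .measure .Z (by simp) (e (Sum.inr ((Fintype.equivFin U).symm i)))
    | 1 => fun i => .pauli .X (e (Sum.inl ((Fintype.equivFin P).symm i)))
  gate_disjoint t := match t with
    | 0 => fun i i' h => by simpa [CliffordGate.qubits] using h
    | 1 => fun i i' h => by simpa [CliffordGate.qubits] using h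

variable (e : P ⊕ U ≃ Q)

variable (f : (U → ZMod 2) → (P → ZMod 2))

/-- After the first step the register holds the measurement outcome, and the entries of the state whose
indices differ on the measured qubits vanish. -/
lemma step_zero_apply (σ : HybridState (Fintype.card Q) ((Q → ZMod 2) × R))
    (x : Fin (Fintype.card Q) → ZMod 2) (a b : (Q → ZMod 2) × R) :
    (measureAndCorrect e f).step R 0 σ x a b =
      if x = record e (rightPart e a.1) ∧ rightPart e a.1 = rightPart e b.1
        then (∑ x, σ x) a b else 0 := by
  classical
  have hcl : ∀ x, applyClassical ((measureAndCorrect e f).classical 0) σ x =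
      if x = 0 then ∑ x, σ x else 0 := by
    intro x
    simp only [applyClassical, measureAndCorrect]
    by_cases hx : x = 0
    · simp [hx]
    · simp [hx, Ne.symm hx]
  have := foldl_measure_apply (R := R) (ι := Fin (Fintype.card U))
    (fun i => e (Sum.inr ((Fintype.equivFin U).symm i)))
    (fun i => outcomeBit e ((Fintype.equivFin U).symm i))
    ((outcomeBit_injective e).comp (Fintype.equivFin U).symm.injective) (by simp) (∑ x, σ x) _ hcl
    (List.finRange _) (List.nodup_finRange _) x a b
  refine Eq.trans ?_ (this.trans ?_)
  · simp only [AdaptiveCliffordCircuit.step]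
    simp only [measureAndCorrect, outcomeBit, Equiv.apply_symm_apply]
  · congr 1
    apply propext
    have h1 : ∀ p : Fin (Fintype.card U) → Prop, (∀ i, p i) ↔ ∀ u, p (Fintype.equivFin U u) :=
      fun p => (Fintype.equivFin U).forall_congr_right.symm
    simp only [List.mem_finRange, true_imp_iff, h1, Equiv.symm_apply_apply, eq_record_iff]
    simp only [funext_iff, rightPart]
    constructor
    · rintro ⟨h, h'⟩
      exact ⟨⟨fun u => (h u).1, h'⟩, fun u => (h u).1.trans (h u).2.symm⟩
    · rintro ⟨⟨h, h'⟩, h''⟩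
      exact ⟨fun u => ⟨h u, (h'' u).symm.trans (h u)⟩, h'⟩

/-- The second step, with the register traced out: for each content of the register, the flips computed
from it shift the indices. -/
lemma step_one_sum (τ : HybridState (Fintype.card Q) ((Q → ZMod 2) × R))
    (a b : (Q → ZMod 2) × R) :
    (∑ x, (measureAndCorrect e f).step R 1 τ x) a b =
      ∑ x, τ x (a.1 + glue e (f fun u => x (outcomeBit e u)) 0, a.2)
        (b.1 + glue e (f fun u => x (outcomeBit e u)) 0, b.2) := by
  have hstep : ∀ x, (measureAndCorrect e f).step R 1 τ x a b =
      applyClassical ((measureAndCorrect e f).classical 1) τ x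
        (a.1 + glue e (fun p => x (correctionBit e p)) 0, a.2)
        (b.1 + glue e (fun p => x (correctionBit e p)) 0, b.2) := by
    intro x
    have := foldl_flip_apply (R := R) (ι := Fin (Fintype.card P))
      (fun i => e (Sum.inl ((Fintype.equivFin P).symm i)))
      (fun i => correctionBit e ((Fintype.equivFin P).symm i))
      (applyClassical ((measureAndCorrect e f).classical 1) τ) (List.finRange _) x a b
    have hs : ((List.finRange (Fintype.card P)).map fun i =>
        Pi.single (M := fun _ => ZMod 2) (e (Sum.inl ((Fintype.equivFin P).symm i)))
          (x (correctionBit e ((Fintype.equivFin P).symm i)))).sum =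
        glue e (fun p => x (correctionBit e p)) 0 := by
      classical
      rw [← List.ofFn_eq_map, List.sum_ofFn]
      rw [(Fintype.equivFin P).symm.sum_comp fun p =>
        Pi.single (M := fun _ => ZMod 2) (e (Sum.inl p)) (x (correctionBit e p))]
      refine ext_parts e ?_ ?_
      · funext p
        rw [leftPart_glue]
        simp only [leftPart, Finset.sum_apply, Pi.single_apply, e.injective.eq_iff,
          Sum.inl_injective.eq_iff]
        simp
      · funext u
        rw [rightPart_glue]
        simp [rightPart, Finset.sum_apply, e.injective.eq_iff]
    rw [hs] at this
    rw [← this]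
    simp only [AdaptiveCliffordCircuit.step]
    simp only [measureAndCorrect, correctionBit, Equiv.apply_symm_apply]
  have hcor : ∀ x p, (measureAndCorrect e f).classical 1 x (correctionBit e p) =
      f (fun u => x (outcomeBit e u)) p := by
    intro x p
    simp [measureAndCorrect, correctionBit]
  simp only [Matrix.sum_apply, hstep, applyClassical]
  rw [Finset.sum_comm]
  refine Finset.sum_congr rfl fun x _ => ?_
  rw [Fintype.sum_eq_single ((measureAndCorrect e f).classical 1 x)]
  · simp only [if_true, hcor]
  · intro x' hx'
    rw [if_neg hx'.symm, Matrix.zero_apply]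

end Circuit

section Run

variable {P U Q R : Type*} [Fintype P] [Fintype U] [Fintype Q] [DecidableEq Q]

/-- The vector of bit flips of a Pauli string. -/
def flips {Q : Type*} (A : Q → Pauli) : Q → ZMod 2 := fun q => (A q).flip

/-- The vector of phase flips of a Pauli string. -/
def signs {Q : Type*} (A : Q → Pauli) : Q → ZMod 2 := fun q => (A q).sign

lemma exists_withRef_superop_apply (R : Type*) (A B : Q → Pauli) :
    ∃ c : ℂ, c ≠ 0 ∧ ∀ (ρ : Matrix ((Q → ZMod 2) × R) ((Q → ZMod 2) × R) ℂ)
      (a b : (Q → ZMod 2) × R), withRef R (Pauli.superop A B) ρ a b =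
        c * (sgn (signs A ⬝ᵥ a.1) * sgn (signs B ⬝ᵥ b.1) *
          ρ (a.1 + flips A, a.2) (b.1 + flips B, b.2)) := by
  obtain ⟨c, hc, h⟩ := Pauli.exists_superop_apply A B
  refine ⟨c, hc, fun ρ a b => ?_⟩
  rw [withRef_apply, h]
  rfl

lemma run_eq (C : AdaptiveCliffordCircuit Q (Fintype.card Q) 2) (F : PauliFault Q 2)
    (σ : HybridState (Fintype.card Q) ((Q → ZMod 2) × R)) :
    C.run F R σ = fun x => withRef R (Pauli.superop (F.left 1) (F.right 1)) (C.step R 1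
      (fun x => withRef R (Pauli.superop (F.left 0) (F.right 0)) (C.step R 0 σ x)) x) := by
  simp [AdaptiveCliffordCircuit.run, List.finRange_succ]

/-- The output of the corrupted circuit, after the measured qubits and the classical register are
traced out, in terms of its input.  The summation index `T` is the measurement outcome. -/
lemma exists_trace_run_apply [DecidableEq P] [DecidableEq U] (e : P ⊕ U ≃ Q)
    (f : (U → ZMod 2) → (P → ZMod 2)) (ι : P ↪ Q) (hι : ∀ p, ι p = e (Sum.inl p))
    (F : PauliFault Q 2) (a₁ a₁' a₂ a₂' : Q → ZMod 2) (ha₁ : a₁ = flips (F.left 0))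
    (ha₁' : a₁' = flips (F.right 0)) (ha₂ : a₂ = flips (F.left 1)) (ha₂' : a₂' = flips (F.right 1)) :
    ∃ c : ℂ, ∀ (σ : HybridState (Fintype.card Q) ((Q → ZMod 2) × R)) (y y' : P → ZMod 2) (r r' : R),
      withRef R (keepQubits ι) (∑ x, (measureAndCorrect e f).run F R σ x) (y, r) (y', r') =
        if rightPart e (a₁ + a₂) = rightPart e (a₁' + a₂') then
          c * ∑ T : U → ZMod 2,
            (sgn (signs (F.left 1) ⬝ᵥ (glue e (y + leftPart e (a₁ + a₂) + f T) T + a₁ + a₂ +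
              glue e (f T) 0)) *
            sgn (signs (F.left 0) ⬝ᵥ (glue e (y + leftPart e (a₁ + a₂) + f T) T + a₁))) *
            (sgn (signs (F.right 1) ⬝ᵥ (glue e (y' + leftPart e (a₁' + a₂') + f T) T + a₁' + a₂' +
              glue e (f T) 0)) *
            sgn (signs (F.right 0) ⬝ᵥ (glue e (y' + leftPart e (a₁' + a₂') + f T) T + a₁'))) *
            (∑ x, σ x) (glue e (y + leftPart e (a₁ + a₂) + f T) T, r)
              (glue e (y' + leftPart e (a₁' + a₂') + f T) T, r')
        else 0 := by
  obtain ⟨c₁, -, h₁⟩ := exists_withRef_superop_apply R (F.left 0) (F.right 0)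
  obtain ⟨c₂, -, h₂⟩ := exists_withRef_superop_apply R (F.left 1) (F.right 1)
  refine ⟨c₁ * c₂, fun σ y y' r r' => ?_⟩
  rw [withRef_apply, keepQubits_apply e ι hι]
  simp only [run_eq, ← map_sum, Matrix.of_apply, h₂]
  simp only [step_one_sum, h₁, step_zero_apply]
  rw [← ha₁, ← ha₁', ← ha₂, ← ha₂']
  have hv : ∀ (z : P → ZMod 2) (t : U → ZMod 2) (a b : Q → ZMod 2) (p : P → ZMod 2),
      glue e z t + b + glue e p 0 + a = glue e (z + leftPart e (a + b) + p) (t + rightPart e (a + b)) := by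
    intro z t a b p
    refine ext_parts e ?_ ?_
    · simp only [leftPart_add, leftPart_glue]; abel
    · simp only [rightPart_add, rightPart_glue]; abel
  simp only [hv, rightPart_glue]
  have key : ∀ t : U → ZMod 2,
      (∑ x : Fin (Fintype.card Q) → ZMod 2, c₁ *
        (sgn (signs (F.left 0) ⬝ᵥ (glue e y t + a₂ + glue e (f fun u => x (outcomeBit e u)) 0)) *
          sgn (signs (F.right 0) ⬝ᵥ (glue e y' t + a₂' + glue e (f fun u => x (outcomeBit e u)) 0)) *
          if x = record e (t + rightPart e (a₁ + a₂)) ∧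
              t + rightPart e (a₁ + a₂) = t + rightPart e (a₁' + a₂')
          then (∑ x, σ x)
            (glue e (y + leftPart e (a₁ + a₂) + f fun u => x (outcomeBit e u))
              (t + rightPart e (a₁ + a₂)), r)
            (glue e (y' + leftPart e (a₁' + a₂') + f fun u => x (outcomeBit e u))
              (t + rightPart e (a₁' + a₂')), r')
          else 0)) =
      if rightPart e (a₁ + a₂) = rightPart e (a₁' + a₂') then
        c₁ * (sgn (signs (F.left 0) ⬝ᵥ (glue e y t + a₂ +
            glue e (f (t + rightPart e (a₁ + a₂))) 0)) *
          sgn (signs (F.right 0) ⬝ᵥ (glue e y' t + a₂' +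
            glue e (f (t + rightPart e (a₁ + a₂))) 0)) *
          (∑ x, σ x)
            (glue e (y + leftPart e (a₁ + a₂) + f (t + rightPart e (a₁ + a₂)))
              (t + rightPart e (a₁ + a₂)), r)
            (glue e (y' + leftPart e (a₁' + a₂') + f (t + rightPart e (a₁ + a₂)))
              (t + rightPart e (a₁' + a₂')), r'))
      else 0 := by
    intro t
    rw [Fintype.sum_eq_single (record e (t + rightPart e (a₁ + a₂)))]
    · have hrec : (fun u => record e (t + rightPart e (a₁ + a₂)) (outcomeBit e u)) =
          t + rightPart e (a₁ + a₂) := funext fun u => record_outcomeBit e _ u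
      simp only [hrec, true_and, add_right_inj]
      split_ifs
      · rfl
      · simp
    · intro x hx
      simp [hx]
  simp only [key]
  by_cases h : rightPart e (a₁ + a₂) = rightPart e (a₁' + a₂')
  · simp only [← h, if_true]
    rw [Finset.mul_sum, ← Equiv.sum_comp (Equiv.addRight (rightPart e (a₁ + a₂)))]
    refine Finset.sum_congr rfl fun T _ => ?_
    simp only [Equiv.coe_addRight, vec_add_cancel]
    have hv' : ∀ (z : P → ZMod 2) (a b : Q → ZMod 2) (p : P → ZMod 2),
        rightPart e (a + b) = rightPart e (a₁ + a₂) →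
        glue e z (T + rightPart e (a₁ + a₂)) + b + glue e p 0 =
          glue e (z + leftPart e (a + b) + p) T + a := by
      intro z a b p hab
      rw [eq_comm, ← vec_add_cancel (_ + b + _) a, hv, hab, vec_add_cancel]
    have hv'' : ∀ (z : P → ZMod 2) (a b : Q → ZMod 2) (p : P → ZMod 2),
        rightPart e (a + b) = rightPart e (a₁ + a₂) →
        glue e z (T + rightPart e (a₁ + a₂)) =
          glue e (z + leftPart e (a + b) + p) T + a + b + glue e p 0 := by
      intro z a b p hab
      rw [← hv' z a b p hab, add_right_comm _ b, vec_add_cancel, vec_add_cancel]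
    rw [hv' y a₁ a₂ _ rfl, hv' y' a₁' a₂' _ h.symm, hv'' y a₁ a₂ (f T) rfl,
      hv'' y' a₁' a₂' (f T) h.symm]
    ring
  · simp [h]

end Run

/-! ### Character sums over cosets -/

section CharacterSums

variable {U : Type*} [Fintype U] [DecidableEq U]

/-- The sum of a character over a coset of a subspace vanishes unless the character is trivial on the
subspace.  Hence it is the same for all cosets `v - a + S` for which `χ v = 0` whenever `χ` is trivial
on `S`. -/
lemma exists_sum_coset_eq (S : Submodule (ZMod 2) (U → ZMod 2)) (χ : (U → ZMod 2) →ₗ[ZMod 2] ZMod 2)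
    (a : U → ZMod 2) :
    open Classical in
    ∃ K : ℂ, ∀ v : U → ZMod 2, ((∀ s ∈ S, χ s = 0) → χ v = 0) →
      (∑ T, if T + a - v ∈ S then sgn (χ T) else 0) = K := by
  classical
  have hshift : ∀ v : U → ZMod 2, (∑ T, if T + a - v ∈ S then sgn (χ T) else 0) =
      sgn (χ v - χ a) * ∑ T, if T ∈ S then sgn (χ T) else 0 := by
    intro v
    rw [← Equiv.sum_comp (Equiv.addRight (v - a)), Finset.mul_sum]
    refine Finset.sum_congr rfl fun T _ => ?_
    have : T + (v - a) + a - v = T := by abel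
    simp only [Equiv.coe_addRight, this, map_add, map_sub, sgn_add]
    split_ifs <;> ring
  by_cases hχ : ∀ s ∈ S, χ s = 0
  · exact ⟨_, fun v hv => by rw [hshift, hv hχ]⟩
  · refine ⟨0, fun v _ => ?_⟩
    push Not at hχ
    obtain ⟨s, hs, hs'⟩ := hχ
    have h1 : χ s = 1 := zmod_two_eq_one hs'
    have hneg : (∑ T, if T ∈ S then sgn (χ T) else 0) = -∑ T, if T ∈ S then sgn (χ T) else 0 := by
      conv_lhs => rw [← Equiv.sum_comp (Equiv.addRight s)]
      rw [← Finset.sum_neg_distrib]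
      refine Finset.sum_congr rfl fun T _ => ?_
      simp only [Equiv.coe_addRight, S.add_mem_iff_left hs, map_add, h1, sgn_add]
      split_ifs <;> simp [sgn]
    rw [hshift, self_eq_neg.1 hneg, mul_zero]

end CharacterSums

/-! ### The output of the corrupted circuit -/

section Gadget

variable {P U Q : Type*} [Fintype P] [Fintype U] [Fintype Q]

/-- The signs that the phase flips before the circuit, after the first and after the second step produce
together.  The flips `w` on `P` take place in the second step, so that `z₂` sees them twice. -/
lemma sign_phase (e : P ⊕ U ≃ Q) (z₀ z₁ z₂ a₁ a₂ : Q → ZMod 2) :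
    ∃ c : ℂ, ∀ (y w : P → ZMod 2) (T : U → ZMod 2),
      sgn (z₂ ⬝ᵥ (glue e (y + leftPart e (a₁ + a₂) + w) T + a₁ + a₂ + glue e w 0)) *
        sgn (z₁ ⬝ᵥ (glue e (y + leftPart e (a₁ + a₂) + w) T + a₁)) *
        sgn (z₀ ⬝ᵥ glue e (y + leftPart e (a₁ + a₂) + w) T) =
      c * sgn (leftPart e (z₀ + z₁ + z₂) ⬝ᵥ y) *
        sgn (leftPart e (z₀ + z₁) ⬝ᵥ w + rightPart e (z₀ + z₁ + z₂) ⬝ᵥ T) := by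
  refine ⟨sgn (z₂ ⬝ᵥ (a₁ + a₂) + z₁ ⬝ᵥ a₁ +
    leftPart e (z₀ + z₁ + z₂) ⬝ᵥ leftPart e (a₁ + a₂)), fun y w T => ?_⟩
  rw [← sgn_add, ← sgn_add, ← sgn_add, ← sgn_add]
  congr 1
  simp only [dotProduct_parts e, leftPart_add, rightPart_add, leftPart_glue, rightPart_glue,
    dotProduct_add, add_dotProduct, dotProduct_zero]
  linear_combination (leftPart e z₂ ⬝ᵥ w) * CharTwo.two_eq_zero (R := ZMod 2)

lemma withRef_encChannel_apply {V P' K R : Type*} [Fintype K] [DecidableEq K]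
    (D : DecoratedCode V P' K)
    (ρ : Matrix ((K → ZMod 2) × R) ((K → ZMod 2) × R) ℂ) (a b : (P' → ZMod 2) × R) :
    withRef R D.encChannel ρ a b =
      ∑ k, ∑ k', D.enc a.1 k * ρ (k, a.2) (k', b.2) * star (D.enc b.1 k') := by
  rw [withRef_apply, DecoratedCode.encChannel, sandwich_apply, Matrix.mul_apply]
  simp only [Matrix.mul_apply, Finset.sum_mul, Matrix.of_apply, Matrix.conjTranspose_apply]
  exact Finset.sum_comm

/-- A bilinear expression in a partial trace, as a sum over pairs of indices that agree on the discarded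
qubits. -/
lemma keepQubits_sum {K K' : Type*} [Fintype K] [Fintype K'] [DecidableEq K] [DecidableEq K']
    (ι : K' ↪ K) (ρ : Matrix (K → ZMod 2) (K → ZMod 2) ℂ) (g g' : (K' → ZMod 2) → ℂ) :
    ∑ l, ∑ l', g l * keepQubits ι ρ l l' * g' l' =
      ∑ k, ∑ k', open Classical in
        if ∀ q, (∀ p, ι p ≠ q) → k q = k' q then g (k ∘ ι) * ρ k k' * g' (k' ∘ ι) else 0 := by
  classical
  have hk : ∀ (k : K → ZMod 2) (l : K' → ZMod 2), (∀ p, k (ι p) = l p) ↔ l = k ∘ ι := by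
    intro k l
    rw [eq_comm, funext_iff]; rfl
  simp only [keepQubits, LinearMap.coe_mk, AddHom.coe_mk, Matrix.of_apply, hk, Finset.mul_sum,
    Finset.sum_mul]
  rw [Finset.sum_congr rfl fun l _ => Finset.sum_comm]
  rw [Finset.sum_comm]
  refine Finset.sum_congr rfl fun k _ => ?_
  rw [Finset.sum_congr rfl fun l _ => Finset.sum_congr rfl fun l' _ => rfl]
  simp only [Finset.sum_comm (s := (Finset.univ : Finset (K' → ZMod 2)))
    (t := (Finset.univ : Finset (K → ZMod 2)))]
  refine Finset.sum_congr rfl fun k' _ => ?_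
  rw [Fintype.sum_eq_single (k ∘ ι), Fintype.sum_eq_single (k' ∘ ι)]
  · simp only [true_and]
    split_ifs <;> simp
  · intro l hl
    simp [hl]
  · intro l hl
    simp [hl]

variable [DecidableEq P] [DecidableEq U] [DecidableEq Q]

set_option maxHeartbeats 1000000 in
/-- The output of the corrupted circuit is a Pauli deviation.  The code on `Q` splits, after the linear
map `(y, t) ↦ (y + s t, t)`, into a code on `P` with cosets of `SP` and a code on `U` with cosets of
`SU`.  The decoder `dec` maps a syndrome to an error; on the flips of the input deviation it is off by an
element of `SU`, and the correction that it induces on `P` is off by `α` (resp. `α'`). -/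
theorem exists_output_deviation {V V' Kin Kout W R : Type*} [Fintype Kin] [DecidableEq Kin]
    [Fintype Kout] [DecidableEq Kout] [AddCommGroup W] [Module (ZMod 2) W]
    (e : P ⊕ U ≃ Q) (ι : P ↪ Q) (hι : ∀ p, ι p = e (Sum.inl p))
    (Din : DecoratedCode V Q Kin) (Dout : DecoratedCode V' P Kout) (log : Kout ↪ Kin)
    (SU : Submodule (ZMod 2) (U → ZMod 2)) (SP : Submodule (ZMod 2) (P → ZMod 2))
    (s : (U → ZMod 2) →ₗ[ZMod 2] (P → ZMod 2))
    (EU : (Kin → ZMod 2) → (U → ZMod 2)) (EP : (Kout → ZMod 2) → (P → ZMod 2))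
    (nin nout : ℂ) (hnout : nout ≠ 0)
    (hin : open Classical in ∀ y t k, Din.enc (glue e y t) k =
      if t - EU k ∈ SU ∧ y + s t - EP (k ∘ log) ∈ SP then nin else 0)
    (hout : open Classical in ∀ y k, Dout.enc y k = if y - EP k ∈ SP then nout else 0)
    (hEU : ∀ k k', EU k - EU k' ∈ SU → ∀ q, (∀ p, log p ≠ q) → k q = k' q)
    (hEU' : ∀ k k', (∀ q, (∀ p, log p ≠ q) → k q = k' q) → EU k - EU k' ∈ SU)
    (syn : (U → ZMod 2) →ₗ[ZMod 2] W) (hsyn : ∀ t ∈ SU, syn t = 0) (hsyn' : ∀ k, syn (EU k) = 0)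
    (dec : W → U → ZMod 2)
    (A B : Q → Pauli) (F : PauliFault Q 2) (α α' : P → ZMod 2)
    (hd : rightPart e (flips A) + dec (syn (rightPart e (flips A))) ∈ SU)
    (hd' : rightPart e (flips B) + dec (syn (rightPart e (flips B))) ∈ SU)
    (hα : s (rightPart e (flips A) + dec (syn (rightPart e (flips A)))) + α ∈ SP)
    (hα' : s (rightPart e (flips B) + dec (syn (rightPart e (flips B)))) + α' ∈ SP)
    (hZ : (∀ w ∈ SU,
        leftPart e (signs A + signs (F.left 0) + (signs B + signs (F.right 0))) ⬝ᵥ s w +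
        rightPart e (signs A + signs (F.left 0) + signs (F.left 1) +
          (signs B + signs (F.right 0) + signs (F.right 1))) ⬝ᵥ w = 0) →
      ∀ k,
        leftPart e (signs A + signs (F.left 0) + (signs B + signs (F.right 0))) ⬝ᵥ s (EU k) +
        rightPart e (signs A + signs (F.left 0) + signs (F.left 1) +
          (signs B + signs (F.right 0) + signs (F.right 1))) ⬝ᵥ EU k = 0)
    (ρ : Matrix ((Kin → ZMod 2) × R) ((Kin → ZMod 2) × R) ℂ)
    (σ : HybridState (Fintype.card Q) ((Q → ZMod 2) × R)) (c₀ : ℂ)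
    (hσ : ∑ x, σ x = c₀ • withRef R (Pauli.superop A B) (withRef R Din.encChannel ρ)) :
    ∃ c : ℂ, withRef R (keepQubits ι)
        (∑ x, (measureAndCorrect e fun t => s (t + dec (syn t))).run F R σ x) =
      c • withRef R (Pauli.superop
        (fun p => Pauli.ofBits (leftPart e (flips A + flips (F.left 0) + flips (F.left 1)) p + α p)
          (leftPart e (signs A + signs (F.left 0) + signs (F.left 1)) p))
        (fun p => Pauli.ofBits (leftPart e (flips B + flips (F.right 0) + flips (F.right 1)) p + α' p)
          (leftPart e (signs B + signs (F.right 0) + signs (F.right 1)) p)))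
        (withRef R Dout.encChannel (withRef R (keepQubits log) ρ)) := by
  classical
  set f : (U → ZMod 2) → (P → ZMod 2) := fun t => s (t + dec (syn t)) with hf
  set Aout : P → Pauli :=
    fun p => Pauli.ofBits (leftPart e (flips A + flips (F.left 0) + flips (F.left 1)) p + α p)
      (leftPart e (signs A + signs (F.left 0) + signs (F.left 1)) p) with hAout
  set Bout : P → Pauli :=
    fun p => Pauli.ofBits (leftPart e (flips B + flips (F.right 0) + flips (F.right 1)) p + α' p)
      (leftPart e (signs B + signs (F.right 0) + signs (F.right 1)) p) with hBout
  have hsA : signs Aout = leftPart e (signs A + signs (F.left 0) + signs (F.left 1)) := by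
    funext p; simp [signs, hAout]
  have hsB : signs Bout = leftPart e (signs B + signs (F.right 0) + signs (F.right 1)) := by
    funext p; simp [signs, hBout]
  have hfA : flips Aout = leftPart e (flips A + (flips (F.left 0) + flips (F.left 1))) + α := by
    funext p; simp [flips, hAout, leftPart, add_assoc]
  have hfB : flips Bout = leftPart e (flips B + (flips (F.right 0) + flips (F.right 1))) + α' := by
    funext p; simp [flips, hBout, leftPart, add_assoc]
  obtain ⟨cR, hRun⟩ := exists_trace_run_apply (R := R) e f ι hι F _ _ _ _ rfl rfl rfl rfl
  obtain ⟨cA, -, hA⟩ := exists_withRef_superop_apply R A B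
  obtain ⟨cO, hcO, hO⟩ := exists_withRef_superop_apply R Aout Bout
  obtain ⟨cL, hL⟩ := sign_phase e (signs A) (signs (F.left 0)) (signs (F.left 1))
    (flips (F.left 0)) (flips (F.left 1))
  obtain ⟨cL', hL'⟩ := sign_phase e (signs B) (signs (F.right 0)) (signs (F.right 1))
    (flips (F.right 0)) (flips (F.right 1))
  set βP := leftPart e (signs A + signs (F.left 0) + (signs B + signs (F.right 0))) with hβP
  set βU := rightPart e (signs A + signs (F.left 0) + signs (F.left 1) +
          (signs B + signs (F.right 0) + signs (F.right 1))) with hβU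
  let χ : (U → ZMod 2) →ₗ[ZMod 2] ZMod 2 :=
    { toFun := fun T => βP ⬝ᵥ s T + βU ⬝ᵥ T
      map_add' := fun T T' => by simp only [map_add, dotProduct_add]; ring
      map_smul' := fun c T => by simp [dotProduct_smul, mul_add] }
  obtain ⟨K₀, hK₀⟩ := exists_sum_coset_eq SU χ (rightPart e (flips A))
  have hsub : ∀ {ι' : Type _} (v w : ι' → ZMod 2), v - w = v + w := fun v w => by
    rw [sub_eq_iff_eq_add, vec_add_cancel]
  -- A coset condition on the outcome determines the syndrome.
  have hsynT : ∀ (T a : U → ZMod 2) k, T + a - EU k ∈ SU → syn T = syn a := by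
    intro T a k h
    have := hsyn _ h
    rw [map_sub, hsyn', sub_zero, map_add] at this
    rw [← sub_eq_zero, ← map_sub, hsub, map_add, this]
  have henc : ∀ (a b : Q → ZMod 2) (γ : P → ZMod 2),
      s (rightPart e a + dec (syn (rightPart e a))) + γ ∈ SP →
      ∀ (y : P → ZMod 2) (T : U → ZMod 2) k,
        Din.enc (glue e (y + leftPart e b + f T) T + a) k =
          if T + rightPart e a - EU k ∈ SU then
            nin / nout * Dout.enc (y + (leftPart e (a + b) + γ)) (k ∘ log) else 0 := by
    intro a b γ hγ y T k
    have hg : glue e (y + leftPart e b + f T) T + a =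
        glue e (y + leftPart e b + f T + leftPart e a) (T + rightPart e a) :=
      ext_parts e (by simp [leftPart_add]) (by simp [rightPart_add])
    rw [hg, hin, hout]
    by_cases hT : T + rightPart e a - EU k ∈ SU
    · rw [if_pos hT]
      have heq : y + leftPart e b + f T + leftPart e a + s (T + rightPart e a) - EP (k ∘ log) =
          (y + (leftPart e (a + b) + γ) - EP (k ∘ log)) +
            (s (rightPart e a + dec (syn (rightPart e a))) + γ) := by
        have h1 := vec_add_self (s T)
        have h2 := vec_add_self γ
        have h1' : s T = - s T := eq_neg_of_add_eq_zero_left h1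
        have h2' : γ = - γ := eq_neg_of_add_eq_zero_left h2
        simp only [hf, hsynT T _ k hT, map_add, leftPart_add]
        calc _ = (y + (leftPart e a + leftPart e b) - EP (k ∘ log)) +
              (s (rightPart e a) + s (dec (syn (rightPart e a)))) + (s T + s T) := by abel
          _ = (y + (leftPart e a + leftPart e b) - EP (k ∘ log)) +
              (s (rightPart e a) + s (dec (syn (rightPart e a)))) + (γ + γ) := by rw [h1, h2]
          _ = _ := by abel
      rw [heq, SP.add_mem_iff_left hγ]
      simp only [hT, true_and]
      split_ifs
      · field_simp
      · simp
    · rw [if_neg hT, if_neg fun h => hT h.1]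
  -- The sum over the outcomes does not depend on the logical qubits that are measured.
  have hK : ∃ K : ℂ, ∀ k k', (∑ T, if T + rightPart e (flips A) - EU k ∈ SU then
      (if T + rightPart e (flips B) - EU k' ∈ SU then sgn (βP ⬝ᵥ f T + βU ⬝ᵥ T) else 0) else 0) =
      if ∀ q, (∀ p, log p ≠ q) → k q = k' q then K else 0 := by
    by_cases hab : syn (rightPart e (flips A)) = syn (rightPart e (flips B))
    · have hmem : rightPart e (flips A) - rightPart e (flips B) ∈ SU := by
        rw [hab] at hd
        have := SU.sub_mem hd hd'
        rwa [add_sub_add_right_eq_sub] at this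
      refine ⟨sgn (βP ⬝ᵥ s (dec (syn (rightPart e (flips A))))) * K₀, fun k k' => ?_⟩
      split_ifs with hkk
      · rw [← hK₀ (EU k) fun h => ?_, Finset.mul_sum]
        · refine Finset.sum_congr rfl fun T _ => ?_
          by_cases hT : T + rightPart e (flips A) - EU k ∈ SU
          · have hT' : T + rightPart e (flips B) - EU k' ∈ SU := by
              have := SU.add_mem (SU.sub_mem hT hmem) (hEU' k k' hkk)
              convert this using 1
              abel
            rw [if_pos hT, if_pos hT', if_pos hT, ← sgn_add]
            simp only [hf, hsynT T _ k hT, map_add, dotProduct_add]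
            congr 1
            change _ = _ + (βP ⬝ᵥ s T + βU ⬝ᵥ T)
            ring
          · rw [if_neg hT, if_neg hT, mul_zero]
        · exact hZ h k
      · refine Finset.sum_eq_zero fun T _ => ?_
        split_ifs with h1 h2
        · refine absurd (hEU k k' ?_) hkk
          have := SU.sub_mem (SU.sub_mem h2 h1) (SU.neg_mem hmem)
          convert this using 1
          abel
        · rfl
        · rfl
    · refine ⟨0, fun k k' => ?_⟩
      rw [ite_self]
      refine Finset.sum_eq_zero fun T _ => ?_
      split_ifs with h1 h2
      · exact absurd ((hsynT _ _ _ h1).symm.trans (hsynT _ _ _ h2)) hab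
      · rfl
      · rfl
  obtain ⟨K, hK⟩ := hK
  by_cases hflip : rightPart e (flips (F.left 0) + flips (F.left 1)) =
      rightPart e (flips (F.right 0) + flips (F.right 1))
  swap
  · refine ⟨0, ?_⟩
    ext ⟨y, r⟩ ⟨y', r'⟩
    rw [hRun, if_neg hflip, zero_smul, Matrix.zero_apply]
  refine ⟨cR * c₀ * cA * cL * cL' * (nin / nout) * star (nin / nout) * K / cO, ?_⟩
  ext ⟨y, r⟩ ⟨y', r'⟩
  rw [hRun, if_pos hflip, Matrix.smul_apply, hO, hσ, withRef_encChannel_apply]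
  simp only [withRef_apply (keepQubits log)]
  have hrhs := keepQubits_sum log (Matrix.of fun x y => ρ (x, r) (y, r'))
    (fun k => Dout.enc (y + flips Aout) k) (fun k => star (Dout.enc (y' + flips Bout) k))
  rw [hrhs]
  simp only [Matrix.smul_apply, hA, withRef_encChannel_apply,
    henc _ _ _ hα, henc _ _ _ hα', ← hfA, ← hfB, hsA, hsB]
  have hterm : ∀ T : U → ZMod 2, ∀ x : ℂ,
      (sgn (signs (F.left 1) ⬝ᵥ (glue e (y + leftPart e (flips (F.left 0) + flips (F.left 1)) + f T) T
          + flips (F.left 0) + flips (F.left 1) + glue e (f T) 0)) *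
        sgn (signs (F.left 0) ⬝ᵥ (glue e (y + leftPart e (flips (F.left 0) + flips (F.left 1)) + f T) T
          + flips (F.left 0)))) *
      (sgn (signs (F.right 1) ⬝ᵥ (glue e (y' + leftPart e (flips (F.right 0) + flips (F.right 1)) + f T)
          T + flips (F.right 0) + flips (F.right 1) + glue e (f T) 0)) *
        sgn (signs (F.right 0) ⬝ᵥ (glue e (y' + leftPart e (flips (F.right 0) + flips (F.right 1)) + f T)
          T + flips (F.right 0)))) *
      c₀ • (cA * (sgn (signs A ⬝ᵥ glue e (y + leftPart e (flips (F.left 0) + flips (F.left 1)) + f T) T)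
        * sgn (signs B ⬝ᵥ glue e (y' + leftPart e (flips (F.right 0) + flips (F.right 1)) + f T) T)
        * x)) =
      c₀ * cA * cL * cL' * sgn (leftPart e (signs A + signs (F.left 0) + signs (F.left 1)) ⬝ᵥ y) *
        sgn (leftPart e (signs B + signs (F.right 0) + signs (F.right 1)) ⬝ᵥ y') *
        (sgn (βP ⬝ᵥ f T + βU ⬝ᵥ T) * x) := by
    intro T x
    have hχ : sgn (βP ⬝ᵥ f T + βU ⬝ᵥ T) =
        sgn (leftPart e (signs A + signs (F.left 0)) ⬝ᵥ f T +
          rightPart e (signs A + signs (F.left 0) + signs (F.left 1)) ⬝ᵥ T) *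
        sgn (leftPart e (signs B + signs (F.right 0)) ⬝ᵥ f T +
          rightPart e (signs B + signs (F.right 0) + signs (F.right 1)) ⬝ᵥ T) := by
      rw [← sgn_add, hβP, hβU, leftPart_add e (_ + _) (_ + _), rightPart_add e (_ + _ + _),
        add_dotProduct, add_dotProduct]
      congr 1
      ring
    have h1 := hL y (f T) T
    have h2 := hL' y' (f T) T
    rw [hχ, smul_eq_mul]
    have h3 := congrArg₂ (fun a b : ℂ => a * b) h1 h2
    linear_combination (c₀ * cA * x) * h3
  simp only [hterm]
  have hcomb : ∀ T : U → ZMod 2, sgn (βP ⬝ᵥ f T + βU ⬝ᵥ T) * (∑ k, ∑ k',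
      (if T + rightPart e (flips A) - EU k ∈ SU then
        nin / nout * Dout.enc (y + flips Aout) (k ∘ log) else 0) * ρ (k, r) (k', r') *
      star (if T + rightPart e (flips B) - EU k' ∈ SU then
        nin / nout * Dout.enc (y' + flips Bout) (k' ∘ log) else 0)) =
      nin / nout * star (nin / nout) * ∑ k, ∑ k',
        (if T + rightPart e (flips A) - EU k ∈ SU then
          (if T + rightPart e (flips B) - EU k' ∈ SU then sgn (βP ⬝ᵥ f T + βU ⬝ᵥ T) else 0) else 0) *
        (Dout.enc (y + flips Aout) (k ∘ log) * ρ (k, r) (k', r') *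
          star (Dout.enc (y' + flips Bout) (k' ∘ log))) := by
    intro T
    simp only [Finset.mul_sum]
    refine Finset.sum_congr rfl fun k _ => Finset.sum_congr rfl fun k' _ => ?_
    split_ifs
    · rw [star_mul']; ring
    · simp
    · simp
    · simp
  have hsum : ∀ g : (Kin → ZMod 2) → (Kin → ZMod 2) → ℂ, (∑ T : U → ZMod 2, ∑ k, ∑ k',
      (if T + rightPart e (flips A) - EU k ∈ SU then
        (if T + rightPart e (flips B) - EU k' ∈ SU then sgn (βP ⬝ᵥ f T + βU ⬝ᵥ T) else 0) else 0) *
        g k k') = K * ∑ k, ∑ k', if ∀ q, (∀ p, log p ≠ q) → k q = k' q then g k k' else 0 := by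
    intro g
    rw [Finset.sum_comm, Finset.mul_sum]
    refine Finset.sum_congr rfl fun k _ => ?_
    rw [Finset.sum_comm, Finset.mul_sum]
    refine Finset.sum_congr rfl fun k' _ => ?_
    rw [← Finset.sum_mul, hK]
    split_ifs <;> simp
  simp only [hcomb]
  rw [← Finset.mul_sum, ← Finset.mul_sum, hsum, smul_eq_mul]
  simp only [Matrix.of_apply]
  rw [← mul_assoc (_ / cO) cO, div_mul_cancel₀ _ hcO]
  ring

end Gadget

/-! ### Linked sets and clusters -/

section Clusters

variable {V : Type*} {G : SimpleGraph V}

/-- Two vertices are linked in `S` if a path of `G` inside `S` joins them (or if they are equal). -/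
def Linked (G : SimpleGraph V) (S : Set V) : V → V → Prop :=
  Relation.ReflTransGen fun a b => G.Adj a b ∧ a ∈ S ∧ b ∈ S

lemma Linked.of_adj {S : Set V} {a b : V} (h : G.Adj a b) (ha : a ∈ S) (hb : b ∈ S) :
    Linked G S a b := Relation.ReflTransGen.single ⟨h, ha, hb⟩

lemma Linked.mono {S S' : Set V} (h : S ⊆ S') {a b : V} (hab : Linked G S a b) :
    Linked G S' a b := by
  induction hab with
  | refl => exact Relation.ReflTransGen.refl
  | tail _ h' ih => exact ih.tail ⟨h'.1, h h'.2.1, h h'.2.2⟩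

lemma Linked.symm {S : Set V} {a b : V} (hab : Linked G S a b) : Linked G S b a := by
  induction hab with
  | refl => exact Relation.ReflTransGen.refl
  | tail _ h ih => exact ih.head ⟨h.1.symm, h.2.2, h.2.1⟩

lemma Linked.trans {S : Set V} {a b c : V} (hab : Linked G S a b) (hbc : Linked G S b c) :
    Linked G S a c := Relation.ReflTransGen.trans hab hbc

/-- The partition of the vertices into the clusters of `S`; a vertex outside `S` is a cluster by
itself. -/
def clusterSetoid (G : SimpleGraph V) (S : Set V) : Setoid V where
  r := Linked G S
  iseqv := ⟨fun _ => Relation.ReflTransGen.refl, Linked.symm, Linked.trans⟩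

/-- A path inside `S` stays in its cluster. -/
lemma Linked.restrict {S : Set V} {a b : V} (hab : Linked G S a b) :
    Linked G (S ∩ {c | Linked G S a c}) a b := by
  induction hab with
  | refl => exact Relation.ReflTransGen.refl
  | tail hc h ih =>
    exact ih.trans (Linked.of_adj h.1 ⟨h.2.1, hc⟩ ⟨h.2.2, hc.tail h⟩)

/-- A nonempty set of vertices is linked if any two of its elements are linked in it. -/
structure IsLinked (G : SimpleGraph V) (T : Set V) : Prop where
  nonempty : T.Nonempty
  linked : ∀ a ∈ T, ∀ b ∈ T, Linked G T a b

lemma IsLinked.of_base {T : Set V} {a : V} (ha : a ∈ T) (h : ∀ b ∈ T, Linked G T a b) :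
    IsLinked G T := ⟨⟨a, ha⟩, fun b hb c hc => (h b hb).symm.trans (h c hc)⟩

lemma IsLinked.cluster {S : Set V} {a : V} (ha : a ∈ S) :
    IsLinked G (S ∩ {c | Linked G S a c}) :=
  IsLinked.of_base ⟨ha, Relation.ReflTransGen.refl⟩ fun _ hb => hb.2.restrict

lemma IsLinked.connected {T : Set V} (h : IsLinked G T) :
    ((⊤ : G.Subgraph).induce T).Connected := by
  obtain ⟨a, ha⟩ := h.nonempty
  have key : ∀ b, (hab : Linked G T a b) → (hb : b ∈ T) →
      ((⊤ : G.Subgraph).induce T).coe.Reachable ⟨a, ha⟩ ⟨b, hb⟩ := by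
    intro b hab
    induction hab with
    | refl => intro _; exact SimpleGraph.Reachable.refl _
    | tail _ h ih =>
      intro hb
      refine (ih h.2.1).trans (SimpleGraph.Adj.reachable ?_)
      simp [h.1, h.2.1, hb]
  rw [SimpleGraph.Subgraph.connected_iff]
  refine ⟨⟨?_⟩, ⟨a, ha⟩⟩
  rintro ⟨b, hb⟩ ⟨c, hc⟩
  exact (key b (h.linked a ha b hb) hb).symm.trans (key c (h.linked a ha c hc) hc)

lemma isLinked_verts {G' : G.Subgraph} (h : G'.Connected) : IsLinked G G'.verts := by
  rw [SimpleGraph.Subgraph.connected_iff] at h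
  refine ⟨h.2, fun a ha b hb => ?_⟩
  have key : ∀ y, Relation.ReflTransGen G'.coe.Adj ⟨a, ha⟩ y → Linked G G'.verts a y.1 := by
    intro y hy
    induction hy with
    | refl => exact Relation.ReflTransGen.refl
    | @tail y z _ hyz ih => exact ih.tail ⟨G'.adj_sub hyz, y.2, z.2⟩
  exact key ⟨b, hb⟩ ((SimpleGraph.reachable_iff_reflTransGen _ _).1 (h.1.coe ⟨a, ha⟩ ⟨b, hb⟩))

variable {η γ : ℝ}

lemma Avoiding.mono {E : Set (Set V)} {S S' : Set V} (h : Avoiding E S') (hS : S ⊆ S') :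
    Avoiding E S := fun T hT hTS => h T hT (hTS.trans hS)

variable [Finite V]

/-- A set avoids the bad sets if and only if it has density less than `γ` in every linked set of size at
least `η`. -/
lemma avoiding_badSets_iff (hη : 0 < η) {S : Set V} :
    Avoiding (badSets G η γ) S ↔
      ∀ T, IsLinked G T → η ≤ T.ncard → ((S ∩ T).ncard : ℝ) < γ * T.ncard := by
  constructor
  · intro h T hT hTη
    have hpos : (0 : ℝ) < T.ncard := hη.trans_le hTη
    by_contra hc
    push Not at hc
    exact h (S ∩ T) ⟨_, hT.connected, Set.inter_subset_right, hTη, (le_div_iff₀ hpos).2 hc⟩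
      Set.inter_subset_left
  · rintro h S' ⟨G', hG', hS', hη', hγ'⟩ hS
    have hpos : (0 : ℝ) < G'.verts.ncard := hη.trans_le hη'
    have h1 := h _ (isLinked_verts hG') hη'
    have h2 : (S'.ncard : ℝ) ≤ (S ∩ G'.verts).ncard := by
      exact_mod_cast Set.ncard_le_ncard (Set.subset_inter hS hS') (Set.toFinite _)
    rw [le_div_iff₀ hpos] at hγ'
    linarith

lemma Avoiding.union (hη : 0 < η) {γ' : ℝ} {S S' : Set V} (h : Avoiding (badSets G η γ) S)
    (h' : Avoiding (badSets G η γ') S') : Avoiding (badSets G η (γ + γ')) (S ∪ S') := by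
  rw [avoiding_badSets_iff hη] at *
  intro T hT hTη
  have h1 := h T hT hTη
  have h2 := h' T hT hTη
  have h3 : ((S ∪ S') ∩ T).ncard ≤ (S ∩ T).ncard + (S' ∩ T).ncard := by
    rw [Set.union_inter_distrib_right]
    exact Set.ncard_union_le _ _
  have h4 : (((S ∪ S') ∩ T).ncard : ℝ) ≤ (S ∩ T).ncard + (S' ∩ T).ncard := by exact_mod_cast h3
  linarith

lemma Avoiding.of_le (hη : 0 < η) {γ' : ℝ} (hγ : γ ≤ γ') {S : Set V}
    (h : Avoiding (badSets G η γ) S) : Avoiding (badSets G η γ') S := by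
  rw [avoiding_badSets_iff hη] at *
  intro T hT hTη
  have h1 := h T hT hTη
  have : γ * T.ncard ≤ γ' * T.ncard := by gcongr
  linarith

/-- If a set that avoids the bad sets is enlarged to a union of linked sets, each of which is at most `c`
times as large as its share of the set, then the result avoids the bad sets for a density `2cγ`:
a linked set together with all enlarged clusters that it meets is again linked. -/
lemma Avoiding.of_clusters {ι : Type*} [Finite ι] (hη : 0 < η) (hγ : 0 < γ) {c : ℝ} (hc : 0 < c)
    (hcγ : c * γ ≤ 1 / 2) {T D : Set V} (hT : Avoiding (badSets G η γ) T) (𝒦 𝒯 : ι → Set V)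
    (h𝒯 : ∀ k, 𝒯 k ⊆ T ∩ 𝒦 k) (hdisj : Pairwise fun k k' => Disjoint (𝒯 k) (𝒯 k'))
    (h𝒦 : ∀ k, (𝒦 k).Nonempty → IsLinked G (𝒦 k)) (hcard : ∀ k, ((𝒦 k).ncard : ℝ) ≤ c * (𝒯 k).ncard)
    (hD : D ⊆ ⋃ k, 𝒦 k) : Avoiding (badSets G η (2 * c * γ)) D := by
  classical
  have := Fintype.ofFinite ι
  rw [avoiding_badSets_iff hη] at *
  intro N hN hNη
  have hpos : (0 : ℝ) < N.ncard := hη.trans_le hNη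
  set J : Finset ι := Finset.univ.filter fun k => (𝒦 k ∩ N).Nonempty with hJ
  set N' : Set V := N ∪ ⋃ k ∈ J, 𝒦 k with hN'
  have hKN' : ∀ k ∈ J, 𝒦 k ⊆ N' := fun k hk =>
    (Set.subset_biUnion_of_mem (u := fun k => 𝒦 k) (Finset.mem_coe.2 hk)).trans
      Set.subset_union_right
  have hlinked : IsLinked G N' := by
    obtain ⟨a, ha⟩ := hN.nonempty
    refine IsLinked.of_base (Or.inl ha) ?_
    rintro b (hb | hb)
    · exact (hN.linked a ha b hb).mono Set.subset_union_left
    · simp only [Set.mem_iUnion] at hb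
      obtain ⟨k, hk, hb⟩ := hb
      obtain ⟨b', hb'⟩ := (Finset.mem_filter.1 hk).2
      exact ((hN.linked a ha b' hb'.2).mono Set.subset_union_left).trans
        (((h𝒦 k ⟨b, hb⟩).linked b' hb'.1 b hb).mono (hKN' k hk))
  have hbi : ∀ 𝒮 : ι → Set V, (⋃ k ∈ J, 𝒮 k).ncard ≤ ∑ k ∈ J, (𝒮 k).ncard := by
    intro 𝒮
    induction J using Finset.induction_on with
    | empty => simp
    | insert k J hk ih =>
      rw [Finset.set_biUnion_insert, Finset.sum_insert hk]
      exact (Set.ncard_union_le _ _).trans (Nat.add_le_add_left ih _)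
  set t : ℝ := ∑ k ∈ J, ((𝒯 k).ncard : ℝ) with ht
  have ht_eq : ((⋃ k ∈ J, 𝒯 k).ncard : ℝ) = t := by
    rw [ht, ← Nat.cast_sum]
    congr 1
    clear_value J
    clear * - hdisj
    induction J using Finset.induction_on with
    | empty => simp
    | insert k J hk ih =>
      rw [Finset.set_biUnion_insert, Finset.sum_insert hk, Set.ncard_union_eq, ih]
      rw [Set.disjoint_iUnion₂_right]
      intro k' hk'
      exact hdisj fun h => hk (h ▸ hk')
  have hKt : ((⋃ k ∈ J, 𝒦 k).ncard : ℝ) ≤ c * t := by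
    have h1 : ((⋃ k ∈ J, 𝒦 k).ncard : ℝ) ≤ ∑ k ∈ J, ((𝒦 k).ncard : ℝ) := by
      exact_mod_cast hbi 𝒦
    refine h1.trans ?_
    rw [ht, Finset.mul_sum]
    exact Finset.sum_le_sum fun k _ => hcard k
  have hN'card : (N'.ncard : ℝ) ≤ N.ncard + c * t := by
    have h1 : (N'.ncard : ℝ) ≤ N.ncard + (⋃ k ∈ J, 𝒦 k).ncard := by
      exact_mod_cast Set.ncard_union_le _ _
    linarith
  have hNN' : (N.ncard : ℝ) ≤ N'.ncard := by
    exact_mod_cast Set.ncard_le_ncard Set.subset_union_left (Set.toFinite _)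
  have htN' : t ≤ (T ∩ N').ncard := by
    rw [← ht_eq]
    refine Nat.cast_le.2 (Set.ncard_le_ncard ?_ (Set.toFinite _))
    refine Set.iUnion₂_subset fun k hk => ?_
    exact fun x hx => ⟨(h𝒯 k hx).1, hKN' k hk (h𝒯 k hx).2⟩
  have hDN : ((D ∩ N).ncard : ℝ) ≤ c * t := by
    refine le_trans ?_ hKt
    refine Nat.cast_le.2 (Set.ncard_le_ncard ?_ (Set.toFinite _))
    rintro x ⟨hx, hxN⟩
    obtain ⟨k, hk⟩ := Set.mem_iUnion.1 (hD hx)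
    simp only [Set.mem_iUnion]
    exact ⟨k, Finset.mem_filter.2 ⟨Finset.mem_univ _, x, hk, hxN⟩, hk⟩
  have hlt := hT N' hlinked (hNη.trans hNN')
  -- The share `t` of the clusters satisfies `t < γ (|N| + c t)`, hence `t < 2 γ |N|`.
  have ht0 : 0 ≤ t := Finset.sum_nonneg fun k _ => Nat.cast_nonneg _
  have h1 : t < γ * (N.ncard + c * t) :=
    (htN'.trans_lt hlt).trans_le (mul_le_mul_of_nonneg_left hN'card hγ.le)
  have h2 : c * γ * t ≤ 1 / 2 * t := mul_le_mul_of_nonneg_right hcγ ht0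
  have h3 : t < 2 * γ * N.ncard := by linarith
  calc ((D ∩ N).ncard : ℝ) ≤ c * t := hDN
    _ < c * (2 * γ * N.ncard) := mul_lt_mul_of_pos_left h3 hc
    _ = 2 * c * γ * N.ncard := by ring

end Clusters

/-! ### Cochains and tensor products with a one-dimensional complex -/

section ZeroExtend

variable {α : Type*} (p : α → Prop) [DecidablePred p]

/-- Extension by zero of a vector indexed by a subtype. -/
def zeroExtend : ({x // p x} → ZMod 2) →ₗ[ZMod 2] (α → ZMod 2) where
  toFun t x := if h : p x then t ⟨x, h⟩ else 0
  map_add' t t' := by funext x; by_cases h : p x <;> simp [h]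
  map_smul' a t := by funext x; by_cases h : p x <;> simp [h]

lemma zeroExtend_apply (t : {x // p x} → ZMod 2) (x : α) :
    zeroExtend p t x = if h : p x then t ⟨x, h⟩ else 0 := rfl

@[simp] lemma zeroExtend_coe (t : {x // p x} → ZMod 2) (x : {x // p x}) :
    zeroExtend p t x.1 = t x := by
  rw [zeroExtend_apply, dif_pos x.2]

lemma dotProduct_zeroExtend [Fintype α] (f : α → ZMod 2) (t : {x // p x} → ZMod 2) :
    f ⬝ᵥ zeroExtend p t = (fun x : {x // p x} => f x.1) ⬝ᵥ t := by
  have h0 : ∑ x : {x // ¬ p x}, f x.1 * zeroExtend p t x.1 = 0 :=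
    Fintype.sum_eq_zero _ fun x => by rw [zeroExtend_apply, dif_neg x.2, mul_zero]
  simp only [dotProduct]
  rw [← Fintype.sum_subtype_add_sum_subtype p, h0, add_zero]
  exact Finset.sum_congr rfl fun x _ => by rw [zeroExtend_coe]

end ZeroExtend

namespace BasedComplex

section General

variable {X : Type*} [Fintype X] (K : BasedComplex X)

lemma coboundary_apply (c : X → ZMod 2) (y : X) : K.coboundary c y = ∑ x, K.bd x y * c x := rfl

lemma boundary_apply (c : X → ZMod 2) (x : X) : K.boundary c x = ∑ y, K.bd x y * c y := rfl

lemma coboundary_add (c c' : X → ZMod 2) :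
    K.coboundary (c + c') = K.coboundary c + K.coboundary c' := Matrix.mulVec_add _ _ _

@[simp] lemma coboundary_zero : K.coboundary 0 = 0 := Matrix.mulVec_zero _

lemma coboundary_sum {ι : Type*} (s : Finset ι) (c : ι → X → ZMod 2) :
    K.coboundary (∑ i ∈ s, c i) = ∑ i ∈ s, K.coboundary (c i) :=
  map_sum (Matrix.mulVecLin K.bdᵀ) c s

lemma coboundary_coboundary (c : X → ZMod 2) : K.coboundary (K.coboundary c) = 0 := by
  rw [coboundary, coboundary, Matrix.mulVec_mulVec, ← Matrix.transpose_mul, K.bd_sq,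
    Matrix.transpose_zero, Matrix.zero_mulVec]

lemma coboundary_dotProduct (f g : X → ZMod 2) :
    K.coboundary f ⬝ᵥ g = f ⬝ᵥ K.boundary g := by
  rw [coboundary, boundary, Matrix.mulVec_transpose, Matrix.dotProduct_mulVec]

lemma isChain_zero (i : ℕ) : K.IsChain i 0 := fun _ h => absurd rfl h

variable {K}

lemma IsChain.add {i : ℕ} {c c' : X → ZMod 2} (h : K.IsChain i c) (h' : K.IsChain i c') :
    K.IsChain i (c + c') := by
  intro x hx
  by_cases hc : c x = 0
  · exact h' x fun hc' => hx (by simp [hc, hc'])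
  · exact h x hc

lemma IsChain.sum {ι : Type*} {i : ℕ} {s : Finset ι} {c : ι → X → ZMod 2}
    (h : ∀ k, K.IsChain i (c k)) : K.IsChain i (∑ k ∈ s, c k) := by
  classical
  induction s using Finset.induction_on with
  | empty => exact K.isChain_zero i
  | insert k s hk ih => rw [Finset.sum_insert hk]; exact (h k).add ih

lemma IsChain.coboundary {i : ℕ} {c : X → ZMod 2} (h : K.IsChain i c) :
    K.IsChain (i + 1) (K.coboundary c) := by
  intro y hy
  rw [coboundary_apply] at hy
  obtain ⟨x, -, hx⟩ := Finset.exists_ne_zero_of_sum_ne_zero hy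
  rw [K.bd_deg x y (left_ne_zero_of_mul hx), h x (right_ne_zero_of_mul hx)]

variable (K)

/-- Extension by zero of a vector indexed by the basis elements of degree `i`. -/
abbrev extend (i : ℕ) : (K.Cell i → ZMod 2) →ₗ[ZMod 2] (X → ZMod 2) :=
  zeroExtend fun x => K.deg x = i

lemma isChain_extend (i : ℕ) (t : K.Cell i → ZMod 2) : K.IsChain i (K.extend i t) := by
  intro x hx
  by_contra h
  exact hx (by rw [zeroExtend_apply, dif_neg h])

lemma extend_restrict {i : ℕ} {c : X → ZMod 2} (h : K.IsChain i c) :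
    K.extend i (fun x => c x.1) = c := by
  funext x
  rw [zeroExtend_apply]
  split_ifs with hx
  · rfl
  · by_contra hc
    exact hx (h x fun h' => hc h'.symm)

lemma eq_extend_iff {i : ℕ} {c : X → ZMod 2} (h : K.IsChain i c) (t : K.Cell i → ZMod 2) :
    K.extend i t = c ↔ ∀ x : K.Cell i, t x = c x.1 := by
  constructor
  · rintro rfl x
    simp
  · intro h'
    rw [← K.extend_restrict h]
    congr 1
    exact funext h'

lemma mem_levelCoboundaries {i : ℕ} {t : K.Cell i → ZMod 2} :
    t ∈ K.levelCoboundaries i ↔ ∃ c, ∀ x : K.Cell i, t x = K.coboundary c x.1 := by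
  simp only [levelCoboundaries, LinearMap.mem_range, Matrix.mulVecLin_apply, funext_iff]
  exact exists_congr fun c => forall_congr' fun x => eq_comm

/-- A coboundary of degree `i + 1` is the coboundary of a cochain that is supported in degree `i`. -/
lemma mem_levelCoboundaries_succ {i : ℕ} {t : K.Cell (i + 1) → ZMod 2} :
    t ∈ K.levelCoboundaries (i + 1) ↔ ∃ c, K.IsChain i c ∧ K.extend (i + 1) t = K.coboundary c := by
  rw [mem_levelCoboundaries]
  constructor
  · rintro ⟨c, hc⟩
    refine ⟨K.extend i fun x => c x.1, K.isChain_extend _ _, ?_⟩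
    rw [K.eq_extend_iff (K.isChain_extend _ _).coboundary]
    intro x
    rw [hc, coboundary_apply, coboundary_apply]
    refine Finset.sum_congr rfl fun y _ => ?_
    by_cases hy : K.bd y x.1 = 0
    · simp [hy]
    · have := K.bd_deg _ _ hy
      rw [zeroExtend_apply, dif_pos (by have := x.2; omega)]
  · rintro ⟨c, hc, h⟩
    exact ⟨c, fun x => by rw [← h, zeroExtend_coe]⟩

end General

section Inclusion

variable {X B₀ B₁ : Type*} (L : Finset B₁)

/-- The inclusion of the basis of `A ⊗ B_L̄` into the basis of `A ⊗ B`. -/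
def inc : X × (B₀ ⊕ {b : B₁ // b ∉ L}) → X × (B₀ ⊕ B₁) := Prod.map id (Sum.map id Subtype.val)

lemma inc_injective : Function.Injective (inc (X := X) (B₀ := B₀) L) :=
  Function.injective_id.prodMap (Function.injective_id.sumMap Subtype.val_injective)

@[simp] lemma inc_inl (x : X) (b : B₀) : inc L (x, Sum.inl b) = (x, Sum.inl b) := rfl

@[simp] lemma inc_inr (x : X) (b : {b // b ∉ L}) :
    inc (B₀ := B₀) L (x, Sum.inr b) = (x, Sum.inr b.1) := rfl

end Inclusion

section Product

variable {X B₀ B₁ : Type*} [Fintype X] [DecidableEq X] [Fintype B₀] [DecidableEq B₀] [Fintype B₁]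
  [DecidableEq B₁] (A : BasedComplex X) (H : Matrix B₀ B₁ (ZMod 2))

@[simp] lemma tensor_deg_inl (x : X) (b : B₀) :
    (A.tensor (oneDim H)).deg (x, Sum.inl b) = A.deg x := rfl

@[simp] lemma tensor_deg_inr (x : X) (b : B₁) :
    (A.tensor (oneDim H)).deg (x, Sum.inr b) = A.deg x + 1 := rfl

lemma tensor_bd (x x' : X) (b b' : B₀ ⊕ B₁) : (A.tensor (oneDim H)).bd (x, b) (x', b') =
    A.bd x x' * (if b = b' then 1 else 0) +
      (if x = x' then 1 else 0) * (Matrix.fromBlocks 0 H 0 0 : Matrix _ (B₀ ⊕ B₁) (ZMod 2)) b b' := by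
  simp [tensor, oneDim, Matrix.kroneckerMap_apply, Matrix.one_apply]

lemma tensor_coboundary_inl (c : X × (B₀ ⊕ B₁) → ZMod 2) (x : X) (b : B₀) :
    (A.tensor (oneDim H)).coboundary c (x, Sum.inl b) =
      A.coboundary (fun x => c (x, Sum.inl b)) x := by
  simp only [coboundary_apply, Fintype.sum_prod_type, Fintype.sum_sum_type, tensor_bd]
  simp

lemma tensor_coboundary_inr (c : X × (B₀ ⊕ B₁) → ZMod 2) (x : X) (b : B₁) :
    (A.tensor (oneDim H)).coboundary c (x, Sum.inr b) =
      A.coboundary (fun x => c (x, Sum.inr b)) x + ∑ b₀, H b₀ b * c (x, Sum.inl b₀) := by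
  simp only [coboundary_apply, Fintype.sum_prod_type, Fintype.sum_sum_type, tensor_bd]
  simp [Finset.sum_add_distrib, add_comm]

lemma tensor_boundary_inl (c : X × (B₀ ⊕ B₁) → ZMod 2) (x : X) (b : B₀) :
    (A.tensor (oneDim H)).boundary c (x, Sum.inl b) =
      A.boundary (fun x => c (x, Sum.inl b)) x + ∑ b₁, H b b₁ * c (x, Sum.inr b₁) := by
  simp only [boundary_apply, Fintype.sum_prod_type, Fintype.sum_sum_type, tensor_bd]
  simp [Finset.sum_add_distrib]

lemma tensor_boundary_inr (c : X × (B₀ ⊕ B₁) → ZMod 2) (x : X) (b : B₁) :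
    (A.tensor (oneDim H)).boundary c (x, Sum.inr b) =
      A.boundary (fun x => c (x, Sum.inr b)) x := by
  simp only [boundary_apply, Fintype.sum_prod_type, Fintype.sum_sum_type, tensor_bd]
  simp

/-- Contraction of a cochain of `A ⊗ B` with a vector on the basis elements of degree `1` of `B`. -/
def contract (κ : B₁ → ZMod 2) (c : X × (B₀ ⊕ B₁) → ZMod 2) : X → ZMod 2 :=
  fun x => ∑ b, κ b * c (x, Sum.inr b)

/-- Contraction with a cycle of `B` is a cochain map from `A ⊗ B` to `A`. -/
lemma contract_coboundary {κ : B₁ → ZMod 2} (hκ : H *ᵥ κ = 0) (c : X × (B₀ ⊕ B₁) → ZMod 2) :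
    contract κ ((A.tensor (oneDim H)).coboundary c) = A.coboundary (contract κ c) := by
  funext x
  have h1 : ∑ b, κ b * ∑ b₀, H b₀ b * c (x, Sum.inl b₀) = 0 := by
    have : ∀ b₀, ∑ b, H b₀ b * κ b = 0 := fun b₀ => congrFun hκ b₀
    simp only [Finset.mul_sum]
    rw [Finset.sum_comm]
    refine Finset.sum_eq_zero fun b₀ _ => ?_
    calc _ = (∑ b, H b₀ b * κ b) * c (x, Sum.inl b₀) := by
          rw [Finset.sum_mul]; exact Finset.sum_congr rfl fun b _ => by ring
      _ = 0 := by rw [this, zero_mul]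
  simp only [contract, tensor_coboundary_inr, mul_add, Finset.sum_add_distrib, h1, add_zero]
  simp only [coboundary_apply, contract, Finset.mul_sum]
  rw [Finset.sum_comm]
  exact Finset.sum_congr rfl fun y _ => Finset.sum_congr rfl fun b _ => by ring

variable (L : Finset B₁)

lemma deg_inc (c : X × (B₀ ⊕ {b : B₁ // b ∉ L})) :
    (A.tensor (oneDim H)).deg (inc L c) = (A.tensor (oneDim (removeCells H L))).deg c := by
  rcases c with ⟨x, b | b⟩ <;> rfl

lemma bd_inc (c c' : X × (B₀ ⊕ {b : B₁ // b ∉ L})) :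
    (A.tensor (oneDim H)).bd (inc L c) (inc L c') =
      (A.tensor (oneDim (removeCells H L))).bd c c' := by
  rcases c with ⟨x, b | b⟩ <;> rcases c' with ⟨x', b' | b'⟩ <;>
    simp [tensor_bd, removeCells, Subtype.ext_iff]

lemma coboundary_inc (c : X × (B₀ ⊕ B₁) → ZMod 2) (y : X × (B₀ ⊕ {b : B₁ // b ∉ L})) :
    (A.tensor (oneDim (removeCells H L))).coboundary (c ∘ inc L) y =
      (A.tensor (oneDim H)).coboundary c (inc L y) := by
  rcases y with ⟨x, b | b⟩
  · rw [tensor_coboundary_inl, inc_inl, tensor_coboundary_inl]; rfl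
  · rw [tensor_coboundary_inr, inc_inr, tensor_coboundary_inr]; rfl

lemma below_inc {c c' : X × (B₀ ⊕ {b : B₁ // b ∉ L})}
    (h : (A.tensor (oneDim (removeCells H L))).Below c c') :
    (A.tensor (oneDim H)).Below (inc L c) (inc L c') := by
  induction h with
  | refl => exact Relation.ReflTransGen.refl
  | tail _ h ih => exact ih.tail (by rwa [bd_inc])

end Product

end BasedComplex

open BasedComplex

/-! ### The encoding map of the tensor product -/

section Encoding

variable {X MA B₀ B₁ : Type*} [Fintype MA]

lemma systematicCodeword_spec {B : Type*} [DecidableEq B] {C : Submodule (ZMod 2) (B → ZMod 2)}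
    {S : Finset B} (hS : IsExtendable C S) (s : S) :
    systematicCodeword C S s ∈ C ∧ ∀ b : S, systematicCodeword C S s b = if b = s then 1 else 0 := by
  classical
  have h : ∃ c ∈ C, ∀ b : S, c b = if b = s then 1 else 0 := by
    obtain ⟨c, hc, hc'⟩ := hS fun b => if b = s then 1 else 0
    refine ⟨c, hc, fun b => ?_⟩
    rw [hc' b b.2]
    simp only [Subtype.ext_iff]
  unfold systematicCodeword
  split_ifs with h'
  · refine ⟨h'.choose_spec.1, fun b => (h'.choose_spec.2 b).trans ?_⟩
    congr
  · exact absurd (by convert h) h'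

/-- On an information set of a code every indicator vector extends to a codeword. -/
lemma exists_indicator_codewords [DecidableEq B₁] {C : Submodule (ZMod 2) (B₁ → ZMod 2)} {S : Finset B₁}
    (hS : IsExtendable C S) :
    ∃ κ : B₁ → B₁ → ZMod 2, ∀ b, κ b ∈ C ∧ ∀ b' ∈ S, κ b b' = if b' = b then 1 else 0 := by
  choose κ hκ using fun b : B₁ => hS fun b' => if b' = b then 1 else 0
  exact ⟨κ, hκ⟩

variable [Fintype B₀] [Fintype B₁] [DecidableEq B₁] (degM : MA → ℕ) (encA : Matrix X MA (ZMod 2))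
  (H : Matrix B₀ B₁ (ZMod 2)) (M₀ : Finset B₀) (M₁ : Finset B₁) (j : ℕ)

/-- Extension by zero of a message of degree `j + 1` to all degrees. -/
abbrev extendMessage :
    ({k : MA × (M₀ ⊕ M₁) // productDeg degM M₀ M₁ k = j + 1} → ZMod 2) →ₗ[ZMod 2]
      (MA × (M₀ ⊕ M₁) → ZMod 2) :=
  zeroExtend fun k => productDeg degM M₀ M₁ k = j + 1

/-- The representative `Enc^C k` of the encoded cohomology class, as a cochain of `C = A ⊗ B`. -/
noncomputable def encodedCochain (k : {k : MA × (M₀ ⊕ M₁) // productDeg degM M₀ M₁ k = j + 1} → ZMod 2) :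
    X × (B₀ ⊕ B₁) → ZMod 2 :=
  (encA ⊗ₖ oneDimEncoding H M₀ M₁) *ᵥ extendMessage degM M₀ M₁ j k

variable (k : {k : MA × (M₀ ⊕ M₁) // productDeg degM M₀ M₁ k = j + 1} → ZMod 2)

lemma encodedCochain_inl (x : X) (b : B₀) :
    encodedCochain degM encA H M₀ M₁ j k (x, Sum.inl b) =
      (encA *ᵥ fun m => ∑ s : M₀, systematicCodeword (LinearMap.ker Hᵀ.mulVecLin) M₀ s b *
        extendMessage degM M₀ M₁ j k (m, Sum.inl s)) x := by
  simp only [encodedCochain, Matrix.mulVec, dotProduct, Fintype.sum_prod_type, Fintype.sum_sum_type,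
    Matrix.kroneckerMap_apply, oneDimEncoding]
  simp [Finset.mul_sum, mul_assoc]

lemma encodedCochain_inr (x : X) (b : B₁) :
    encodedCochain degM encA H M₀ M₁ j k (x, Sum.inr b) =
      (encA *ᵥ fun m => if h : b ∈ M₁ then
        extendMessage degM M₀ M₁ j k (m, Sum.inr ⟨b, h⟩) else 0) x := by
  simp only [encodedCochain, Matrix.mulVec, dotProduct, Fintype.sum_prod_type, Fintype.sum_sum_type,
    Matrix.kroneckerMap_apply, oneDimEncoding]
  refine Finset.sum_congr rfl fun m _ => ?_
  simp only [Matrix.fromBlocks_apply₂₁, Matrix.zero_apply, mul_zero, zero_mul,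
    Finset.sum_const_zero, zero_add, Matrix.fromBlocks_apply₂₂, Matrix.of_apply, mul_ite, mul_one,
    ite_mul]
  split_ifs with h
  · rw [Fintype.sum_eq_single ⟨b, h⟩]
    · simp
    · intro s hs
      rw [if_neg]
      rintro rfl
      exact hs rfl
  · rw [mul_zero]
    refine Finset.sum_eq_zero fun s _ => ?_
    rw [if_neg]
    rintro rfl
    exact h s.2

variable {degM encA H M₀ M₁} in
/-- Contraction of an encoded cochain with a vector that is an indicator on the information set. -/
lemma contract_encodedCochain {κ : B₁ → ZMod 2} (b : M₁)
    (hκ : ∀ b' ∈ M₁, κ b' = if b' = b then 1 else 0) :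
    contract κ (encodedCochain degM encA H M₀ M₁ j k) =
      encA *ᵥ fun m => extendMessage degM M₀ M₁ j k (m, Sum.inr b) := by
  funext x
  simp only [contract, encodedCochain_inr]
  rw [Fintype.sum_eq_single b.1]
  · rw [hκ _ b.2, if_pos rfl, one_mul]
    simp only [b.2, dite_true]
  · intro b' hb'
    by_cases hb : b' ∈ M₁
    · rw [hκ _ hb, if_neg hb', zero_mul]
    · simp only [hb, dite_false]
      simp [Matrix.mulVec, dotProduct]

variable [Fintype X] [DecidableEq X] [DecidableEq B₀] (A : BasedComplex X)

lemma encodedCochain_cell (x : (A.tensor (oneDim H)).Cell (j + 1)) :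
    ((encA ⊗ₖ oneDimEncoding H M₀ M₁).submatrix Subtype.val Subtype.val *ᵥ k) x =
      encodedCochain degM encA H M₀ M₁ j k x.1 := by
  rw [encodedCochain, Matrix.mulVec, Matrix.mulVec, dotProduct_zeroExtend]
  rfl

variable {A degM encA H M₀ M₁}

lemma isChain_encodedCochain (hencA : A.IsEncodingMap degM encA) :
    (A.tensor (oneDim H)).IsChain (j + 1) (encodedCochain degM encA H M₀ M₁ j k) := by
  rintro ⟨x, b | b⟩ hx
  · rw [encodedCochain_inl] at hx
    obtain ⟨m, -, hm⟩ := Finset.exists_ne_zero_of_sum_ne_zero hx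
    obtain ⟨s, -, hs⟩ := Finset.exists_ne_zero_of_sum_ne_zero (right_ne_zero_of_mul hm)
    have h1 := hencA.graded _ _ (left_ne_zero_of_mul hm)
    have h2 := right_ne_zero_of_mul hs
    rw [zeroExtend_apply] at h2
    split_ifs at h2 with h
    · rw [tensor_deg_inl, h1]; exact h
    · exact absurd rfl h2
  · rw [encodedCochain_inr] at hx
    obtain ⟨m, -, hm⟩ := Finset.exists_ne_zero_of_sum_ne_zero hx
    have h1 := hencA.graded _ _ (left_ne_zero_of_mul hm)
    have h2 := right_ne_zero_of_mul hm
    split_ifs at h2 with hb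
    · beta_reduce at h2
      rw [zeroExtend_apply] at h2
      split_ifs at h2 with h
      · rw [tensor_deg_inr, h1]; exact h
      · exact absurd rfl h2
    · exact absurd rfl h2

lemma coboundary_encodedCochain (hencA : A.IsEncodingMap degM encA)
    (hM₀ : IsExtendable (LinearMap.ker Hᵀ.mulVecLin) M₀) :
    (A.tensor (oneDim H)).coboundary (encodedCochain degM encA H M₀ M₁ j k) = 0 := by
  funext ⟨x, b⟩
  rcases b with b | b
  · rw [tensor_coboundary_inl]
    simp only [encodedCochain_inl]
    exact congrFun (hencA.cochain _) x
  · rw [tensor_coboundary_inr]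
    simp only [encodedCochain_inr]
    have h1 := congrFun (hencA.cochain fun m => if h : b ∈ M₁ then
        extendMessage degM M₀ M₁ j k (m, Sum.inr ⟨b, h⟩) else 0) x
    refine (congrArg₂ (· + ·) h1 ?_).trans (add_zero _)
    simp only [encodedCochain_inl, Matrix.mulVec, dotProduct, Finset.mul_sum]
    rw [Finset.sum_comm]
    refine Finset.sum_eq_zero fun m _ => ?_
    rw [Finset.sum_comm]
    refine Finset.sum_eq_zero fun s _ => ?_
    have h2 : ∑ b₀, H b₀ b * systematicCodeword (LinearMap.ker Hᵀ.mulVecLin) M₀ s b₀ = 0 :=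
      congrFun (LinearMap.mem_ker.1 (systematicCodeword_spec hM₀ s).1) b
    calc _ = (∑ b₀, H b₀ b * systematicCodeword (LinearMap.ker Hᵀ.mulVecLin) M₀ s b₀) *
        (encA x m * extendMessage degM M₀ M₁ j k (m, Sum.inl s)) := by
          rw [Finset.sum_mul]; exact Finset.sum_congr rfl fun b₀ _ => by ring
      _ = 0 := by rw [h2, zero_mul]

end Encoding

/-! ### Splitting off copies of a complex from the tensor product -/

section Splitting

variable {X B₀ B₁ : Type*} [Fintype X] [DecidableEq X]
  [Fintype B₀] [DecidableEq B₀] [Fintype B₁] [DecidableEq B₁]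
  (A : BasedComplex X) (H : Matrix B₀ B₁ (ZMod 2)) (L : Finset B₁) (j : ℕ)

/-- The basis elements of `A ⊗ B` of degree `j + 1` are those of `A^j × L` and those of `A ⊗ B_L̄`. -/
noncomputable def cellEquiv : (A.Cell j × L) ⊕ (A.tensor (oneDim (removeCells H L))).Cell (j + 1) ≃
    (A.tensor (oneDim H)).Cell (j + 1) :=
  Equiv.ofBijective
    (Sum.elim (physicalInclusion A H L j) fun u => ⟨inc L u.1, (deg_inc A H L u.1).trans u.2⟩) <| by
    constructor
    · refine (physicalInclusion A H L j).injective.sumElim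
        (fun u u' h => Subtype.ext (inc_injective L (congrArg Subtype.val h))) ?_
      rintro ⟨a, l⟩ ⟨⟨x, b | b⟩, hb⟩ h
      · have h' : ((a.1, Sum.inr l.1) : X × (B₀ ⊕ B₁)) = (x, Sum.inl b) := congrArg Subtype.val h
        simp at h'
      · have h' : ((a.1, Sum.inr l.1) : X × (B₀ ⊕ B₁)) = (x, Sum.inr b.1) :=
          congrArg Subtype.val h
        simp only [Prod.mk.injEq, Sum.inr.injEq] at h'
        exact b.2 (h'.2 ▸ l.2)
    · rintro ⟨⟨x, b | b⟩, hb⟩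
      · exact ⟨Sum.inr ⟨(x, Sum.inl b), hb⟩, rfl⟩
      · by_cases hbL : b ∈ L
        · exact ⟨Sum.inl (⟨x, Nat.succ_injective hb⟩, ⟨b, hbL⟩), rfl⟩
        · exact ⟨Sum.inr ⟨(x, Sum.inr ⟨b, hbL⟩), hb⟩, rfl⟩

lemma cellEquiv_inl_val (p : A.Cell j × L) :
    (cellEquiv A H L j (Sum.inl p)).1 = (p.1.1, Sum.inr p.2.1) := rfl

lemma cellEquiv_inr_val (u : (A.tensor (oneDim (removeCells H L))).Cell (j + 1)) :
    (cellEquiv A H L j (Sum.inr u)).1 = inc L u.1 := rfl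

/-- The correction on `A^j × L` computed from a cochain `t` of `A ⊗ B_L̄`: on the copy `l` it is the
contraction of `t` with a cycle `κ l` of `B`. -/
def correction (κ : B₁ → B₁ → ZMod 2) :
    ((A.tensor (oneDim (removeCells H L))).Cell (j + 1) → ZMod 2) →ₗ[ZMod 2]
      (A.Cell j × L → ZMod 2) where
  toFun t p := contract (fun b : {b // b ∉ L} => κ p.2 b) (extend _ (j + 1) t) p.1.1
  map_add' t t' := by
    funext p
    simp [contract, mul_add, Finset.sum_add_distrib]
  map_smul' a t := by
    funext p
    simp only [contract, map_smul, Pi.smul_apply, smul_eq_mul, RingHom.id_apply, Finset.mul_sum]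
    exact Finset.sum_congr rfl fun b _ => by ring

lemma correction_apply (κ : B₁ → B₁ → ZMod 2)
    (t : (A.tensor (oneDim (removeCells H L))).Cell (j + 1) → ZMod 2) (p : A.Cell j × L) :
    correction A H L j κ t p =
      contract (fun b : {b // b ∉ L} => κ p.2 b) (extend _ (j + 1) t) p.1.1 := rfl

/-- If `t` agrees with a cochain in degree `j + 1` then that cochain computes the correction. -/
lemma correction_eq (κ : B₁ → B₁ → ZMod 2)
    (t : (A.tensor (oneDim (removeCells H L))).Cell (j + 1) → ZMod 2)
    (c : X × (B₀ ⊕ {b // b ∉ L}) → ZMod 2) (hc : ∀ u, t u = c u.1) (p : A.Cell j × L) :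
    correction A H L j κ t p = contract (fun b : {b // b ∉ L} => κ p.2 b) c p.1.1 := by
  rw [correction_apply]
  refine Finset.sum_congr rfl fun b _ => ?_
  rw [zeroExtend_apply, dif_pos (by rw [tensor_deg_inr, p.1.2]), hc]

variable {A H L j} {M₁ : Finset B₁} {κ : B₁ → B₁ → ZMod 2}

omit [Fintype X] [DecidableEq X] [Fintype B₀] [DecidableEq B₀] in
lemma contract_split (hL : L ⊆ M₁) (hκ : ∀ b, ∀ b' ∈ M₁, κ b b' = if b' = b then 1 else 0)
    (c : X × (B₀ ⊕ B₁) → ZMod 2) (l : L) (x : X) :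
    contract (κ l) c x =
      c (x, Sum.inr l.1) + contract (fun b : {b // b ∉ L} => κ l b) (c ∘ inc L) x := by
  have h1 : ∀ _ : Fintype {b // b ∈ L}, ∑ b : {b // b ∈ L}, κ l b * c (x, Sum.inr b.1) =
      c (x, Sum.inr l.1) := by
    intro _
    rw [Fintype.sum_eq_single l]
    · rw [hκ _ _ (hL l.2), if_pos rfl, one_mul]
    · intro b hb
      rw [hκ _ _ (hL b.2), if_neg fun h => hb (Subtype.ext h), zero_mul]
  rw [contract, ← Fintype.sum_subtype_add_sum_subtype (· ∈ L), h1]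
  rfl

/-- The complex `A ⊗ B` splits as the sum of `A ⊗ B_L̄` and copies of `A`. -/
lemma glue_mem_levelCoboundaries_iff (hL : L ⊆ M₁) (hκ₀ : ∀ b, H *ᵥ κ b = 0)
    (hκ : ∀ b, ∀ b' ∈ M₁, κ b b' = if b' = b then 1 else 0) (y : A.Cell j × L → ZMod 2)
    (t : (A.tensor (oneDim (removeCells H L))).Cell (j + 1) → ZMod 2) :
    glue (cellEquiv A H L j) y t ∈ (A.tensor (oneDim H)).levelCoboundaries (j + 1) ↔
      t ∈ (A.tensor (oneDim (removeCells H L))).levelCoboundaries (j + 1) ∧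
        ∀ l : L, (fun a => (y + correction A H L j κ t) (a, l)) ∈ A.levelCoboundaries j := by
  have key : ∀ (c : X × (B₀ ⊕ B₁) → ZMod 2), (∀ u, t u =
      (A.tensor (oneDim (removeCells H L))).coboundary (c ∘ inc L) u.1) →
      ∀ (a : A.Cell j) (l : L), A.coboundary (contract (κ l) c) a.1 =
        (A.tensor (oneDim H)).coboundary c (a.1, Sum.inr l.1) + correction A H L j κ t (a, l) := by
    intro c hc a l
    rw [← contract_coboundary A H (hκ₀ l), contract_split hL hκ,
      correction_eq A H L j κ t _ hc (a, l)]
    congr 2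
    funext y
    exact (coboundary_inc A H L c y).symm
  simp only [mem_levelCoboundaries]
  constructor
  · rintro ⟨c, hc⟩
    have ht : ∀ u, t u = (A.tensor (oneDim (removeCells H L))).coboundary (c ∘ inc L) u.1 := by
      intro u
      rw [coboundary_inc, ← cellEquiv_inr_val, ← hc, glue_inr]
    refine ⟨⟨_, ht⟩, fun l => ⟨contract (κ l) c, fun a => ?_⟩⟩
    rw [key c ht, Pi.add_apply, ← glue_inl (cellEquiv A H L j) y t, hc]
    rfl
  · rintro ⟨⟨c₁, hc₁⟩, h⟩
    choose g hg using h
    let c : X × (B₀ ⊕ B₁) → ZMod 2 := fun x => match x with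
      | (x, Sum.inl b) => c₁ (x, Sum.inl b)
      | (x, Sum.inr b) => if h : b ∈ L then
          g ⟨b, h⟩ x + contract (fun b' : {b // b ∉ L} => κ b b') c₁ x else c₁ (x, Sum.inr ⟨b, h⟩)
    have hcinc : c ∘ inc L = c₁ := by
      funext ⟨x, b⟩
      rcases b with b | b
      · rfl
      · simp [c, b.2]
    have hct : ∀ l : L, contract (κ l) c = g l := by
      intro l
      funext x
      rw [contract_split hL hκ, hcinc]
      simp only [c, l.2, dite_true]
      rw [add_assoc, CharTwo.add_self_eq_zero, add_zero]
    refine ⟨c, fun q => ?_⟩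
    obtain ⟨s, rfl⟩ := (cellEquiv A H L j).surjective q
    rcases s with ⟨a, l⟩ | u
    · rw [glue_inl]
      have h1 := key c (by rw [hcinc]; exact hc₁) a l
      rw [hct, ← hg, Pi.add_apply] at h1
      exact add_right_cancel h1
    · rw [glue_inr, hc₁, cellEquiv_inr_val, ← coboundary_inc, hcinc]

end Splitting

/-! ### Phase errors: small cycles -/

section ClusterParts

variable {V Y : Type*} (r : Setoid V) (pos : Y → V)

open Classical in
/-- The part of a vector that is supported on one class of an equivalence relation on positions. -/
noncomputable def clusterPart (β : Y → ZMod 2) (k : Quotient r) : Y → ZMod 2 :=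
  fun q => if Quotient.mk r (pos q) = k then β q else 0

variable {r pos}

lemma clusterPart_ne_zero_iff {β : Y → ZMod 2} {k : Quotient r} {q : Y} :
    clusterPart r pos β k q ≠ 0 ↔ Quotient.mk r (pos q) = k ∧ β q ≠ 0 := by
  rw [clusterPart]
  split_ifs with h <;> simp [h]

lemma sum_clusterPart [Fintype (Quotient r)] (β : Y → ZMod 2) :
    ∑ k, clusterPart r pos β k = β := by
  funext q
  rw [Finset.sum_apply, Fintype.sum_eq_single (Quotient.mk r (pos q))]
  · rw [clusterPart, if_pos rfl]
  · intro k hk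
    rw [clusterPart, if_neg hk.symm]

/-- A linear relation that only involves positions in a single class holds for every part of a vector. -/
lemma dotProduct_clusterPart_eq_zero [Fintype Y] {f β : Y → ZMod 2}
    (h : ∀ q q', f q ≠ 0 → β q ≠ 0 → f q' ≠ 0 → β q' ≠ 0 → r (pos q) (pos q'))
    (h0 : f ⬝ᵥ β = 0) (k : Quotient r) : f ⬝ᵥ clusterPart r pos β k = 0 := by
  by_cases hk : ∃ q, f q ≠ 0 ∧ β q ≠ 0 ∧ Quotient.mk r (pos q) = k
  · obtain ⟨q, hf, hβ, rfl⟩ := hk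
    rw [← h0]
    refine Finset.sum_congr rfl fun q' _ => ?_
    by_cases hf' : f q' = 0
    · simp [hf']
    · by_cases hβ' : β q' = 0
      · simp [clusterPart, hβ']
      · rw [clusterPart, if_pos (Quotient.sound (h q' q hf' hβ' hf hβ))]
  · refine Finset.sum_eq_zero fun q _ => ?_
    by_contra hne
    have h1 := clusterPart_ne_zero_iff.1 (right_ne_zero_of_mul hne)
    exact hk ⟨q, left_ne_zero_of_mul hne, h1.2, h1.1⟩

end ClusterParts

section Homology

variable {X : Type*} [Fintype X] {K : BasedComplex X}

lemma hammingNorm_eq_ncard {Y : Type*} [Fintype Y] (c : Y → ZMod 2) :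
    hammingNorm c = {y | c y ≠ 0}.ncard := by
  rw [hammingNorm, ← Set.ncard_coe_finset]
  congr 1
  ext y
  simp

lemma hammingNorm_zeroExtend {Y : Type*} [Fintype Y] (p : Y → Prop) [DecidablePred p]
    (t : {y // p y} → ZMod 2) : hammingNorm (zeroExtend p t) = hammingNorm t := by
  rw [hammingNorm_eq_ncard, hammingNorm_eq_ncard,
    ← Set.ncard_image_of_injective _ Subtype.val_injective]
  congr 1
  ext x
  simp only [Set.mem_ofPred_eq, Set.mem_image, zeroExtend_apply]
  constructor
  · intro hx
    split_ifs at hx with h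
    · exact ⟨⟨x, h⟩, hx, rfl⟩
    · exact absurd rfl hx
  · rintro ⟨q, hq, rfl⟩
    rwa [dif_pos q.2]

variable [DecidableEq X]

lemma exists_boundary_eq_of_norm_lt {η : ℝ} {i : ℕ} (hη : ENNReal.ofReal η ≤ K.systolicDistance i)
    {z : X → ZMod 2} (hz : K.IsChain i z) (hz' : K.boundary z = 0) (hlt : (hammingNorm z : ℝ) < η) :
    ∃ c, K.boundary c = z := by
  by_contra hc
  have hmem : z ∈ {z : X → ZMod 2 | K.IsChain i z ∧ K.boundary z = 0 ∧
    ¬ ∃ c, K.IsChain (i + 1) c ∧ K.boundary c = z} :=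
    ⟨hz, hz', fun ⟨c, _, h⟩ => hc ⟨c, h⟩⟩
  have h1 : ENNReal.ofReal η ≤ (hammingNorm z : ENNReal) := hη.trans (iInf₂_le z hmem)
  rw [← ENNReal.ofReal_natCast, ENNReal.ofReal_le_ofReal_iff (Nat.cast_nonneg _)] at h1
  linarith

/-- A cycle below the systolic distance is orthogonal to all cocycles. -/
lemma dotProduct_eq_zero_of_norm_lt {η : ℝ} {i : ℕ}
    (hη : ENNReal.ofReal η ≤ K.systolicDistance i) {z : X → ZMod 2} (hz : K.IsChain i z)
    (hz' : K.boundary z = 0) (hlt : (hammingNorm z : ℝ) < η) {α : X → ZMod 2}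
    (hα : K.coboundary α = 0) : α ⬝ᵥ z = 0 := by
  obtain ⟨c, rfl⟩ := exists_boundary_eq_of_norm_lt hη hz hz' hlt
  rw [← coboundary_dotProduct, hα, zero_dotProduct]

end Homology

section SmallCycles

variable {X MA B₀ B₁ : Type*} [Fintype X] [DecidableEq X] [Fintype MA]
  [Fintype B₀] [DecidableEq B₀] [Fintype B₁] [DecidableEq B₁]
  {A : BasedComplex X} {degM : MA → ℕ} {encA : Matrix X MA (ZMod 2)}
  {H : Matrix B₀ B₁ (ZMod 2)} {M₀ : Finset B₀} {M₁ L : Finset B₁} {j : ℕ} {η : ℝ}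

/-- A chain of `A ⊗ B` of weight less than the distances of `A ⊗ B_L̄` and of `A`, whose boundary vanishes
on `A × B^0` and on `A × (M^1 \ L)`, is orthogonal to the encoded cochains outside `A × L`: contracted with
a codeword of `ker δ^B`, or restricted to an element of `M^1 \ L`, it becomes a small cycle of `A`. -/
lemma dotProduct_encodedCochain_eq_zero (hencA : A.IsEncodingMap degM encA)
    (hM₀ : IsExtendable (LinearMap.ker Hᵀ.mulVecLin) M₀)
    (hηd : ENNReal.ofReal η ≤ (A.tensor (oneDim (removeCells H L))).systolicDistance (j + 1))
    (hηA : ENNReal.ofReal η ≤ A.systolicDistance j) {b : X × (B₀ ⊕ B₁) → ZMod 2}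
    (hb : (A.tensor (oneDim H)).IsChain (j + 1) b) (hbη : (hammingNorm b : ℝ) < η)
    (hb₀ : ∀ x b₀, (A.tensor (oneDim H)).boundary b (x, Sum.inl b₀) = 0)
    (hb₁ : ∀ x, ∀ b₁ ∈ M₁, b₁ ∉ L → (A.tensor (oneDim H)).boundary b (x, Sum.inr b₁) = 0)
    (k : {k : MA × (M₀ ⊕ M₁) // productDeg degM M₀ M₁ k = j + 1} → ZMod 2) :
    (b ∘ inc L) ⬝ᵥ (encodedCochain degM encA H M₀ M₁ j k ∘ inc L) = 0 := by
  classical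
  have hnorm : ∀ h : X → ZMod 2, (∀ x, h x ≠ 0 → ∃ y, b (x, y) ≠ 0) →
      (hammingNorm h : ℝ) < η := by
    intro h hh
    refine lt_of_le_of_lt ?_ hbη
    rw [hammingNorm, hammingNorm]
    refine Nat.cast_le.2 ((Finset.card_le_card ?_).trans
      (Finset.card_image_le (s := Finset.univ.filter fun y => b y ≠ 0) (f := Prod.fst)))
    intro x hx
    obtain ⟨y, hy⟩ := hh x (Finset.mem_filter.1 hx).2
    exact Finset.mem_image.2 ⟨(x, y), Finset.mem_filter.2 ⟨Finset.mem_univ _, hy⟩, rfl⟩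
  -- The part on `A × (M^1 \ L)`.
  have h₁ : ∀ b₁ : {b // b ∉ L}, ∑ x, b (x, Sum.inr b₁.1) *
      encodedCochain degM encA H M₀ M₁ j k (x, Sum.inr b₁.1) = 0 := by
    rintro ⟨b₁, hbL⟩
    simp only [encodedCochain_inr]
    by_cases hbM : b₁ ∈ M₁
    · simp only [hbM, dite_true]
      change (fun x => b (x, Sum.inr b₁)) ⬝ᵥ (encA *ᵥ _) = 0
      rw [dotProduct_comm]
      refine dotProduct_eq_zero_of_norm_lt hηA (fun x hx => ?_) ?_ (hnorm _ fun x hx => ⟨_, hx⟩)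
        (hencA.cochain _)
      · exact Nat.succ_injective (hb _ hx)
      · funext x
        rw [← tensor_boundary_inr A H b x b₁, hb₁ x b₁ hbM hbL]
        rfl
    · simp [hbM, Matrix.mulVec, dotProduct]
  -- The part on `A × B^0`.
  have h₀ : ∀ (s : M₀) (α : X → ZMod 2), A.coboundary α = 0 →
      ∑ x, (∑ b₀, systematicCodeword (LinearMap.ker Hᵀ.mulVecLin) M₀ s b₀ * b (x, Sum.inl b₀)) * α x
        = 0 := by
    intro s α hα
    obtain ⟨hcw, hcw'⟩ := systematicCodeword_spec hM₀ s
    set cw := systematicCodeword (LinearMap.ker Hᵀ.mulVecLin) M₀ s with hcw_def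
    have hker : ∀ b₁, ∑ b₀, H b₀ b₁ * cw b₀ = 0 := fun b₁ => congrFun (LinearMap.mem_ker.1 hcw) b₁
    set h : X → ZMod 2 := fun x => ∑ b₀, cw b₀ * b (x, Sum.inl b₀) with hh
    have hcycle : A.boundary h = 0 := by
      funext x
      have h1 : A.boundary h x =
          ∑ b₀, cw b₀ * A.boundary (fun x => b (x, Sum.inl b₀)) x := by
        simp only [boundary_apply, hh, Finset.mul_sum]
        rw [Finset.sum_comm]
        exact Finset.sum_congr rfl fun _ _ => Finset.sum_congr rfl fun _ _ => by ring
      have h2 : ∀ b₀, A.boundary (fun x => b (x, Sum.inl b₀)) x =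
          - ∑ b₁, H b₀ b₁ * b (x, Sum.inr b₁) := by
        intro b₀
        rw [eq_neg_iff_add_eq_zero, ← tensor_boundary_inl, hb₀]
      rw [h1]
      simp only [h2, mul_neg, Finset.sum_neg_distrib, Finset.mul_sum]
      rw [Finset.sum_comm, Pi.zero_apply, neg_eq_zero]
      refine Finset.sum_eq_zero fun b₁ _ => ?_
      calc _ = (∑ b₀, H b₀ b₁ * cw b₀) * b (x, Sum.inr b₁) := by
            rw [Finset.sum_mul]; exact Finset.sum_congr rfl fun b₀ _ => by ring
        _ = 0 := by rw [hker, zero_mul]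
    have hsupp : ∀ x, h x ≠ 0 → ∃ b₀, b (x, Sum.inl b₀) ≠ 0 := by
      intro x hx
      obtain ⟨b₀, -, h'⟩ := Finset.exists_ne_zero_of_sum_ne_zero hx
      exact ⟨b₀, right_ne_zero_of_mul h'⟩
    -- The cycle `h` of `A` is placed on the basis element `s` of `B`, where the codeword is `1`.
    let z : X × (B₀ ⊕ {b // b ∉ L}) → ZMod 2 := fun y => if y.2 = Sum.inl s.1 then h y.1 else 0
    let ζ : X × (B₀ ⊕ {b // b ∉ L}) → ZMod 2 := fun y => α y.1 * Sum.elim cw 0 y.2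
    have hζ : (A.tensor (oneDim (removeCells H L))).coboundary ζ = 0 := by
      funext ⟨x, y⟩
      rcases y with b₀ | b₁
      · rw [tensor_coboundary_inl]
        have : A.coboundary α x * cw b₀ = 0 := by rw [hα, Pi.zero_apply, zero_mul]
        simpa [coboundary_apply, ζ, Finset.sum_mul, mul_assoc] using this
      · rw [tensor_coboundary_inr]
        have : (∑ b₀, H b₀ b₁.1 * cw b₀) * α x = 0 := by rw [hker, zero_mul]
        rw [Finset.sum_mul] at this
        simp only [coboundary_apply, ζ, Sum.elim_inr, Sum.elim_inl, Pi.zero_apply, mul_zero,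
          Finset.sum_const_zero, zero_add, removeCells, Matrix.submatrix_apply, id]
        rw [← this]
        exact Finset.sum_congr rfl fun _ _ => by ring
    have hz : (A.tensor (oneDim (removeCells H L))).boundary z = 0 := by
      funext ⟨x, y⟩
      rcases y with b₀ | b₁
      · rw [tensor_boundary_inl]
        by_cases hbs : b₀ = s.1
        · simpa [z, hbs] using congrFun hcycle x
        · simp [z, hbs, boundary_apply]
      · rw [tensor_boundary_inr]
        simp [z, boundary_apply]
    have hzchain : (A.tensor (oneDim (removeCells H L))).IsChain (j + 1) z := by
      rintro ⟨x, y⟩ hx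
      by_cases hy : y = Sum.inl s.1
      · subst hy
        obtain ⟨b₀, hb'⟩ := hsupp x (by simpa [z] using hx)
        exact hb _ hb'
      · simp [z, hy] at hx
    have hznorm : (hammingNorm z : ℝ) < η := by
      refine lt_of_le_of_lt ?_ (hnorm h fun x hx => (hsupp x hx).imp' Sum.inl fun _ h' => h')
      rw [hammingNorm, hammingNorm]
      refine Nat.cast_le.2 (Finset.card_le_card_of_injOn Prod.fst ?_ ?_)
      · rintro ⟨x, y⟩ hx
        by_cases hy : y = Sum.inl s.1
        · simpa [z, hy] using hx
        · simp [z, hy] at hx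
      · rintro ⟨x, y⟩ hx ⟨x', y'⟩ hx' hxx
        by_cases hy : y = Sum.inl s.1
        · by_cases hy' : y' = Sum.inl s.1
          · exact Prod.ext hxx (hy.trans hy'.symm)
          · simp [z, hy'] at hx'
        · simp [z, hy] at hx
    have := dotProduct_eq_zero_of_norm_lt hηd hzchain hz hznorm hζ
    rw [← this, dotProduct, Fintype.sum_prod_type]
    refine Finset.sum_congr rfl fun x _ => ?_
    rw [Fintype.sum_eq_single (Sum.inl s.1)]
    · simp only [z, ζ, if_true, Sum.elim_inl, hcw' s, mul_one]
      ring
    · intro y hy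
      simp [z, hy]
  rw [dotProduct, Fintype.sum_prod_type, Finset.sum_comm, Fintype.sum_sum_type]
  simp only [Function.comp_apply, inc_inl, inc_inr, h₁, Finset.sum_const_zero, add_zero]
  rw [Finset.sum_comm]
  have h₂ := fun s : M₀ => h₀ s _
    (hencA.cochain fun m => extendMessage degM M₀ M₁ j k (m, Sum.inl s))
  refine Eq.trans ?_ (Finset.sum_eq_zero fun s (_ : s ∈ (Finset.univ : Finset M₀)) => h₂ s)
  rw [Finset.sum_comm (s := (Finset.univ : Finset M₀))]
  refine Finset.sum_congr rfl fun x _ => ?_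
  simp only [encodedCochain_inl, Matrix.mulVec, dotProduct, Finset.mul_sum, Finset.sum_mul]
  refine Finset.sum_comm.trans (Eq.trans ?_ Finset.sum_comm)
  refine Finset.sum_congr rfl fun m _ => Finset.sum_comm.trans ?_
  exact Finset.sum_congr rfl fun s _ => Finset.sum_congr rfl fun b₀ _ => by ring

omit [Fintype MA] in
/-- The correction computed from the restriction of a coboundary to `A ⊗ B_L̄` is the restriction of the
coboundary to `A^j × L`, up to coboundaries of the copies of `A`. -/
lemma correction_coboundary (hL : L ⊆ M₁) {κ : B₁ → B₁ → ZMod 2} (hκ₀ : ∀ b, H *ᵥ κ b = 0)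
    (hκ : ∀ b, ∀ b' ∈ M₁, κ b b' = if b' = b then 1 else 0) (c : X × (B₀ ⊕ B₁) → ZMod 2)
    (p : A.Cell j × L) :
    correction A H L j κ
        (fun u => (A.tensor (oneDim H)).coboundary c (inc L u.1)) p =
      (A.tensor (oneDim H)).coboundary c (p.1.1, Sum.inr p.2.1) +
        A.coboundary (contract (κ p.2) c) p.1.1 := by
  rw [← contract_coboundary A H (hκ₀ p.2), contract_split hL hκ,
    correction_eq A H L j κ (fun u => (A.tensor (oneDim H)).coboundary c (inc L u.1))
      ((A.tensor (oneDim H)).coboundary c ∘ inc L) (fun u => rfl) p,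
    ← add_assoc, CharTwo.add_self_eq_zero, zero_add]

/-- The clusters of an error that avoids the bad sets are small. -/
lemma norm_clusterPart_lt {V Y : Type*} [Finite V] [Fintype Y] {G : SimpleGraph V} {pos : Y → V}
    (hpos : Function.Injective pos) {γ : ℝ} (hη : 0 < η) (hγ : γ ≤ 1) {β : Y → ZMod 2}
    {S : Set V} (hS : S = pos '' {q | β q ≠ 0}) (hβ : Avoiding (badSets G η γ) S)
    (k : Quotient (clusterSetoid G S)) :
    (hammingNorm (clusterPart _ pos β k) : ℝ) < η := by
  by_cases hq : ∃ q, clusterPart (clusterSetoid G S) pos β k q ≠ 0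
  · obtain ⟨q, hq⟩ := hq
    obtain ⟨rfl, hq'⟩ := clusterPart_ne_zero_iff.1 hq
    have hqS : pos q ∈ S := hS ▸ ⟨q, hq', rfl⟩
    have hT := IsLinked.cluster (G := G) hqS
    set T := S ∩ {c | Linked G S (pos q) c} with hT_def
    have hle : hammingNorm (clusterPart (clusterSetoid G S) pos β
        (Quotient.mk (clusterSetoid G S) (pos q))) ≤ T.ncard := by
      rw [hammingNorm_eq_ncard, ← Set.ncard_image_of_injective _ hpos]
      refine Set.ncard_le_ncard ?_ (Set.toFinite _)
      rintro _ ⟨q', hq', rfl⟩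
      have h1 := clusterPart_ne_zero_iff.1 hq'
      exact ⟨hS ▸ ⟨q', h1.2, rfl⟩, Linked.symm (Quotient.exact h1.1)⟩
    by_contra hc
    push Not at hc
    have hηT : η ≤ T.ncard := hc.trans (by exact_mod_cast hle)
    have h1 := (avoiding_badSets_iff hη).1 hβ T hT hηT
    rw [Set.inter_eq_right.2 Set.inter_subset_left] at h1
    have : γ * T.ncard ≤ 1 * T.ncard := mul_le_mul_of_nonneg_right hγ (Nat.cast_nonneg _)
    linarith
  · push Not at hq
    rw [show clusterPart (clusterSetoid G S) pos β k = 0 from funext hq, hammingNorm_zero]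
    simpa using hη

/-- If the sign of a phase error is constant under the coboundaries of `A ⊗ B_L̄` and the support of the
error avoids the bad sets, then the sign is the same for all logical basis states: the clusters of the
error are small cycles. -/
lemma dotProduct_encodedCochain_eq_zero_of_avoiding {V : Type*} [Finite V] {G : SimpleGraph V}
    (hencA : A.IsEncodingMap degM encA) (hM₀ : IsExtendable (LinearMap.ker Hᵀ.mulVecLin) M₀)
    (hL : L ⊆ M₁) {κ : B₁ → B₁ → ZMod 2} (hκ₀ : ∀ b, H *ᵥ κ b = 0)
    (hκ : ∀ b, ∀ b' ∈ M₁, κ b b' = if b' = b then 1 else 0)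
    (hηd : ENNReal.ofReal η ≤ (A.tensor (oneDim (removeCells H L))).systolicDistance (j + 1))
    (hηA : ENNReal.ofReal η ≤ A.systolicDistance j)
    (hbelow : ∀ c, (A.tensor (oneDim (removeCells H L))).deg c = j →
      ∃ c₀, (A.tensor (oneDim (removeCells H L))).deg c₀ = 0 ∧
        (A.tensor (oneDim (removeCells H L))).Below c₀ c)
    (pos : (A.tensor (oneDim H)).Cell (j + 1) ↪ V)
    (hadj : ∀ q q' : (A.tensor (oneDim H)).Cell (j + 1), q ≠ q' →
      ∀ c₀, (A.tensor (oneDim H)).deg c₀ = 0 → (A.tensor (oneDim H)).Below c₀ q.1 →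
        (A.tensor (oneDim H)).Below c₀ q'.1 → G.Adj (pos q) (pos q'))
    {γ : ℝ} (hη : 0 < η) (hγ : γ ≤ 1) (β : (A.tensor (oneDim H)).Cell (j + 1) → ZMod 2)
    (hβ : Avoiding (badSets G η γ) (pos '' {q | β q ≠ 0}))
    (hker : ∀ t ∈ (A.tensor (oneDim (removeCells H L))).levelCoboundaries (j + 1),
      leftPart (cellEquiv A H L j) β ⬝ᵥ correction A H L j κ t +
        rightPart (cellEquiv A H L j) β ⬝ᵥ t = 0)
    (k : {k : MA × (M₀ ⊕ M₁) // productDeg degM M₀ M₁ k = j + 1} → ZMod 2) :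
    rightPart (cellEquiv A H L j) β ⬝ᵥ
      (fun u => encodedCochain degM encA H M₀ M₁ j k (inc L u.1)) = 0 := by
  classical
  set S := pos '' {q | β q ≠ 0} with hS
  have := Fintype.ofFinite (Quotient (clusterSetoid G S))
  -- The boundary of the error vanishes at the elements that no contraction sees.
  have hbd : ∀ z : X × (B₀ ⊕ {b // b ∉ L}), (∀ l : L, contract (κ l) (Pi.single (inc L z) 1) = 0) →
      (fun q : (A.tensor (oneDim H)).Cell (j + 1) => (A.tensor (oneDim H)).bd (inc L z) q.1) ⬝ᵥ β
        = 0 := by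
    intro z hz
    set c : X × (B₀ ⊕ B₁) → ZMod 2 := Pi.single (inc L z) 1 with hc
    have hcob : ∀ y, (A.tensor (oneDim H)).coboundary c y = (A.tensor (oneDim H)).bd (inc L z) y := by
      intro y
      rw [coboundary_apply, Fintype.sum_eq_single (inc L z)]
      · rw [hc, Pi.single_eq_same, mul_one]
      · intro x hx
        rw [hc, Pi.single_eq_of_ne hx, mul_zero]
    have hmem : (fun u : (A.tensor (oneDim (removeCells H L))).Cell (j + 1) =>
        (A.tensor (oneDim H)).coboundary c (inc L u.1)) ∈
        (A.tensor (oneDim (removeCells H L))).levelCoboundaries (j + 1) :=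
      (mem_levelCoboundaries _).2 ⟨c ∘ inc L, fun u => (coboundary_inc A H L c u.1).symm⟩
    have h1 := hker _ hmem
    rw [dotProduct_comm, dotProduct_parts (cellEquiv A H L j), ← h1]
    congr 1
    · congr 1
      funext p
      rw [correction_coboundary hL hκ₀ hκ, hz, coboundary_zero, Pi.zero_apply, add_zero, hcob]
      rfl
    · congr 1
      funext u
      rw [hcob]
      rfl
  have hbd' : ∀ z : X × (B₀ ⊕ {b // b ∉ L}), (∀ l : L, contract (κ l) (Pi.single (inc L z) 1) = 0) →
      ∀ K, (A.tensor (oneDim H)).boundary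
        (extend _ (j + 1) (clusterPart (clusterSetoid G S) pos β K)) (inc L z) = 0 := by
    intro z hz K
    change (fun y => (A.tensor (oneDim H)).bd (inc L z) y) ⬝ᵥ zeroExtend _ _ = 0
    rw [dotProduct_zeroExtend]
    refine dotProduct_clusterPart_eq_zero ?_ (hbd z hz) K
    intro q q' hq hβq hq' hβq'
    by_cases hqq : q = q'
    · rw [hqq]
    have hdeg : (A.tensor (oneDim (removeCells H L))).deg z = j := by
      have h1 := (A.tensor (oneDim H)).bd_deg _ _ hq
      rw [q.2, deg_inc] at h1
      omega
    obtain ⟨c₀, hc₀, hc₀z⟩ := hbelow z hdeg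
    have h2 := below_inc A H L hc₀z
    exact Linked.of_adj (hadj q q' hqq (inc L c₀) ((deg_inc A H L c₀).trans hc₀) (h2.tail hq)
      (h2.tail hq')) ⟨q, hβq, rfl⟩ ⟨q', hβq', rfl⟩
  have hpart : ∀ K, rightPart (cellEquiv A H L j) (clusterPart (clusterSetoid G S) pos β K) ⬝ᵥ
      (fun u => encodedCochain degM encA H M₀ M₁ j k (inc L u.1)) = 0 := by
    intro K
    have h1 := dotProduct_encodedCochain_eq_zero (L := L) hencA hM₀ hηd hηA
      (b := extend _ (j + 1) (clusterPart (clusterSetoid G S) pos β K))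
      (isChain_extend _ _ _) ?_ (fun x b₀ => ?_) (fun x b₁ hb₁ hb₁L => ?_) k
    · have h2 : (extend _ (j + 1) (clusterPart (clusterSetoid G S) pos β K)) ∘ inc L =
          extend (A.tensor (oneDim (removeCells H L))) (j + 1)
            (rightPart (cellEquiv A H L j) (clusterPart (clusterSetoid G S) pos β K)) := by
        funext u
        rw [Function.comp_apply, zeroExtend_apply, zeroExtend_apply]
        simp only [deg_inc]
        split_ifs <;> rfl
      rw [h2, dotProduct_comm, dotProduct_zeroExtend, dotProduct_comm] at h1
      exact h1
    · rw [hammingNorm_zeroExtend]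
      exact norm_clusterPart_lt pos.injective hη hγ hS hβ K
    · refine hbd' (x, Sum.inl b₀) (fun l => ?_) K
      funext y
      simp [contract]
    · refine hbd' (x, Sum.inr ⟨b₁, hb₁L⟩) (fun l => ?_) K
      funext y
      have hκl : κ l b₁ = 0 := by
        rw [hκ _ _ hb₁, if_neg]
        rintro rfl
        exact hb₁L l.2
      refine Finset.sum_eq_zero fun b _ => ?_
      by_cases hb : b = b₁
      · rw [hb, hκl, zero_mul]
      · rw [Pi.single_eq_of_ne, mul_zero]
        intro h
        simp only [inc_inr, Prod.mk.injEq, Sum.inr.injEq] at h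
        exact hb h.2
  have hsum := sum_clusterPart (r := clusterSetoid G S) (pos := pos) β
  conv_lhs => rw [← hsum]
  have hlin : rightPart (cellEquiv A H L j) (∑ K, clusterPart (clusterSetoid G S) pos β K) =
      ∑ K, rightPart (cellEquiv A H L j) (clusterPart (clusterSetoid G S) pos β K) := by
    funext u
    simp [rightPart, Finset.sum_apply]
  rw [hlin, sum_dotProduct]
  exact Finset.sum_eq_zero fun K _ => hpart K

end SmallCycles

/-! ### Flip errors: small cocycles -/

section SmallCocycles

variable {X V P : Type*} [Fintype X] [DecidableEq X] {K : BasedComplex X} {j m w : ℕ}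
  {G : SimpleGraph V} {pos : K.Cell (j + 1) → V} {star : X → Set V}
  {D : (X → ZMod 2) →ₗ[ZMod 2] (P → ZMod 2)} {posD : P → V}

/-- A small cocycle is removed by successive flips of the decoder: since the syndrome vanishes, every
flip decreases the weight of the cocycle.  The flips take place in stars, each of which meets the current
cocycle, so that the union of the stars stays linked to the given cocycle.  The linear map `D` stands
for a quantity that every flip changes only in its star. -/
lemma exists_coboundary_eq_of_small (hdec : K.HasErrorFlipDecoder (j + 1) m)
    (hcard : ∀ c₀, (star c₀).ncard ≤ w)
    (hadj : ∀ c₀, K.deg c₀ = 0 → ∀ a ∈ star c₀, ∀ b ∈ star c₀, a ≠ b → G.Adj a b)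
    (hpos : ∀ c₀, ∀ u : K.Cell (j + 1), K.Below c₀ u.1 → pos u ∈ star c₀)
    (hD : ∀ c₀ c, K.IsChain j c → K.BelowChain c₀ c → ∀ p, D c p ≠ 0 → posD p ∈ star c₀)
    (e : X → ZMod 2) (he : K.IsChain (j + 1) e) (hδ : K.coboundary e = 0) (hm : hammingNorm e ≤ m) :
    ∃ c, K.IsChain j c ∧ K.coboundary c = e ∧ ∃ S : Set V, S.ncard ≤ w * hammingNorm e ∧
      (∀ p, D c p ≠ 0 → posD p ∈ S) ∧
      ∀ v ∈ S, ∃ u, e u.1 ≠ 0 ∧ Linked G (S ∪ pos '' {u | e u.1 ≠ 0}) v (pos u) := by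
  induction hn : hammingNorm e using Nat.strong_induction_on generalizing e with
  | _ n ih =>
  by_cases h0 : e = 0
  · exact ⟨0, K.isChain_zero j, by rw [h0, coboundary_zero], ∅, by simp, by simp, by simp⟩
  obtain ⟨c₀, hc₀, ⟨j', c₁, hj', hc₁, hbel, hlt⟩ | ⟨c, -, -, h⟩⟩ := hdec e he h0 hm
  swap
  · rw [hδ, hammingNorm_zero] at h
    exact absurd h (Nat.not_lt_zero _)
  obtain rfl : j' = j := by omega
  set e' := e + K.coboundary c₁ with he'_def
  have hstar : ∀ u : K.Cell (j' + 1), K.coboundary c₁ u.1 ≠ 0 → pos u ∈ star c₀ := by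
    intro u hu
    rw [coboundary_apply] at hu
    obtain ⟨x, -, hx⟩ := Finset.exists_ne_zero_of_sum_ne_zero hu
    exact hpos _ _ ((hbel x (right_ne_zero_of_mul hx)).tail (left_ne_zero_of_mul hx))
  have hstar' : ∀ u : K.Cell (j' + 1), e' u.1 ≠ 0 → e u.1 = 0 → pos u ∈ star c₀ := by
    intro u hu hu'
    refine hstar u ?_
    rwa [he'_def, Pi.add_apply, hu', zero_add] at hu
  obtain ⟨u₀, hu₀, hu₀'⟩ : ∃ u₀ : K.Cell (j' + 1), e u₀.1 ≠ 0 ∧ e' u₀.1 = 0 := by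
    by_contra hno
    push Not at hno
    refine absurd (Finset.card_le_card ?_) (not_le.2 hlt)
    intro x hx
    have hx' : e x ≠ 0 := (Finset.mem_filter.1 hx).2
    exact Finset.mem_filter.2 ⟨Finset.mem_univ _, hno ⟨x, he x hx'⟩ hx'⟩
  have hu₀s : pos u₀ ∈ star c₀ := by
    refine hstar u₀ fun h => hu₀ ?_
    rwa [he'_def, Pi.add_apply, h, add_zero] at hu₀'
  obtain ⟨c', hc', hc'e, S, hS, hDS, hlink⟩ := ih _ (hn ▸ hlt) e' (he.add hc₁.coboundary)
    (by rw [he'_def, coboundary_add, hδ, coboundary_coboundary, add_zero]) (hlt.le.trans hm) rfl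
  have hlink₀ : ∀ v ∈ star c₀,
      Linked G ((S ∪ star c₀) ∪ pos '' {u | e u.1 ≠ 0}) v (pos u₀) := by
    intro v hv
    by_cases hvu : v = pos u₀
    · rw [hvu]; exact Relation.ReflTransGen.refl
    · exact Linked.of_adj (hadj c₀ hc₀ _ hv _ hu₀s hvu) (Or.inl (Or.inr hv)) (Or.inl (Or.inr hu₀s))
  refine ⟨c' + c₁, hc'.add hc₁, ?_, S ∪ star c₀, ?_, ?_, ?_⟩
  · rw [coboundary_add, hc'e, he'_def, vec_add_cancel]
  · refine (Set.ncard_union_le _ _).trans ((add_le_add hS (hcard c₀)).trans ?_)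
    rw [← hn, ← mul_add_one]
    exact Nat.mul_le_mul_left _ hlt
  · intro p hp
    rw [map_add, Pi.add_apply] at hp
    by_cases hp' : D c' p = 0
    · rw [hp', zero_add] at hp
      exact Or.inr (hD c₀ c₁ hc₁ hbel p hp)
    · exact Or.inl (hDS p hp')
  · rintro v (hv | hv)
    · obtain ⟨u, hu, hvu⟩ := hlink v hv
      have hvu' : Linked G ((S ∪ star c₀) ∪ pos '' {u | e u.1 ≠ 0}) v (pos u) := by
        refine hvu.mono ?_
        rintro _ (hx | ⟨x, hx, rfl⟩)
        · exact Or.inl (Or.inl hx)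
        · by_cases hex : e x.1 = 0
          · exact Or.inl (Or.inr (hstar' x hx hex))
          · exact Or.inr ⟨x, hex, rfl⟩
      by_cases heu : e u.1 = 0
      · exact ⟨u₀, hu₀, hvu'.trans (hlink₀ _ (hstar' u hu heu))⟩
      · exact ⟨u, heu, hvu'⟩
    · exact ⟨u₀, hu₀, hlink₀ v hv⟩

lemma ncard_biUnion_le {Y : Type*} [Fintype Y] {f : Y → Set V} (hf : ∀ y, (f y).ncard ≤ w)
    (s : Set Y) : (⋃ y ∈ s, f y).ncard ≤ w * s.ncard := by
  classical
  induction s, s.toFinite using Set.Finite.induction_on with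
  | empty => simp
  | @insert a s ha hs ih =>
    rw [Set.biUnion_insert, Set.ncard_insert_of_notMem ha hs, mul_add, mul_one, add_comm]
    exact (Set.ncard_union_le _ _).trans (add_le_add (hf a) ih)

variable [Finite V]

/-- A cocycle whose support avoids the bad sets is the coboundary of a cochain that spills, through the
map `D`, only onto a set that avoids the bad sets for a larger density: the clusters of the cocycle,
formed after adding all elements above its support, are small cocycles. -/
lemma exists_coboundary_eq_of_avoiding (hw : 0 < w) (hdec : K.HasErrorFlipDecoder (j + 1) m)
    (hcard : ∀ c₀, (star c₀).ncard ≤ w)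
    (hadj : ∀ c₀, K.deg c₀ = 0 → ∀ a ∈ star c₀, ∀ b ∈ star c₀, a ≠ b → G.Adj a b)
    (hpos : ∀ c₀, ∀ u : K.Cell (j + 1), K.Below c₀ u.1 → pos u ∈ star c₀)
    (hD : ∀ c₀ c, K.IsChain j c → K.BelowChain c₀ c → ∀ p, D c p ≠ 0 → posD p ∈ star c₀)
    (hinj : Function.Injective pos) {up : K.Cell (j + 1) → Set V}
    (hup_card : ∀ u, (up u).ncard ≤ w) (hup_self : ∀ u, pos u ∈ up u)
    (hup_adj : ∀ u, ∀ v ∈ up u, v ≠ pos u → G.Adj (pos u) v)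
    (hup_meet : ∀ u u' : K.Cell (j + 1), ∀ y, K.bd u.1 y ≠ 0 → K.bd u'.1 y ≠ 0 →
      (up u ∩ up u').Nonempty)
    {η γ : ℝ} (hη : 0 < η) (hηm : η ≤ m) (hγ : 0 < γ) (hγw : 2 * w * γ ≤ 1 / 2)
    (t : K.Cell (j + 1) → ZMod 2) (ht : K.coboundary (extend K (j + 1) t) = 0)
    (htG : Avoiding (badSets G η γ) (pos '' {u | t u ≠ 0})) :
    ∃ c, K.IsChain j c ∧ K.coboundary c = extend K (j + 1) t ∧
      Avoiding (badSets G η (2 * (2 * w) * γ)) (posD '' {p | D c p ≠ 0}) := by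
  classical
  have hw' : (0 : ℝ) < w := Nat.cast_pos.2 hw
  set U : Set V := ⋃ u ∈ {u | t u ≠ 0}, up u with hU
  have hupU : ∀ u, t u ≠ 0 → up u ⊆ U := fun u hu => Set.subset_biUnion_of_mem (u := up) hu
  have := Fintype.ofFinite (Quotient (clusterSetoid G U))
  set part := clusterPart (clusterSetoid G U) pos t with hpart
  let 𝒯 : Quotient (clusterSetoid G U) → Set V := fun k => pos '' {u | part k u ≠ 0}
  let 𝒰 : Quotient (clusterSetoid G U) → Set V := fun k => ⋃ u ∈ {u | part k u ≠ 0}, up u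
  have h𝒯𝒰 : ∀ k, 𝒯 k ⊆ 𝒰 k := by
    rintro k _ ⟨u, hu, rfl⟩
    exact Set.mem_biUnion hu (hup_self u)
  have h𝒯card : ∀ k, (𝒯 k).ncard = hammingNorm (part k) := by
    intro k
    rw [hammingNorm_eq_ncard]
    exact Set.ncard_image_of_injective _ hinj
  have h𝒰card : ∀ k, (𝒰 k).ncard ≤ w * hammingNorm (part k) := by
    intro k
    rw [hammingNorm_eq_ncard]
    exact ncard_biUnion_le hup_card _
  have hlinkU : ∀ u, t u ≠ 0 → ∀ W, up u ⊆ W → ∀ v ∈ up u, Linked G W (pos u) v := by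
    intro u _ W hW v hv
    by_cases h : v = pos u
    · rw [h]; exact Relation.ReflTransGen.refl
    · exact Linked.of_adj (hup_adj u v hv h) (hW (hup_self u)) (hW hv)
  -- Each of the sets `𝒰 k` is a cluster of `U`.
  have h𝒰eq : ∀ u, t u ≠ 0 → 𝒰 (Quotient.mk (clusterSetoid G U) (pos u)) =
      U ∩ {v | Linked G U (pos u) v} := by
    intro u hu
    ext v
    constructor
    · intro hv
      obtain ⟨u', hu', hv⟩ := Set.mem_iUnion₂.1 hv
      have h1 := clusterPart_ne_zero_iff.1 hu'
      exact ⟨hupU u' h1.2 hv, (Linked.symm (Quotient.exact h1.1)).trans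
        (hlinkU u' h1.2 U (hupU u' h1.2) v hv)⟩
    · rintro ⟨hv, hv'⟩
      obtain ⟨u', hu', hvu'⟩ := Set.mem_iUnion₂.1 hv
      refine Set.mem_biUnion (clusterPart_ne_zero_iff.2 ⟨Quotient.sound ?_, hu'⟩) hvu'
      exact (hlinkU u' hu' U (hupU u' hu') v hvu').trans (Linked.symm hv')
  have h𝒰 : ∀ k, ∀ u, part k u ≠ 0 → IsLinked G (𝒰 k) := by
    intro k u hu
    obtain ⟨rfl, hu'⟩ := clusterPart_ne_zero_iff.1 hu
    rw [h𝒰eq u hu']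
    exact IsLinked.cluster (hupU u hu' (hup_self u))
  have hsmall : ∀ k, hammingNorm (part k) ≤ m := by
    intro k
    by_cases h0 : part k = 0
    · rw [h0, hammingNorm_zero]; exact Nat.zero_le _
    obtain ⟨u, hu⟩ := Function.ne_iff.1 h0
    by_contra hlt
    push Not at hlt
    have h1 : (m : ℝ) ≤ hammingNorm (part k) := by exact_mod_cast hlt.le
    have h2 : (hammingNorm (part k) : ℝ) ≤ (𝒰 k).ncard := by
      rw [← h𝒯card]; exact_mod_cast Set.ncard_le_ncard (h𝒯𝒰 k) (Set.toFinite _)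
    have h3 := (avoiding_badSets_iff hη).1 htG _ (h𝒰 k u hu) (hηm.trans (h1.trans h2))
    have h4 : (hammingNorm (part k) : ℝ) ≤ ((pos '' {u | t u ≠ 0}) ∩ 𝒰 k).ncard := by
      rw [← h𝒯card]
      refine Nat.cast_le.2 (Set.ncard_le_ncard (Set.subset_inter ?_ (h𝒯𝒰 k)) (Set.toFinite _))
      exact Set.image_mono fun u hu => (clusterPart_ne_zero_iff.1 hu).2
    have h5 : ((𝒰 k).ncard : ℝ) ≤ w * hammingNorm (part k) := by exact_mod_cast h𝒰card k
    have h6 : γ * (𝒰 k).ncard ≤ γ * (w * hammingNorm (part k)) := by gcongr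
    have h7 : γ * (w * hammingNorm (part k)) = (2 * w * γ) * hammingNorm (part k) / 2 := by ring
    have h8 : (2 * w * γ) * hammingNorm (part k) ≤ 1 / 2 * hammingNorm (part k) := by gcongr
    have h9 : (0 : ℝ) ≤ hammingNorm (part k) := Nat.cast_nonneg _
    linarith
  have hcocycle : ∀ k, K.coboundary (extend K (j + 1) (part k)) = 0 := by
    intro k
    funext y
    change (fun x => K.bd x y) ⬝ᵥ zeroExtend _ _ = 0
    rw [dotProduct_zeroExtend]
    refine dotProduct_clusterPart_eq_zero ?_ ?_ k
    · intro u u' hu htu hu' htu'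
      obtain ⟨v, hv, hv'⟩ := hup_meet u u' y hu hu'
      exact (hlinkU u htu U (hupU u htu) v hv).trans
        (hlinkU u' htu' U (hupU u' htu') v hv').symm
    · have h1 := congrFun ht y
      change (fun x => K.bd x y) ⬝ᵥ zeroExtend _ t = 0 at h1
      rwa [dotProduct_zeroExtend] at h1
  have key := fun k => exists_coboundary_eq_of_small hdec hcard hadj hpos hD
    (extend K (j + 1) (part k)) (K.isChain_extend _ _) (hcocycle k)
    (by rw [hammingNorm_zeroExtend]; exact hsmall k)
  simp only [hammingNorm_zeroExtend, zeroExtend_coe] at key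
  choose c hc hce S hS hDS hlink using key
  refine ⟨∑ k, c k, IsChain.sum hc, ?_, ?_⟩
  · rw [coboundary_sum, Finset.sum_congr rfl fun k _ => hce k, ← map_sum, hpart, sum_clusterPart]
  refine Avoiding.of_clusters hη hγ (by positivity) hγw htG (fun k => S k ∪ 𝒰 k) 𝒯 ?_ ?_ ?_ ?_ ?_
  · intro k
    refine Set.subset_inter ?_ ((h𝒯𝒰 k).trans Set.subset_union_right)
    exact Set.image_mono fun u hu => (clusterPart_ne_zero_iff.1 hu).2
  · intro k k' hkk
    rw [Set.disjoint_left]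
    rintro _ ⟨u, hu, rfl⟩ ⟨u', hu', h⟩
    obtain rfl := hinj h
    exact hkk ((clusterPart_ne_zero_iff.1 hu).1.symm.trans (clusterPart_ne_zero_iff.1 hu').1)
  · rintro k ⟨v, hv⟩
    obtain ⟨u, hu⟩ : ∃ u, part k u ≠ 0 := by
      rcases hv with hv | hv
      · exact ⟨_, (hlink k v hv).choose_spec.1⟩
      · obtain ⟨u, hu, -⟩ := Set.mem_iUnion₂.1 hv
        exact ⟨u, hu⟩
    have hlinked : ∀ b ∈ 𝒰 k, Linked G (S k ∪ 𝒰 k) (pos u) b := fun b hb =>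
      ((h𝒰 k u hu).linked _ (h𝒯𝒰 k ⟨u, hu, rfl⟩) b hb).mono Set.subset_union_right
    refine IsLinked.of_base (Or.inr (h𝒯𝒰 k ⟨u, hu, rfl⟩)) ?_
    rintro b (hb | hb)
    · obtain ⟨u', hu', hbu'⟩ := hlink k b hb
      exact (hlinked _ (h𝒯𝒰 k ⟨u', hu', rfl⟩)).trans
        (hbu'.mono (Set.union_subset_union_right _ (h𝒯𝒰 k))).symm
    · exact hlinked b hb
  · intro k
    have h1 : (S k ∪ 𝒰 k).ncard ≤ 2 * w * (𝒯 k).ncard := by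
      refine (Set.ncard_union_le _ _).trans ((add_le_add (hS k) (h𝒰card k)).trans (le_of_eq ?_))
      rw [h𝒯card]; ring
    exact_mod_cast h1
  · rintro _ ⟨p, hp, rfl⟩
    rw [Set.mem_ofPred_eq, map_sum, Finset.sum_apply] at hp
    obtain ⟨k, -, hk⟩ := Finset.exists_ne_zero_of_sum_ne_zero hp
    exact Set.mem_iUnion.2 ⟨k, Or.inl (hDS k p hk)⟩

end SmallCocycles

/-! ### The encoded states on the two parts of the qubits -/

section Logical

variable {X MA B₀ B₁ : Type*} [Fintype X] [DecidableEq X] [Fintype MA]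
  [Fintype B₀] [DecidableEq B₀] [Fintype B₁] [DecidableEq B₁]
  {A : BasedComplex X} {degM : MA → ℕ} {encA : Matrix X MA (ZMod 2)}
  {H : Matrix B₀ B₁ (ZMod 2)} {M₀ : Finset B₀} {M₁ L : Finset B₁} {j : ℕ}

variable (encA H L) in
/-- The encoded cochain of a message, outside `A^j × L`. -/
noncomputable def encodedRest (A : BasedComplex X)
    (k : {k : MA × (M₀ ⊕ M₁) // productDeg degM M₀ M₁ k = j + 1} → ZMod 2) :
    (A.tensor (oneDim (removeCells H L))).Cell (j + 1) → ZMod 2 :=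
  fun u => encodedCochain degM encA H M₀ M₁ j k (inc L u.1)

lemma encodedRest_sub (k k' : {k : MA × (M₀ ⊕ M₁) // productDeg degM M₀ M₁ k = j + 1} → ZMod 2) :
    encodedRest encA H L A (k - k') = encodedRest encA H L A k - encodedRest encA H L A k' := by
  funext u
  simp only [encodedRest, encodedCochain, map_sub, Matrix.mulVec_sub, Pi.sub_apply]

lemma extend_encodedRest (hencA : A.IsEncodingMap degM encA)
    (k : {k : MA × (M₀ ⊕ M₁) // productDeg degM M₀ M₁ k = j + 1} → ZMod 2) :
    extend _ (j + 1) (encodedRest encA H L A k) =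
      encodedCochain degM encA H M₀ M₁ j k ∘ inc L := by
  rw [eq_extend_iff]
  · exact fun u => rfl
  · intro x hx
    rw [← deg_inc]
    exact isChain_encodedCochain j k hencA _ hx

lemma coboundary_extend_encodedRest (hencA : A.IsEncodingMap degM encA)
    (hM₀ : IsExtendable (LinearMap.ker Hᵀ.mulVecLin) M₀)
    (k : {k : MA × (M₀ ⊕ M₁) // productDeg degM M₀ M₁ k = j + 1} → ZMod 2) :
    (A.tensor (oneDim (removeCells H L))).coboundary
      (extend _ (j + 1) (encodedRest encA H L A k)) = 0 := by
  funext y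
  rw [extend_encodedRest hencA, coboundary_inc, coboundary_encodedCochain j k hencA hM₀]
  rfl

omit [DecidableEq X] [DecidableEq B₀] in
/-- On `A^j × L` the encoding `Enc^C` is the encoding `Enc^A` of the messages on `M^(A,j) × L`. -/
lemma encodedCochain_physicalInclusion (hL : L ⊆ M₁)
    (k : {k : MA × (M₀ ⊕ M₁) // productDeg degM M₀ M₁ k = j + 1} → ZMod 2) (a : A.Cell j) (l : L) :
    encodedCochain degM encA H M₀ M₁ j k (a.1, Sum.inr l.1) =
      (encA.submatrix Subtype.val Subtype.val *ᵥ
        fun m => k (logicalInclusion degM M₀ M₁ L hL j (m, l)) : A.Cell j → ZMod 2) a := by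
  classical
  rw [encodedCochain_inr]
  have h1 : (fun m => if h : l.1 ∈ M₁ then
      extendMessage degM M₀ M₁ j k (m, Sum.inr ⟨l.1, h⟩) else 0) =
      zeroExtend (fun m => degM m = j) fun m =>
        k (logicalInclusion degM M₀ M₁ L hL j (m, l)) := by
    funext m
    rw [dif_pos (hL l.2), zeroExtend_apply, zeroExtend_apply]
    by_cases hm : degM m = j
    · rw [dif_pos hm, dif_pos (show productDeg degM M₀ M₁ (m, Sum.inr ⟨l.1, hL l.2⟩) = j + 1 from
        congrArg (· + 1) hm)]
      rfl
    · rw [dif_neg hm, dif_neg (show ¬ productDeg degM M₀ M₁ (m, Sum.inr ⟨l.1, hL l.2⟩) = j + 1 from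
        fun h => hm (Nat.succ_injective h))]
  rw [h1, Matrix.mulVec, dotProduct_zeroExtend]
  rfl

/-- The representatives `Enc^C k` of the encoded classes need no correction. -/
lemma correction_encodedRest (hencA : A.IsEncodingMap degM encA) (hL : L ⊆ M₁)
    {κ : B₁ → B₁ → ZMod 2} (hκ : ∀ b, ∀ b' ∈ M₁, κ b b' = if b' = b then 1 else 0)
    (k : {k : MA × (M₀ ⊕ M₁) // productDeg degM M₀ M₁ k = j + 1} → ZMod 2) :
    correction A H L j κ (encodedRest encA H L A k) = 0 := by
  funext p
  have h1 := contract_split hL hκ (encodedCochain degM encA H M₀ M₁ j k) p.2 p.1.1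
  rw [contract_encodedCochain j k ⟨p.2.1, hL p.2.2⟩ (hκ p.2), encodedCochain_inr] at h1
  simp only [hL p.2.2, dite_true] at h1
  rw [correction_apply, extend_encodedRest hencA]
  exact left_eq_add.1 h1

omit [Fintype X] [DecidableEq X] [Fintype B₀] [DecidableEq B₀] in
/-- A vector that vanishes on `L` contracts a cochain of `A ⊗ B` in the same way as its restriction. -/
lemma contract_removed {κ : B₁ → ZMod 2} (hκ : ∀ b ∈ L, κ b = 0) (c : X × (B₀ ⊕ B₁) → ZMod 2) :
    contract (fun b : {b // b ∉ L} => κ b) (c ∘ inc L) = contract κ c := by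
  funext x
  have h1 : ∀ _ : Fintype {b // b ∈ L}, ∑ b : {b // b ∈ L}, κ b * c (x, Sum.inr b.1) = 0 :=
    fun _ => Finset.sum_eq_zero fun b _ => by rw [hκ _ b.2, zero_mul]
  rw [contract, contract, ← Fintype.sum_subtype_add_sum_subtype (· ∈ L)
    (fun b => κ b * c (x, Sum.inr b)), h1, zero_add]
  rfl

/-- Outside `A^j × L` the encoded cohomology class determines the logical qubits that are traced out. -/
lemma eq_zero_of_encodedRest_mem (hencA : A.IsEncodingMap degM encA)
    (hM₀ : IsExtendable (LinearMap.ker Hᵀ.mulVecLin) M₀) (hL : L ⊆ M₁) {κ : B₁ → B₁ → ZMod 2}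
    (hκ₀ : ∀ b, H *ᵥ κ b = 0) (hκ : ∀ b, ∀ b' ∈ M₁, κ b b' = if b' = b then 1 else 0)
    {k : {k : MA × (M₀ ⊕ M₁) // productDeg degM M₀ M₁ k = j + 1} → ZMod 2}
    (hk : encodedRest encA H L A k ∈
      (A.tensor (oneDim (removeCells H L))).levelCoboundaries (j + 1))
    (q : {k : MA × (M₀ ⊕ M₁) // productDeg degM M₀ M₁ k = j + 1})
    (hq : ∀ p, logicalInclusion degM M₀ M₁ L hL j p ≠ q) : k q = 0 := by
  obtain ⟨c, -, hc⟩ := (mem_levelCoboundaries_succ _).1 hk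
  rw [extend_encodedRest hencA] at hc
  obtain ⟨⟨m, s | b⟩, hmq⟩ := q
  · have h1 := congrFun (hencA.inj (fun m => extendMessage degM M₀ M₁ j k (m, Sum.inl s))
      ⟨fun x => c (x, Sum.inl s.1), ?_⟩) m
    · exact (zeroExtend_coe _ k ⟨(m, Sum.inl s), hmq⟩).symm.trans h1
    · funext x
      rw [← tensor_coboundary_inl, ← hc, Function.comp_apply, inc_inl, encodedCochain_inl]
      congr 2
      funext m
      rw [Fintype.sum_eq_single s]
      · rw [(systematicCodeword_spec hM₀ s).2 s, if_pos rfl, one_mul]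
      · intro s' hs'
        rw [(systematicCodeword_spec hM₀ s').2 s, if_neg hs'.symm, zero_mul]
  · by_cases hb : b.1 ∈ L
    · exact absurd rfl (hq (⟨m, Nat.succ_injective hmq⟩, ⟨b.1, hb⟩))
    have hκL : ∀ b' ∈ L, κ b b' = 0 := fun b' hb' => by
      rw [hκ _ _ (hL hb'), if_neg]
      rintro rfl
      exact hb hb'
    have hker : removeCells H L *ᵥ (fun b' : {b // b ∉ L} => κ b b') = 0 := by
      funext b₀
      have h2 := congrFun (hκ₀ b) b₀
      simp only [Matrix.mulVec, dotProduct, removeCells, Matrix.submatrix_apply, id] at h2 ⊢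
      rw [← h2, ← Fintype.sum_subtype_add_sum_subtype (· ∈ L) (fun b' => H b₀ b' * κ b b')]
      refine (zero_add _).symm.trans (congrArg₂ _ (Eq.symm ?_) rfl)
      exact Finset.sum_eq_zero fun b' _ => by rw [hκL _ b'.2, mul_zero]
    have h1 := congrFun (hencA.inj (fun m => extendMessage degM M₀ M₁ j k (m, Sum.inr b))
      ⟨contract (fun b' : {b // b ∉ L} => κ b b') c, ?_⟩) m
    · exact (zeroExtend_coe _ k ⟨(m, Sum.inr b), hmq⟩).symm.trans h1
    · rw [← contract_encodedCochain j k b (hκ b), ← contract_removed hκL, hc,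
        contract_coboundary A _ hker]

/-- The messages on `M^(A,j) × L` are encoded on `A^j × L` alone. -/
lemma encodedRest_eq_zero (hL : L ⊆ M₁)
    {k : {k : MA × (M₀ ⊕ M₁) // productDeg degM M₀ M₁ k = j + 1} → ZMod 2}
    (hk : ∀ q, (∀ p, logicalInclusion degM M₀ M₁ L hL j p ≠ q) → k q = 0) :
    encodedRest encA H L A k = 0 := by
  have hinl : ∀ m s, extendMessage degM M₀ M₁ j k (m, Sum.inl s) = 0 := by
    intro m s
    rw [zeroExtend_apply]
    split_ifs with h
    · refine hk _ fun p hp => ?_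
      have h1 := congrArg (fun q => q.1.2) hp
      exact Sum.inr_ne_inl h1
    · rfl
  have hinr : ∀ m (b : M₁), b.1 ∉ L → extendMessage degM M₀ M₁ j k (m, Sum.inr b) = 0 := by
    intro m b hb
    rw [zeroExtend_apply]
    split_ifs with h
    · refine hk _ fun p hp => ?_
      have h1 := congrArg (fun q => q.1.2) hp
      exact hb (Sum.inr_injective h1 ▸ p.2.2)
    · rfl
  funext u
  obtain ⟨⟨x, b | b⟩, hu⟩ := u
  · change encodedCochain degM encA H M₀ M₁ j k (x, Sum.inl b) = 0
    rw [encodedCochain_inl]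
    simp only [hinl, mul_zero, Finset.sum_const_zero]
    exact congrFun (Matrix.mulVec_zero encA) x
  · change encodedCochain degM encA H M₀ M₁ j k (x, Sum.inr b.1) = 0
    rw [encodedCochain_inr]
    have h1 : (fun m => if h : b.1 ∈ M₁ then
        extendMessage degM M₀ M₁ j k (m, Sum.inr ⟨b.1, h⟩) else 0) = 0 := by
      funext m
      split_ifs with h
      · exact hinr m ⟨b.1, h⟩ b.2
      · rfl
    rw [h1]
    exact congrFun (Matrix.mulVec_zero encA) x

/-- The coboundaries of the copies of `A` labelled by `L`. -/
noncomputable def copiesCoboundaries (A : BasedComplex X) (L : Finset B₁) (j : ℕ) :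
    Submodule (ZMod 2) (A.Cell j × L → ZMod 2) :=
  ⨅ l : L, (A.levelCoboundaries j).comap (LinearMap.funLeft (ZMod 2) (ZMod 2) fun a => (a, l))

omit [DecidableEq X] [Fintype B₁] [DecidableEq B₁] in
lemma mem_copiesCoboundaries {y : A.Cell j × L → ZMod 2} : y ∈ copiesCoboundaries A L j ↔
    ∀ l : L, (fun a => y (a, l)) ∈ A.levelCoboundaries j := by
  simp only [copiesCoboundaries, Submodule.mem_iInf, Submodule.mem_comap]
  rfl

variable (degM encA A j) in
/-- The encoding of the messages of the copies of `A`, as a representative of the cohomology class. -/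
noncomputable def copiesEncoding (L : Finset B₁) (k : {k : MA // degM k = j} × L → ZMod 2) :
    A.Cell j × L → ZMod 2 :=
  fun p => ((encA.submatrix Subtype.val Subtype.val : Matrix (A.Cell j) _ (ZMod 2)) *ᵥ
    fun m => k (m, p.2)) p.1

open Classical in
/-- After the map `(y, t) ↦ (y + s t, t)`, where `s` is the correction, the input code is the product of a
code on the measured qubits and the copies of the code of `A`. -/
lemma inputCode_enc_glue {V : Type*} (hencA : A.IsEncodingMap degM encA) (hL : L ⊆ M₁)
    {κ : B₁ → B₁ → ZMod 2} (hκ₀ : ∀ b, H *ᵥ κ b = 0)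
    (hκ : ∀ b, ∀ b' ∈ M₁, κ b b' = if b' = b then 1 else 0)
    (pos : (A.tensor (oneDim H)).Cell (j + 1) ↪ V) (bad : Set (Set V))
    (y : A.Cell j × L → ZMod 2)
    (t : (A.tensor (oneDim (removeCells H L))).Cell (j + 1) → ZMod 2)
    (k : {k : MA × (M₀ ⊕ M₁) // productDeg degM M₀ M₁ k = j + 1} → ZMod 2) :
    (inputCode A degM encA H M₀ M₁ (j + 1) pos bad).enc (glue (cellEquiv A H L j) y t) k =
      if t - encodedRest encA H L A k ∈
          (A.tensor (oneDim (removeCells H L))).levelCoboundaries (j + 1) ∧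
        y + correction A H L j κ t - copiesEncoding A degM encA j L
          (k ∘ logicalInclusion degM M₀ M₁ L hL j) ∈ copiesCoboundaries A L j
      then 1 / (Real.sqrt (Nat.card ((A.tensor (oneDim H)).levelCoboundaries (j + 1))) : ℂ) else 0 := by
  have h1 : glue (cellEquiv A H L j) y t -
      (encA ⊗ₖ oneDimEncoding H M₀ M₁).submatrix Subtype.val Subtype.val *ᵥ k =
      glue (cellEquiv A H L j) (y - copiesEncoding A degM encA j L
        (k ∘ logicalInclusion degM M₀ M₁ L hL j)) (t - encodedRest encA H L A k) := by
    funext q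
    obtain ⟨p | u, rfl⟩ := (cellEquiv A H L j).surjective q
    · rw [Pi.sub_apply, glue_inl, glue_inl, encodedCochain_cell, cellEquiv_inl_val,
        encodedCochain_physicalInclusion hL]
      rfl
    · rw [Pi.sub_apply, glue_inr, glue_inr, encodedCochain_cell, cellEquiv_inr_val]
      rfl
  change (if _ then _ else _) = _
  rw [h1]
  refine if_congr ?_ rfl rfl
  rw [glue_mem_levelCoboundaries_iff hL hκ₀ hκ, ← mem_copiesCoboundaries, map_sub,
    correction_encodedRest hencA hL hκ, sub_zero, sub_add_eq_add_sub]

omit [DecidableEq X] [Fintype B₁] [DecidableEq B₁] in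
open Classical in
lemma copiesCode_enc {V : Type*} (pos : A.Cell j × L ↪ V) (bad : Set (Set V))
    (y : A.Cell j × L → ZMod 2) (k : {k : MA // degM k = j} × L → ZMod 2) :
    (copiesCode A degM encA L j pos bad).enc y k =
      if y - copiesEncoding A degM encA j L k ∈ copiesCoboundaries A L j
      then ∏ _l : L, (1 / (Real.sqrt (Nat.card (A.levelCoboundaries j)) : ℂ)) else 0 := by
  have h1 : y - copiesEncoding A degM encA j L k ∈ copiesCoboundaries A L j ↔
      ∀ l ∈ (Finset.univ : Finset L), (fun a => y (a, l)) -
        encA.submatrix Subtype.val Subtype.val *ᵥ (fun m => k (m, l)) ∈ A.levelCoboundaries j := by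
    rw [mem_copiesCoboundaries]
    simp only [Finset.mem_univ, true_imp_iff]
    rfl
  simp only [copiesCode, encodingIsometry, Matrix.of_apply]
  rw [Finset.prod_ite_zero]
  by_cases h2 : y - copiesEncoding A degM encA j L k ∈ copiesCoboundaries A L j
  · rw [if_pos h2, if_pos (h1.1 h2)]
  · rw [if_neg h2, if_neg fun h => h2 (h1.2 h)]

omit [DecidableEq X] [Fintype B₁] [DecidableEq B₁] in
lemma prod_normalization_ne_zero :
    ∏ _l : L, (1 / (Real.sqrt (Nat.card (A.levelCoboundaries j)) : ℂ)) ≠ 0 := by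
  refine Finset.prod_ne_zero_iff.2 fun l _ => one_div_ne_zero ?_
  rw [Complex.ofReal_ne_zero, Real.sqrt_ne_zero']
  exact Nat.cast_pos.2 Nat.card_pos

end Logical

/-! ### Decoding and the induced correction -/

section Recovery

variable {X B₀ B₁ V : Type*} [Fintype X] [DecidableEq X] [Fintype B₀] [DecidableEq B₀] [Fintype B₁]
  [DecidableEq B₁]

/-- The part on `A^j × L` of the coboundary in `A ⊗ B` of a cochain of `A ⊗ B_L̄`. -/
def spill (A : BasedComplex X) (H : Matrix B₀ B₁ (ZMod 2)) (L : Finset B₁) (j : ℕ) :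
    (X × (B₀ ⊕ {b // b ∉ L}) → ZMod 2) →ₗ[ZMod 2] (A.Cell j × L → ZMod 2) where
  toFun c p := ∑ b₀, H b₀ p.2 * c (p.1.1, Sum.inl b₀)
  map_add' c c' := by funext p; simp [mul_add, Finset.sum_add_distrib]
  map_smul' a c := by
    funext p
    simp only [Pi.smul_apply, smul_eq_mul, RingHom.id_apply, Finset.mul_sum]
    exact Finset.sum_congr rfl fun b _ => by ring

variable {A : BasedComplex X} {H : Matrix B₀ B₁ (ZMod 2)} {M₁ L : Finset B₁} {j : ℕ}

/-- The correction computed from a coboundary of `A ⊗ B_L̄` acts on the copies of `A` as its spill, up to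
coboundaries. -/
lemma correction_add_spill_mem (hL : L ⊆ M₁) {κ : B₁ → B₁ → ZMod 2} (hκ₀ : ∀ b, H *ᵥ κ b = 0)
    (hκ : ∀ b, ∀ b' ∈ M₁, κ b b' = if b' = b then 1 else 0)
    {t : (A.tensor (oneDim (removeCells H L))).Cell (j + 1) → ZMod 2}
    {c : X × (B₀ ⊕ {b // b ∉ L}) → ZMod 2}
    (ht : ∀ u, t u = (A.tensor (oneDim (removeCells H L))).coboundary c u.1) :
    correction A H L j κ t + spill A H L j c ∈ copiesCoboundaries A L j := by
  set c' : X × (B₀ ⊕ B₁) → ZMod 2 := Function.extend (inc L) c 0 with hc'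
  have hinc : c' ∘ inc L = c := funext fun x => (inc_injective L).extend_apply c 0 x
  have hzero : ∀ (x : X) (l : L), c' (x, Sum.inr l.1) = 0 := by
    intro x l
    refine Function.extend_apply' _ _ _ ?_
    rintro ⟨⟨x', b | b⟩, h⟩
    · simp at h
    · simp only [inc_inr, Prod.mk.injEq, Sum.inr.injEq] at h
      exact b.2 (h.2 ▸ l.2)
  have ht' : t = fun u => (A.tensor (oneDim H)).coboundary c' (inc L u.1) := by
    funext u
    rw [ht, ← coboundary_inc, hinc]
  refine mem_copiesCoboundaries.2 fun l => (mem_levelCoboundaries _).2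
    ⟨contract (κ l) c', fun a => ?_⟩
  have h1 : (A.tensor (oneDim H)).coboundary c' (a.1, Sum.inr l.1) = spill A H L j c (a, l) := by
    rw [tensor_coboundary_inr]
    simp only [hzero]
    refine (congrArg₂ (· + ·) (congrFun (coboundary_zero A) a.1) ?_).trans (zero_add _)
    refine Finset.sum_congr rfl fun b₀ _ => ?_
    rw [← hinc]
    rfl
  rw [Pi.add_apply, ht', correction_coboundary hL hκ₀ hκ, h1, add_comm, ← add_assoc,
    CharTwo.add_self_eq_zero, zero_add]

variable (A H L j) in
/-- The syndrome of an error on the measured qubits: its coboundary in `A ⊗ B_L̄`. -/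
def syndrome : ((A.tensor (oneDim (removeCells H L))).Cell (j + 1) → ZMod 2) →ₗ[ZMod 2]
    (X × (B₀ ⊕ {b // b ∉ L}) → ZMod 2) :=
  (A.tensor (oneDim (removeCells H L))).bdᵀ.mulVecLin ∘ₗ extend _ (j + 1)

lemma syndrome_apply (t : (A.tensor (oneDim (removeCells H L))).Cell (j + 1) → ZMod 2) :
    syndrome A H L j t =
      (A.tensor (oneDim (removeCells H L))).coboundary (extend _ (j + 1) t) := rfl

open Classical in
/-- An error with the given syndrome among those that satisfy `E`, if there is one. -/
noncomputable def plausibleError {Y W : Type*} (syn : (Y → ZMod 2) → W) (E : (Y → ZMod 2) → Prop)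
    (σ : W) : Y → ZMod 2 :=
  if h : ∃ t, syn t = σ ∧ E t then h.choose else 0

lemma plausibleError_spec {Y W : Type*} {syn : (Y → ZMod 2) → W} {E : (Y → ZMod 2) → Prop}
    {t : Y → ZMod 2} (ht : E t) :
    syn (plausibleError syn E (syn t)) = syn t ∧ E (plausibleError syn E (syn t)) := by
  have h : ∃ t', syn t' = syn t ∧ E t' := ⟨t, rfl, ht⟩
  rw [plausibleError, dif_pos h]
  exact h.choose_spec

variable {w m : ℕ} {I : Set ℕ} {G : SimpleGraph V}

/-- The positions of the basis elements above a given one. -/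
def above {I : Set ℕ} (φ : {c // (A.tensor (oneDim H)).deg c ∈ I} ↪ V) (x : X × (B₀ ⊕ B₁)) : Set V :=
  φ '' {y | (A.tensor (oneDim H)).Below x y.1}

lemma ncard_above_le (hw : (A.tensor (oneDim H)).HasLocality w)
    (φ : {c // (A.tensor (oneDim H)).deg c ∈ I} ↪ V) (x : X × (B₀ ⊕ B₁)) :
    (above φ x).ncard ≤ w := by
  rw [above, Set.ncard_image_of_injective _ φ.injective,
    ← Set.ncard_image_of_injective _ Subtype.val_injective]
  refine (Set.ncard_le_ncard ?_ (Set.toFinite _)).trans (hw x)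
  rintro _ ⟨y, hy, rfl⟩
  exact Or.inr hy

lemma adj_of_mem_above {r : ℕ} {φ : {c // (A.tensor (oneDim H)).deg c ∈ I} ↪ V}
    (hφ : ∀ c c', ((A.tensor (oneDim H)).connectivityGraph r I).Adj c c' → G.Adj (φ c) (φ c'))
    {c₀ : X × (B₀ ⊕ B₁)} (hc₀ : (A.tensor (oneDim H)).deg c₀ = 0) {a b : V} (ha : a ∈ above φ c₀)
    (hb : b ∈ above φ c₀) (hab : a ≠ b) : G.Adj a b := by
  obtain ⟨y, hy, rfl⟩ := ha
  obtain ⟨z, hz, rfl⟩ := hb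
  exact hφ y z ⟨fun h => hab (congrArg φ h), Or.inl ⟨c₀, hc₀, hy, hz⟩⟩

variable [Finite V]

/-- An error of vanishing syndrome on the measured qubits whose support avoids the bad sets is a
coboundary of `A ⊗ B_L̄`, and the correction that it induces is, up to coboundaries of the copies of `A`,
supported on a set that avoids the bad sets for a larger density. -/
lemma exists_correction_equivalent {r : ℕ} (hj : j + 1 ∈ I) (hj' : j + 2 ∈ I)
    (hw : (A.tensor (oneDim H)).HasLocality w) (hw0 : 0 < w)
    (hdec : (A.tensor (oneDim (removeCells H L))).HasErrorFlipDecoder (j + 1) m)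
    (hbelow : ∀ c, (A.tensor (oneDim (removeCells H L))).deg c = j + 1 →
      ∃ c₀, (A.tensor (oneDim (removeCells H L))).deg c₀ = 0 ∧
        (A.tensor (oneDim (removeCells H L))).Below c₀ c)
    (φ : {c // (A.tensor (oneDim H)).deg c ∈ I} ↪ V)
    (hφ : ∀ c c', ((A.tensor (oneDim H)).connectivityGraph r I).Adj c c' → G.Adj (φ c) (φ c'))
    (pos : (A.tensor (oneDim H)).Cell (j + 1) ↪ V)
    (hpos : ∀ q, pos q = φ ⟨q.1, by rw [q.2]; exact hj⟩)
    (hL : L ⊆ M₁) {κ : B₁ → B₁ → ZMod 2} (hκ₀ : ∀ b, H *ᵥ κ b = 0)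
    (hκ : ∀ b, ∀ b' ∈ M₁, κ b b' = if b' = b then 1 else 0)
    {η γ : ℝ} (hη : 0 < η) (hηm : η ≤ m) (hγ : 0 < γ) (hγw : 2 * w * γ ≤ 1 / 2)
    {t : (A.tensor (oneDim (removeCells H L))).Cell (j + 1) → ZMod 2}
    (ht : syndrome A H L j t = 0)
    (htG : Avoiding (badSets G η γ)
      ((fun u => pos (cellEquiv A H L j (Sum.inr u))) '' {u | t u ≠ 0})) :
    t ∈ (A.tensor (oneDim (removeCells H L))).levelCoboundaries (j + 1) ∧
      ∃ α, correction A H L j κ t + α ∈ copiesCoboundaries A L j ∧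
        Avoiding (badSets G η (2 * (2 * w) * γ))
          ((fun p => pos (cellEquiv A H L j (Sum.inl p))) '' {p | α p ≠ 0}) := by
  have hmem : ∀ (x : X × (B₀ ⊕ B₁)) (q : (A.tensor (oneDim H)).Cell (j + 1)),
      (A.tensor (oneDim H)).Below x q.1 → pos q ∈ above φ x :=
    fun x q h => ⟨⟨q.1, by rw [q.2]; exact hj⟩, h, (hpos q).symm⟩
  have key := exists_coboundary_eq_of_avoiding (K := A.tensor (oneDim (removeCells H L)))
    (pos := fun u => pos (cellEquiv A H L j (Sum.inr u))) (star := fun c₀ => above φ (inc L c₀))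
    (up := fun u => above φ (inc L u.1)) (D := spill A H L j)
    (posD := fun p => pos (cellEquiv A H L j (Sum.inl p))) (G := G) hw0 hdec
    (fun c₀ => ncard_above_le hw φ _)
    (fun c₀ hc₀ a ha b hb hab => adj_of_mem_above hφ ((deg_inc A H L c₀).trans hc₀) ha hb hab)
    (fun c₀ u hu => hmem _ _ (below_inc A H L hu)) ?_
    (pos.injective.comp ((cellEquiv A H L j).injective.comp Sum.inr_injective))
    (fun u => ncard_above_le hw φ _) (fun u => hmem _ _ Relation.ReflTransGen.refl) ?_ ?_
    hη hηm hγ hγw t ht htG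
  · obtain ⟨c, hc, hct, hcG⟩ := key
    refine ⟨(mem_levelCoboundaries_succ _).2 ⟨c, hc, hct.symm⟩, spill A H L j c,
      correction_add_spill_mem hL hκ₀ hκ fun u => ?_, hcG⟩
    rw [hct, zeroExtend_coe]
  · intro c₀ c _ hc₀ p hp
    obtain ⟨b₀, -, hb₀⟩ := Finset.exists_ne_zero_of_sum_ne_zero (show (∑ _, _) ≠ _ from hp)
    refine hmem _ _ ((below_inc A H L (hc₀ _ (right_ne_zero_of_mul hb₀))).tail ?_)
    rw [inc_inl, cellEquiv_inl_val, tensor_bd]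
    simpa using left_ne_zero_of_mul hb₀
  · rintro u _ ⟨y, hy, rfl⟩ hne
    obtain ⟨c₀, hc₀, hc₀u⟩ := hbelow u.1 u.2
    have h1 := below_inc A H L hc₀u
    exact adj_of_mem_above hφ ((deg_inc A H L c₀).trans hc₀) (hmem _ _ h1)
      ⟨y, h1.trans hy, rfl⟩ (Ne.symm hne)
  · intro u u' y hu hu'
    have hdeg : (A.tensor (oneDim H)).deg (inc L y) ∈ I := by
      rw [deg_inc, (A.tensor (oneDim (removeCells H L))).bd_deg _ _ hu, u.2]
      exact hj'
    have hbel : ∀ u : (A.tensor (oneDim (removeCells H L))).Cell (j + 1),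
        (A.tensor (oneDim (removeCells H L))).bd u.1 y ≠ 0 →
        φ ⟨inc L y, hdeg⟩ ∈ above φ (inc L u.1) := fun u hu =>
      ⟨_, below_inc A H L (Relation.ReflTransGen.single hu), rfl⟩
    exact ⟨_, hbel u hu, hbel u' hu'⟩

end Recovery

/-! ### The gadget -/

/-- If the space-time support of a fault avoids the copies of the bad sets, then the support of each of
its steps avoids the bad sets. -/
lemma Avoiding.fault_step {Q V : Type*} {E : Set (Set V)} {F : PauliFault Q 2} {pos : Q ↪ V}
    (h : Avoiding (copies 2 E) ((fun p => (pos p.1, p.2)) '' F.support)) (t : Fin 2) :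
    Avoiding E (pos '' Pauli.support (F.left t) (F.right t)) := by
  intro S hS hsub
  refine h (S ×ˢ {t}) ⟨t, S, hS, rfl⟩ ?_
  rintro ⟨v, t'⟩ ⟨hv, rfl⟩
  obtain ⟨q, hq, rfl⟩ := hsub hv
  exact ⟨(q, t'), hq, rfl⟩

lemma exists_measureAndCorrect_gate_zero {P U Q : Type*} [Fintype P] [Fintype U] [Fintype Q]
    [DecidableEq P] [DecidableEq U] [DecidableEq Q] (e : P ⊕ U ≃ Q)
    (f : (U → ZMod 2) → (P → ZMod 2)) (u : U) :
    ∃ g, (measureAndCorrect e f).gate 0 g = .measure .Z (by simp) (e (Sum.inr u)) :=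
  ⟨Fintype.equivFin U u, by simp [measureAndCorrect]⟩

theorem proposition5p1
    {X MA B₀ B₁ V : Type*} [Fintype X] [DecidableEq X] [Fintype MA] [DecidableEq MA]
    [Fintype B₀] [DecidableEq B₀] [Fintype B₁] [DecidableEq B₁] [Fintype V]
    -- The input code lives at level `i = j + 1`, where `2 ≤ i ≤ r - 1`.
    (r j w m : ℕ) (hj : 1 ≤ j) (hjr : j + 2 ≤ r)
    -- The `(r-1)`-dimensional complex `A` with its encoding map.
    (A : BasedComplex X) (hA : ∀ a, A.deg a + 1 ≤ r)
    (degM : MA → ℕ) (encA : Matrix X MA (ZMod 2)) (hencA : A.IsEncodingMap degM encA)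
    -- The 1-dimensional complex `B = oneDim H`, its information sets, and `L ⊆ M₁`.
    (H : Matrix B₀ B₁ (ZMod 2)) (M₀ : Finset B₀) (M₁ : Finset B₁)
    (hM₀ : IsInformationSet (LinearMap.ker Hᵀ.mulVecLin) M₀)
    (hM₁ : IsInformationSet (LinearMap.ker H.mulVecLin) M₁)
    (L : Finset B₁) (hL : L ⊆ M₁)
    -- `C = A ⊗ B` has locality `w`.
    (hw : (A.tensor (BasedComplex.oneDim H)).HasLocality w)
    -- The restricted complex `A ⊗ B_L̄` has a small-set flip decoder, and its basis elements of
    -- degrees `i - 1` and `i` lie above basis elements of degree `0`.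
    (hdec : (A.tensor (BasedComplex.oneDim (removeCells H L))).HasSmallSetFlipDecoder (j + 1) m 0)
    (hbelow : ∀ c, (A.tensor (BasedComplex.oneDim (removeCells H L))).deg c ∈ ({j, j + 1} : Set ℕ) →
      ∃ c₀, (A.tensor (BasedComplex.oneDim (removeCells H L))).deg c₀ = 0 ∧
        (A.tensor (BasedComplex.oneDim (removeCells H L))).Below c₀ c)
    -- A graph that contains the connectivity graph of `C` on levels `i - 1, i, i + 1`.
    (G : SimpleGraph V)
    (φ : {c // (A.tensor (BasedComplex.oneDim H)).deg c ∈ ({j, j + 1, j + 2} : Set ℕ)} ↪ V)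
    (hφ : ∀ c c', ((A.tensor (BasedComplex.oneDim H)).connectivityGraph r {j, j + 1, j + 2}).Adj c c' →
      G.Adj (φ c) (φ c'))
    (η γ : ℝ) (hη : 0 < η) (hγ : 0 < γ) (hηm : η ≤ m)
    (hηd : ENNReal.ofReal η ≤
      (A.tensor (BasedComplex.oneDim (removeCells H L))).systolicDistance (j + 1))
    (hηA : ENNReal.ofReal η ≤ A.systolicDistance j)
    (hγw : γ ≤ 1 / (150 * (w : ℝ) ^ 7)) :
    -- The positions of the physical qubits `C^i` in the graph.
    let pos : (A.tensor (BasedComplex.oneDim H)).Cell (j + 1) ↪ V :=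
      (cellInclusion _ (by simp)).trans φ
    let out := physicalInclusion A H L j
    ∃ (M : ℕ) (Q : AdaptiveCliffordCircuit ((A.tensor (BasedComplex.oneDim H)).Cell (j + 1)) M 2),
      -- First step: measure `Z` on exactly the qubits outside `A^(i-1) × L`.
      (∀ g, ∃ q, q ∉ Set.range out ∧ Q.gate 0 g = .measure .Z (by simp) q) ∧
      (∀ q, q ∉ Set.range out → ∃ g, Q.gate 0 g = .measure .Z (by simp) q) ∧
      -- Second step: classically controlled `X` gates on qubits in `A^(i-1) × L`.
      (∀ g, ∃ q, q ∈ Set.range out ∧ Q.gate 1 g = .pauli .X q) ∧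
      IsPauliFaultTolerantGadget Q pos (copies 2 (badSets G η γ))
        (inputCode A degM encA H M₀ M₁ (j + 1) pos (badSets G η γ))
        (Function.Embedding.refl _)
        (copiesCode A degM encA L j (out.trans pos) (badSets G η (300 * (w : ℝ) ^ 7 * γ)))
        out
        (keepQubits (logicalInclusion degM M₀ M₁ L hL j)) := by
  classical
  intro pos out
  obtain ⟨κ, hκ'⟩ := exists_indicator_codewords hM₁.1
  have hκ₀ : ∀ b, H *ᵥ κ b = 0 := fun b => LinearMap.mem_ker.1 (hκ' b).1
  have hκ := fun b => (hκ' b).2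
  set e := cellEquiv A H L j with he
  let C := A.tensor (BasedComplex.oneDim H)
  let CL := A.tensor (BasedComplex.oneDim (removeCells H L))
  let E : (CL.Cell (j + 1) → ZMod 2) → Prop := fun t =>
    Avoiding (badSets G η γ) ((fun u => pos (e (Sum.inr u))) '' {u | t u ≠ 0})
  let dec := plausibleError (syndrome A H L j) E
  have hout : ∀ p, out p = e (Sum.inl p) := fun p => rfl
  have hrange : ∀ u, e (Sum.inr u) ∉ Set.range out := by
    rintro u ⟨p, hp⟩
    exact Sum.inl_ne_inr (e.injective ((hout p).symm.trans hp))
  -- The numerical consequences of the bound on `γ`.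
  have hw0 : 0 < w := by
    rcases Nat.eq_zero_or_pos w with rfl | h
    · norm_num at hγw
      exact absurd hγ (not_lt.2 hγw)
    · exact h
  have hw1 : (1 : ℝ) ≤ w := by exact_mod_cast hw0
  have hw7 : (w : ℝ) ≤ (w : ℝ) ^ 7 := le_self_pow₀ hw1 (by norm_num)
  have hγ7 : γ * (w : ℝ) ^ 7 ≤ 1 / 150 := by
    rw [le_div_iff₀ (by positivity)] at hγw
    linarith
  have hγw1 : γ * w ≤ γ * (w : ℝ) ^ 7 := mul_le_mul_of_nonneg_left hw7 hγ.le
  have hγ1 : γ ≤ γ * w := le_mul_of_one_le_right hγ.le hw1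
  have hposφ : ∀ q, pos q = φ ⟨q.1, by rw [q.2]; simp⟩ := fun q => rfl
  refine ⟨_, measureAndCorrect e fun t => correction A H L j κ (t + dec (syndrome A H L j t)),
    fun g => ⟨_, hrange _, rfl⟩, ?_, fun g => ⟨_, ⟨_, rfl⟩, rfl⟩, ?_⟩
  · intro q hq
    obtain ⟨p | u, rfl⟩ := e.surjective q
    · exact absurd ⟨p, rfl⟩ hq
    · exact exists_measureAndCorrect_gate_zero e _ u
  intro l ρ _ _ σ hσ F hF
  obtain ⟨a, b, hab, c₀, hσ⟩ := hσ
  have hF₀ := hF.fault_step 0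
  have hF₁ := hF.fault_step 1
  replace hab : Avoiding (badSets G η γ) (pos '' Pauli.support a b) := hab
  set S := pos '' Pauli.support a b ∪ pos '' Pauli.support (F.left 0) (F.right 0) ∪
    pos '' Pauli.support (F.left 1) (F.right 1) with hS
  have hSG : Avoiding (badSets G η (γ + γ + γ)) S := (hab.union hη hF₀).union hη hF₁
  have hSI : ∀ q, pos q ∉ S → (a q = .I ∧ b q = .I) ∧ (F.left 0 q = .I ∧ F.right 0 q = .I) ∧
      (F.left 1 q = .I ∧ F.right 1 q = .I) := by
    intro q hq
    have hI : ∀ A B : _ → Pauli, pos q ∉ pos '' Pauli.support A B → A q = .I ∧ B q = .I := by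
      intro A B h
      by_contra hne
      exact h ⟨q, by rw [Pauli.support, Set.mem_ofPred_eq]; tauto, rfl⟩
    exact ⟨hI _ _ fun h => hq (Or.inl (Or.inl h)), hI _ _ fun h => hq (Or.inl (Or.inr h)),
      hI _ _ fun h => hq (Or.inr h)⟩
  -- The decoder finds the flips of the input deviation up to coboundaries.
  have hrec : ∀ A' : C.Cell (j + 1) → Pauli, (∀ q, A' q ≠ .I → pos q ∈ pos '' Pauli.support a b) →
      rightPart e (flips A') + dec (syndrome A H L j (rightPart e (flips A'))) ∈
          CL.levelCoboundaries (j + 1) ∧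
        ∃ α, correction A H L j κ
            (rightPart e (flips A') + dec (syndrome A H L j (rightPart e (flips A')))) + α ∈
              copiesCoboundaries A L j ∧
          Avoiding (badSets G η (2 * (2 * w) * (γ + γ)))
            ((fun p => pos (e (Sum.inl p))) '' {p | α p ≠ 0}) := by
    intro A' hA'
    set t := rightPart e (flips A') with ht
    have htE : E t := by
      refine hab.mono ?_
      rintro _ ⟨u, hu, rfl⟩
      exact hA' _ fun h => hu (Pauli.flip_eq_zero_of_eq_I h)
    obtain ⟨hsyn, hdecE⟩ := plausibleError_spec (syn := syndrome A H L j) htE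
    refine exists_correction_equivalent (G := G) (r := r) (I := {j, j + 1, j + 2}) (by simp) (by simp)
      hw hw0 hdec.1 (fun c hc => hbelow c (by simp [hc])) φ hφ pos hposφ hL hκ₀ hκ hη hηm
      (add_pos hγ hγ) (by linarith) ?_ ?_
    · change syndrome A H L j (t + plausibleError _ _ _) = 0
      rw [map_add, hsyn]
      exact vec_add_self _
    · refine (Avoiding.union hη htE hdecE).mono ?_
      rintro _ ⟨u, hu, rfl⟩
      by_cases htu : t u = 0
      · refine Or.inr ⟨u, fun h => hu ?_, rfl⟩
        rw [Pi.add_apply, htu, zero_add]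
        exact h
      · exact Or.inl ⟨u, htu, rfl⟩
  obtain ⟨hd, α, hα, hαG⟩ := hrec a fun q hq => ⟨q, Or.inl hq, rfl⟩
  obtain ⟨hd', α', hα', hαG'⟩ := hrec b fun q hq => ⟨q, Or.inr hq, rfl⟩
  have hσ' : ∑ x, σ x = c₀ • withRef (Fin l → ZMod 2) (Pauli.superop a b)
      (withRef (Fin l → ZMod 2) (inputCode A degM encA H M₀ M₁ (j + 1) pos
        (badSets G η γ)).encChannel ρ) := by
    rw [← hσ]
    ext x y
    rw [withRef_apply, keepQubits_refl]
    rfl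
  have hmain := exists_output_deviation e out hout
    (inputCode A degM encA H M₀ M₁ (j + 1) pos (badSets G η γ))
    (copiesCode A degM encA L j (out.trans pos) (badSets G η (300 * (w : ℝ) ^ 7 * γ)))
    (logicalInclusion degM M₀ M₁ L hL j) (CL.levelCoboundaries (j + 1)) (copiesCoboundaries A L j)
    (correction A H L j κ) (encodedRest encA H L A) (copiesEncoding A degM encA j L) _ _
    prod_normalization_ne_zero (fun y t k => inputCode_enc_glue hencA hL hκ₀ hκ _ _ y t k)
    (fun y k => copiesCode_enc _ _ y k) ?_ ?_ (syndrome A H L j) ?_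
    (coboundary_extend_encodedRest hencA hM₀.1) dec a b F α α' hd hd' hα hα' ?_ ρ σ c₀ hσ'
  · obtain ⟨c, hc⟩ := hmain
    refine ⟨_, _, ?_, c, hc⟩
    refine Avoiding.of_le hη ?_ (((hSG.union hη hαG).union hη hαG').mono ?_)
    · have : (300 * (w : ℝ) ^ 7 * γ) = 300 * (γ * (w : ℝ) ^ 7) := by ring
      nlinarith
    · rintro _ ⟨p, hp, rfl⟩
      by_cases hpS : pos (out p) ∈ S
      · exact Or.inl (Or.inl hpS)
      by_cases hαp : α p = 0
      · by_cases hαp' : α' p = 0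
        · obtain ⟨⟨h1, h2⟩, ⟨h3, h4⟩, h5, h6⟩ := hSI _ hpS
          rw [hout] at h1 h2 h3 h4 h5 h6
          simp [Pauli.support, leftPart, flips, signs, h1, h2, h3, h4, h5, h6, hαp, hαp',
            Pauli.flip_eq_zero_of_eq_I, Pauli.sign_eq_zero_of_eq_I, Pauli.ofBits_zero] at hp
        · exact Or.inr ⟨p, hαp', rfl⟩
      · exact Or.inl (Or.inr ⟨p, hαp, rfl⟩)
  · intro k k' hk q hq
    rw [← encodedRest_sub] at hk
    exact sub_eq_zero.1 (eq_zero_of_encodedRest_mem hencA hM₀.1 hL hκ₀ hκ hk q hq)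
  · intro k k' hk
    rw [← encodedRest_sub, encodedRest_eq_zero hL (k := k - k') fun q hq => sub_eq_zero.2 (hk q hq)]
    exact Submodule.zero_mem _
  · intro t ht
    obtain ⟨c, -, hc⟩ := (BasedComplex.mem_levelCoboundaries_succ _).1 ht
    rw [syndrome_apply, hc, BasedComplex.coboundary_coboundary]
  · intro hker k
    rw [correction_encodedRest hencA hL hκ, dotProduct_zero, zero_add]
    have h1 := dotProduct_encodedCochain_eq_zero_of_avoiding (V := V) (G := G) hencA hM₀.1 hL hκ₀ hκ
      hηd hηA (fun c hc => hbelow c (by simp [hc])) pos ?_ hη (γ := γ + γ + γ) (by linarith)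
      (glue e (leftPart e (signs a + signs (F.left 0) + (signs b + signs (F.right 0))))
        (rightPart e (signs a + signs (F.left 0) + signs (F.left 1) +
          (signs b + signs (F.right 0) + signs (F.right 1))))) (hSG.mono ?_) ?_ k
    · rwa [rightPart_glue] at h1
    · intro q q' hqq c₀ hc₀ hq hq'
      exact hφ _ _ ⟨fun h => hqq (Subtype.ext (congrArg (fun c => c.1) h)),
        Or.inl ⟨c₀, hc₀, hq, hq'⟩⟩
    · rintro _ ⟨q, hq, rfl⟩
      by_contra hqS
      obtain ⟨⟨h1, h2⟩, ⟨h3, h4⟩, h5, h6⟩ := hSI q hqS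
      obtain ⟨p | u, rfl⟩ := e.surjective q
      · simp [leftPart, signs, h1, h2, h3, h4, Pauli.sign_eq_zero_of_eq_I] at hq
      · simp [rightPart, signs, h1, h2, h3, h4, h5, h6, Pauli.sign_eq_zero_of_eq_I] at hq
    · intro t ht
      rw [leftPart_glue, rightPart_glue]
      exact hker t ht
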